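/- Setting. Let $X=(X_k\,\vdots\,X_{\setminus k})$ be an $n\times(p_k+q)$ real matrix of full column rank, where $X_k$ has $p_k\ge1$ columns and $X_{\setminus k}$ has $q\ge1$ columns ($p=p_k+q$). The full model is $y\sim N(X\beta,\sigma^2I)$ and the submodel is $y\sim N(X_k\beta_k^*,\sigma_k^2I)$. For $g,d,a>0$, $\mathrm{NIGa}(b,V,d,a)$ denotes the law of $(\beta,\sigma^2)$ with $\beta\mid\sigma^2\sim N(b,\sigma^2V)$ and $\sigma^2$ inverse gamma with shape $d/2$ and scale $a/2$. The prior on $(\beta,\sigma^2)$ is $\mathrm{NIGa}(b,g(X^TX)^{-1},d,a)$ with $b=(b_k,b_{\setminus k})$; $E$ and $\mathrm{Var}$ refer to this prior. The KL-prior on $(\beta_k^*,\sigma_k^2)$ is the law, under this prior, of the minimizer of $KL(N(X\beta,\sigma^2I),N(X_k\beta_k^*,\sigma_k^2I))$ over $(\beta_k^*,\sigma_k^2)$, $\sigma_k^2>0$. A KL-conjugate approximation is a law $\mathrm{NIGa}(b',g'(X_k^TX_k)^{-1},d',a')$ with $g',d',a'>0$ that minimizes, among all laws of this form, the Kullback–Leibler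 divergence $KL(\text{KL-prior},\,\cdot\,)$. Put $Q_k(\beta)=\frac1n\beta^TX^T(I-X_k(X_k^TX_k)^{-1}X_k^T)X\beta$, $R_k=(1+Q_k(\beta)/\sigma^2)^{-1}$, and let $\psi=(\log\Gamma)'$ be the digamma function. (0) $R_k$, $R_k/\sigma^2$ and $\log R_k$ are integrable, $R_k^{-1}$ is square integrable, and $$E[R_k^{-1}]=1+\tfrac gn q+Q_k(b)\tfrac da,\qquad \mathrm{Var}[R_k^{-1}]=\tfrac{2d}{a}Q_k(b)\Big[\tfrac{Q_k(b)}{a}+\tfrac{2g}{n}\Big]+\tfrac{2g^2}{n^2}q .$$ (1) If $b_{\setminus k}=0$, there is exactly one KL-conjugate approximation; its hyperparameters $(b_k^{KL},g_k^{KL},d_k^{KL},a_k^{KL})$ are the unique solution (with $g_k^{KL},d_k^{KL},a_k^{KL}>0$) of $$b_k^{KL}=b_k,\quad g_k^{KL}=g\,E[R_k],\quad a_k^{KL}=d_k^{KL}\frac ad\frac1{E[R_k]},$$ $$\psi(d_k^{KL}/2)-\log(d_k^{KL}/2)=\psi(d/2)-\log(d/2)+E[\log R_k]-\log E[R_k],$$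 and $E[R_k]=(2g/n)^{-q/2}e^{n/(2g)}\,\Gamma(1-\frac q2;\frac n{2g})$ with $\Gamma(\alpha;z)=\int_z^\infty e^{-t}t^{\alpha-1}dt$. (2) If $b_{\setminus k}\ne0$, there is exactly one KL-conjugate approximation, and its hyperparameters are approximately the solution of the system $$b'=b_k+(X_k^TX_k)^{-1}X_k^TX_{\setminus k}b_{\setminus k},\quad g'=\frac g{E[R_k^{-1}]},\quad a'=d'\frac ad E[R_k^{-1}],$$ $$\psi(d'/2)-\log(d'/2)=\psi(d/2)-\log(d/2)-\frac12\frac{\mathrm{Var}[R_k^{-1}]}{E[R_k^{-1}]^2},$$ which itself has exactly one solution with $g',d',a'>0$. Precisely: the hyperparameters of the KL-conjugate approximation are characterized by the exact equations $b_k^{KL}=b'$, $g_k^{KL}=gE[R_k]$, $a_k^{KL}=d_k^{KL}/E[R_k/\sigma^2]$, $\psi(d_k^{KL}/2)-\log(a_k^{KL}/2)=\psi(d/2)-\log(a/2)+E[\log R_k]$; and, with $c=\sqrt{\mathrm{Var}[R_k^{-1}]}/E[R_k^{-1}]$ the coefficient of variation of $R_k^{-1}$, there are constants $C,\delta>0$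 depending only on $d$ and $q$ such that, whenever $c\le\delta$, the delta-method replacements that turn the exact equations into the displayed system satisfy $$\big|E[R_k]E[R_k^{-1}]-1\big|\le Cc^2,\quad \Big|\frac{E[R_k/\sigma^2]}{E[R_k]\,E[1/\sigma^2]}-1\Big|\le Cc\ \ (E[1/\sigma^2]=d/a),\quad \Big|E[\log R_k]-\log E[R_k]+\tfrac12c^2\Big|\le Cc^3,$$ and the hyperparameters satisfy $b_k^{KL}=b'$, $|g_k^{KL}/g'-1|\le Cc^2$, $|a_k^{KL}/a'-1|\le Cc$, $|d_k^{KL}/d'-1|\le Cc$. -/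

import Mathlib

open MeasureTheory ProbabilityTheory InformationTheory Matrix

noncomputable section

namespace GPrior

/-- The digamma function `ψ(α) = (d/dα) log Γ(α)`. -/
def digamma (x : ℝ) : ℝ := deriv (fun t : ℝ => Real.log (Real.Gamma t)) x

/-- The upper incomplete gamma function `Γ(α; z) = ∫_z^∞ exp(-t) t^(α-1) dt`. -/
def upperGamma (α z : ℝ) : ℝ := ∫ t in Set.Ioi z, Real.exp (-t) * t ^ (α - 1)

/-- Density of the multivariate normal law `N(m, S)` (for positive definite `S`) with respect to
Lebesgue measure. -/
def normalPDF {ι : Type*} [Fintype ι] [DecidableEq ι] (m : ι → ℝ) (S : Matrix ι ι ℝ)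
    (x : ι → ℝ) : ℝ :=
  (Real.sqrt ((2 * Real.pi) ^ Fintype.card ι * S.det))⁻¹ *
    Real.exp (-(1 / 2) * ((x - m) ⬝ᵥ (S⁻¹ *ᵥ (x - m))))

/-- Density of the inverted gamma law `IGa(α, β)`, that is, of `1 / T` where `T` has the gamma law
with shape `α` and rate `β`. -/
def invGammaPDF (α β s : ℝ) : ℝ :=
  if 0 < s then β ^ α / Real.Gamma α * s ^ (-α - 1) * Real.exp (-(β / s)) else 0

/-- The normal inverted gamma law `NIGa(b, V, d, a)` of a pair `(β, σ²)`: `β` given `σ²` is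
`N(b, σ² V)` and `σ²` is `IGa(d/2, a/2)`. -/
def NIGa {ι : Type*} [Fintype ι] [DecidableEq ι] (b : ι → ℝ) (V : Matrix ι ι ℝ) (d a : ℝ) :
    Measure ((ι → ℝ) × ℝ) :=
  (volume : Measure ((ι → ℝ) × ℝ)).withDensity fun θ =>
    ENNReal.ofReal (normalPDF b (θ.2 • V) θ.1 * invGammaPDF (d / 2) (a / 2) θ.2)

/-- The sampling law `N(Xβ, s I)` of the observation vector in the linear model `y = Xβ + ε` with
`ε ~ N(0, s I)`. -/
def sampling {n : ℕ} {ι : Type*} [Fintype ι] (X : Matrix (Fin n) ι ℝ) (θ : (ι → ℝ) × ℝ) :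
    Measure (Fin n → ℝ) :=
  (volume : Measure (Fin n → ℝ)).withDensity fun y =>
    ENNReal.ofReal (normalPDF (X *ᵥ θ.1) (θ.2 • (1 : Matrix (Fin n) (Fin n) ℝ)) y)

/-- The data of the problem: a design matrix `X = (X_k ⋮ X_{\k})` of full column rank with `k`
columns retained by the submodel and `q` columns excluded, and the hyperparameters
`b = (b_k, b_{\k})`, `g`, `d`, `a` of the prior `NIGa(b, g (XᵀX)⁻¹, d, a)` on the full model. -/
structure Setting (n k q : ℕ) where
  /-- the columns retained by the submodel -/
  Xk : Matrix (Fin n) (Fin k) ℝ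
  /-- the columns excluded from the submodel -/
  Xc : Matrix (Fin n) (Fin q) ℝ
  /-- prior mean of the retained coefficients -/
  bk : Fin k → ℝ
  /-- prior mean of the excluded coefficients -/
  bc : Fin q → ℝ
  g : ℝ
  d : ℝ
  a : ℝ
  k_pos : 0 < k
  q_pos : 0 < q
  rank_eq : (fromCols Xk Xc).rank = k + q
  g_pos : 0 < g
  d_pos : 0 < d
  a_pos : 0 < a

/-- Hyperparameters of the conjugate family of `g`-priors `NIGa(b, g (X_kᵀX_k)⁻¹, d, a)` on the
parameters `(β_k*, σ_k²)` of the submodel. -/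
structure Hyper (k : ℕ) where
  b : Fin k → ℝ
  g : ℝ
  d : ℝ
  a : ℝ
  g_pos : 0 < g
  d_pos : 0 < d
  a_pos : 0 < a

namespace Setting

variable {n k q : ℕ} (M : Setting n k q)

/-- The full design matrix `X = (X_k ⋮ X_{\k})`. -/
def X : Matrix (Fin n) (Fin k ⊕ Fin q) ℝ := fromCols M.Xk M.Xc

/-- The prior `NIGa(b, g (XᵀX)⁻¹, d, a)` on the parameters `(β, σ²)` of the full model. -/
def prior : Measure ((Fin k ⊕ Fin q → ℝ) × ℝ) :=
  NIGa (Sum.elim M.bk M.bc) (M.g • (M.Xᵀ * M.X)⁻¹) M.d M.a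

/-- The parameter `η = (β_k*, σ_k²)` of the submodel minimizes the Kullback-Leibler divergence
`KL(N(Xβ, σ² I), N(X_k β_k*, σ_k² I))` for the given `θ = (β, σ²)`. -/
def IsKLProjection (θ : (Fin k ⊕ Fin q → ℝ) × ℝ) (η : (Fin k → ℝ) × ℝ) : Prop :=
  0 < η.2 ∧ ∀ ζ : (Fin k → ℝ) × ℝ, 0 < ζ.2 →
    klDiv (sampling M.X θ) (sampling M.Xk η) ≤ klDiv (sampling M.X θ) (sampling M.Xk ζ)

/-- The KL-projection map from the parameters of the full model to those of the submodel. -/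
def klProjection (θ : (Fin k ⊕ Fin q → ℝ) × ℝ) : (Fin k → ℝ) × ℝ :=
  Classical.epsilon (M.IsKLProjection θ)

/-- The KL-prior on `(β_k*, σ_k²)`: the law of the KL-projection of `(β, σ²)` under the prior. -/
def klPrior : Measure ((Fin k → ℝ) × ℝ) := M.prior.map M.klProjection

/-- The conjugate law `NIGa(b', g' (X_kᵀX_k)⁻¹, d', a')` on the parameters of the submodel. -/
def conjugate (h : Hyper k) : Measure ((Fin k → ℝ) × ℝ) :=
  NIGa h.b (h.g • (M.Xkᵀ * M.Xk)⁻¹) h.d h.a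

/-- The conjugate law with hyperparameters `h` is a KL-conjugate approximation: it minimizes the
Kullback-Leibler divergence from the KL-prior within the conjugate family. -/
def IsKLConjugateApprox (h : Hyper k) : Prop :=
  ∀ h' : Hyper k, klDiv M.klPrior (M.conjugate h) ≤ klDiv M.klPrior (M.conjugate h')

/-- `M_k = I - X_k (X_kᵀX_k)⁻¹ X_kᵀ`. -/
def residualProj : Matrix (Fin n) (Fin n) ℝ := 1 - M.Xk * (M.Xkᵀ * M.Xk)⁻¹ * M.Xkᵀ

/-- `Q_k(β) = βᵀXᵀ M_k X β / n`. -/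
def Q (β : Fin k ⊕ Fin q → ℝ) : ℝ :=
  (1 / (n : ℝ)) * ((M.X *ᵥ β) ⬝ᵥ (M.residualProj *ᵥ (M.X *ᵥ β)))

/-- `R_k(β, σ²) = (1 + Q_k(β) / σ²)⁻¹`. -/
def R (θ : (Fin k ⊕ Fin q → ℝ) × ℝ) : ℝ := (1 + M.Q θ.1 / θ.2)⁻¹

/-- `E[R_k]`. -/
def meanR : ℝ := ∫ θ, M.R θ ∂M.prior

/-- `E[R_k⁻¹]`. -/
def meanInvR : ℝ := ∫ θ, (M.R θ)⁻¹ ∂M.prior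

/-- `Var[R_k⁻¹]`. -/
def varInvR : ℝ := variance (fun θ => (M.R θ)⁻¹) M.prior

/-- `E[log R_k]`. -/
def meanLogR : ℝ := ∫ θ, Real.log (M.R θ) ∂M.prior

/-- `E[R_k / σ²]`. -/
def meanRPrec : ℝ := ∫ θ, M.R θ / θ.2 ∂M.prior

/-- The coefficient of variation of `R_k⁻¹`. -/
def cv : ℝ := Real.sqrt M.varInvR / M.meanInvR

/-- The mean `b_k + (X_kᵀX_k)⁻¹ X_kᵀ X_{\k} b_{\k}`. -/
def projMean : Fin k → ℝ := M.bk + (M.Xkᵀ * M.Xk)⁻¹ *ᵥ ((M.Xkᵀ * M.Xc) *ᵥ M.bc)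

/-- The exact system of equations in the case `b_{\k} = 0`. -/
def CentralSystem (h : Hyper k) : Prop :=
  h.b = M.bk ∧
  h.g = M.g * M.meanR ∧
  h.a = h.d * (M.a / M.d) * (1 / M.meanR) ∧
  digamma (h.d / 2) - Real.log (h.d / 2) =
    digamma (M.d / 2) - Real.log (M.d / 2) + M.meanLogR - Real.log M.meanR

/-- The exact system of equations for arbitrary `b_{\k}`, in terms of `E[R_k]`, `E[R_k / σ²]` and
`E[log R_k]`. -/
def ExactSystem (h : Hyper k) : Prop :=
  h.b = M.projMean ∧
  h.g = M.g * M.meanR ∧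
  h.a = h.d / M.meanRPrec ∧
  digamma (h.d / 2) - Real.log (h.a / 2) =
    digamma (M.d / 2) - Real.log (M.a / 2) + M.meanLogR

/-- The approximate (delta-method) system of equations in the case `b_{\k} ≠ 0`. -/
def DeltaSystem (h : Hyper k) : Prop :=
  h.b = M.projMean ∧
  h.g = M.g / M.meanInvR ∧
  h.a = h.d * (M.a / M.d) * M.meanInvR ∧
  digamma (h.d / 2) - Real.log (h.d / 2) =
    digamma (M.d / 2) - Real.log (M.d / 2) - 1 / 2 * (M.varInvR / M.meanInvR ^ 2)

end Setting

end GPrior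

end

/-! Everything rests on a standardization of the prior. Let T = 1/σ² be the gamma distributed
precision, and let z_k, z_c be standard normal vectors of dimensions k and q, all independent. The
block triangular square root `root` of g(XᵀX)⁻¹, built from the Schur complement of X_kᵀX_k, makes
Q_k(β)/σ² equal to `excess` = (1/n)|√T·`shift` + √g z_c|², which does not involve z_k. By Pythagoras
the KL-projection is the regression of Xβ on X_k, with σ_k² = σ² + Q_k(β); in standardized form β_k*
= `projMean` + √(g/T)·`rootK` z_k and σ_k² = (1 + `excess`)/T. Thus R_k⁻¹ = 1 + `excess` is an
affine image of a noncentral chi-square variable mixed over T, which yields its mean and variance.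
If b_{\k} = 0, `excess` is independent of T, and E[R_k] follows from the Laplace transform of a
chi-square variable.

The log-density of a conjugate law is linear in log σ_k², 1/σ_k² and a quadratic form divided by
σ_k². Hence the divergence from the KL-prior is a constant plus `score`, an explicit function of the
hyperparameters, once the constant is known to be finite. Finiteness holds because the density of
the KL-prior is at most a multiple of σ_k^q (`klPrior_le`, `integrable_log_rnDeriv`). The score is
minimized one variable at a time: b and g separately, then a for given d. What remains is log Γ(t) +
t - t log t + tτ with t = d'/2, whose derivative is τ - (log t - ψ(t)). The gap log - ψ decreases
strictly from ∞ to 0, and τ = log E[1/σ_k²] - E[log(1/σ_k²)] is positive by strict Jensen, so there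
is exactly one minimizer, and it is the solution of the exact system.

For the delta method put Y = R_k⁻¹ ≥ 1, m = E[Y], and let c be the coefficient of variation. The
formulas for mean and variance give m - 1 ≤ Kc with K depending on q and d only (`meanInvR_le`). All
scales of the problem are then O(c), the third absolute central moment of Y is O(c³), and second
order expansions of 1/Y and log Y around m give the errors c² and c³. Y and T are dependent, so the
factorization of E[R_k/σ²] has error O(c) only, and this limits the accuracy of a and d. A
quantitative form of the strict decrease of log - ψ (`digammaGap_sub`) carries errors in the digamma
equation over to d. -/

noncomputable section

namespace GPrior


/-! ### The gap log - ψ: strict decrease, range and continuity. -/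

/-- The gap `log x - ψ(x)`. -/
def digammaGap (x : ℝ) : ℝ := Real.log x - digamma x

theorem hasDerivAt_log_gamma {x : ℝ} (hx : 0 < x) :
    HasDerivAt (fun t : ℝ => Real.log (Real.Gamma t)) (digamma x) x := by
  have h : DifferentiableAt ℝ (fun t : ℝ => Real.log (Real.Gamma t)) x := by
    refine DifferentiableAt.log (Real.differentiableAt_Gamma fun m => ?_) (Real.Gamma_pos_of_pos hx).ne'
    have : (0 : ℝ) ≤ m := Nat.cast_nonneg m
    linarith
  exact h.hasDerivAt

theorem digamma_add_one {x : ℝ} (hx : 0 < x) : digamma (x + 1) = digamma x + 1 / x := by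
  have h1 : HasDerivAt (fun t : ℝ => Real.log (Real.Gamma (t + 1))) (digamma (x + 1)) x := by
    have := (hasDerivAt_log_gamma (show 0 < x + 1 by linarith)).comp_add_const x 1
    exact this
  have h2 : HasDerivAt (fun t : ℝ => Real.log (Real.Gamma t) + Real.log t) (digamma x + 1 / x) x := by
    have := (hasDerivAt_log_gamma hx).add (Real.hasDerivAt_log hx.ne')
    rw [one_div]
    exact this
  refine (h1.congr_of_eventuallyEq ?_).unique h2
  filter_upwards [lt_mem_nhds hx] with t ht
  rw [Real.Gamma_add_one ht.ne', Real.log_mul ht.ne' (Real.Gamma_pos_of_pos ht).ne', add_comm]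

/-- This is Γ(x + 1) = xΓ(x) read as a chord slope. Convexity of log Γ then compares the slope with
the derivatives at both ends, giving ψ(x) ≤ log x ≤ ψ(x + 1). -/
theorem log_gamma_slope {x : ℝ} (hx : 0 < x) :
    slope (Real.log ∘ Real.Gamma) x (x + 1) = Real.log x := by
  simp [slope_def_field, Real.Gamma_add_one hx.ne', Real.log_mul hx.ne' (Real.Gamma_pos_of_pos hx).ne']

theorem digamma_le_log {x : ℝ} (hx : 0 < x) : digamma x ≤ Real.log x := by
  rw [← log_gamma_slope hx]
  exact Real.convexOn_log_Gamma.deriv_le_slope hx (show 0 < x + 1 by linarith) (by linarith)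
    (hasDerivAt_log_gamma hx).differentiableAt

theorem log_le_digamma_add_one {x : ℝ} (hx : 0 < x) : Real.log x ≤ digamma (x + 1) := by
  rw [← log_gamma_slope hx]
  exact Real.convexOn_log_Gamma.slope_le_deriv hx (show 0 < x + 1 by linarith) (by linarith)
    (hasDerivAt_log_gamma (show 0 < x + 1 by linarith)).differentiableAt

theorem digammaGap_nonneg {x : ℝ} (hx : 0 < x) : 0 ≤ digammaGap x :=
  sub_nonneg.2 (digamma_le_log hx)

/-- The decrement `φ(x) - φ(x + 1)` of the gap `φ = log - ψ`. -/
def digammaGapStep (x : ℝ) : ℝ := 1 / x - (Real.log (x + 1) - Real.log x)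

theorem digammaGap_eq_add {x : ℝ} (hx : 0 < x) :
    digammaGap x = digammaGapStep x + digammaGap (x + 1) := by
  rw [digammaGap, digammaGap, digammaGapStep, digamma_add_one hx]
  ring

theorem digammaGap_add_one_le {x : ℝ} (hx : 0 < x) : digammaGap (x + 1) ≤ 1 / x := by
  have h1 := log_le_digamma_add_one hx
  have h2 : Real.log (x + 1) - Real.log x ≤ 1 / x := by
    rw [← Real.log_div (by linarith) hx.ne']
    refine (Real.log_le_sub_one_of_pos (by positivity)).trans_eq ?_
    field_simp
    ring
  rw [digammaGap]
  linarith

/-- The derivative of the step is -1/(t²(t + 1)); on [x, y] its size is smallest at y, and the mean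
value inequality applies. -/
theorem digammaGapStep_sub {x y : ℝ} (hx : 0 < x) (hxy : x ≤ y) :
    (y - x) / (y ^ 2 * (y + 1)) ≤ digammaGapStep x - digammaGapStep y := by
  have hd : ∀ t : ℝ, 0 < t → HasDerivAt digammaGapStep (-(1 / (t ^ 2 * (t + 1)))) t := by
    intro t ht
    have h1 := (hasDerivAt_inv ht.ne').sub
      ((((hasDerivAt_id t).add_const 1).log (by simp; linarith)).sub (Real.hasDerivAt_log ht.ne'))
    refine (h1.congr_of_eventuallyEq ?_).congr_deriv ?_
    · filter_upwards with s
      simp [digammaGapStep]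
    · simp only [id]
      field_simp
      ring
  have h := (convex_Icc x y).image_sub_le_mul_sub_of_deriv_le (f := digammaGapStep)
    (C := -(1 / (y ^ 2 * (y + 1))))
    (fun t ht => (hd t (hx.trans_le ht.1)).continuousAt.continuousWithinAt)
    (fun t ht => (hd t (hx.trans_le (interior_subset ht).1)).differentiableAt.differentiableWithinAt)
    (fun t ht => ?_) x ⟨le_rfl, hxy⟩ y ⟨hxy, le_rfl⟩ hxy
  · have : (y - x) / (y ^ 2 * (y + 1)) = (1 / (y ^ 2 * (y + 1))) * (y - x) := by ring
    rw [this]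
    linarith
  · have ht' := interior_subset ht
    have h0 : 0 < t := hx.trans_le ht'.1
    rw [(hd t h0).deriv, neg_le_neg_iff]
    have := ht'.2
    gcongr

/-- The difference of gaps at x + n and y + n decreases in n, because the steps decrease in their
argument, and it tends to 0. So it is nonnegative at n = 1, and the first step alone accounts for
the bound. -/
theorem digammaGap_sub {x y : ℝ} (hx : 0 < x) (hxy : x ≤ y) :
    (y - x) / (y ^ 2 * (y + 1)) ≤ digammaGap x - digammaGap y := by
  have hpos : ∀ s : ℝ, 0 < s → ∀ n : ℕ, 0 < s + n := fun s hs n => by positivity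
  have hanti : Antitone fun n : ℕ => digammaGap (x + n) - digammaGap (y + n) := by
    refine antitone_nat_of_succ_le fun n => ?_
    have h1 := digammaGap_eq_add (hpos x hx n)
    have h2 := digammaGap_eq_add (hpos y (hx.trans_le hxy) n)
    have h3 := digammaGapStep_sub (hpos x hx n) (add_le_add_left hxy (n : ℝ))
    have h4 : 0 ≤ (y + n - (x + n)) / ((y + n) ^ 2 * (y + n + 1)) := by
      have : 0 < y + n := hpos y (hx.trans_le hxy) n
      have : 0 ≤ y + n - (x + n) := by linarith
      positivity
    push_cast
    rw [← add_assoc, ← add_assoc]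
    linarith
  have hlim : ∀ s : ℝ, 0 < s → Filter.Tendsto (fun n : ℕ => digammaGap (s + n)) Filter.atTop (nhds 0) := by
    intro s hs
    rw [← Filter.tendsto_add_atTop_iff_nat 1]
    refine squeeze_zero (g := fun n : ℕ => 1 / (s + n))
      (fun n => digammaGap_nonneg (hpos s hs _)) (fun n => ?_) ?_
    · have := digammaGap_add_one_le (hpos s hs n)
      push_cast
      rwa [← add_assoc]
    · have : Filter.Tendsto (fun n : ℕ => s + (n : ℝ)) Filter.atTop Filter.atTop :=
        Filter.tendsto_atTop_add_const_left _ s tendsto_natCast_atTop_atTop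
      simp only [one_div]
      exact this.inv_tendsto_atTop
  have h := hanti.le_of_tendsto (by simpa using (hlim x hx).sub (hlim y (hx.trans_le hxy))) 1
  simp only [Nat.cast_one] at h
  have h1 := digammaGap_eq_add hx
  have h2 := digammaGap_eq_add (hx.trans_le hxy)
  have h3 := digammaGapStep_sub hx hxy
  linarith

theorem digammaGap_lt {x y : ℝ} (hx : 0 < x) (hxy : x < y) : digammaGap y < digammaGap x := by
  have h := digammaGap_sub hx hxy.le
  have : 0 < (y - x) / (y ^ 2 * (y + 1)) := by
    have h1 : 0 < y - x := by linarith
    have h2 : 0 < y := by linarith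
    positivity
  linarith

theorem digammaGap_pos {x : ℝ} (hx : 0 < x) : 0 < digammaGap x :=
  (digammaGap_nonneg (by linarith : 0 < x + 1)).trans_lt (digammaGap_lt hx (by linarith))

theorem digammaGap_le_iff {x y : ℝ} (hx : 0 < x) (hy : 0 < y) :
    digammaGap x ≤ digammaGap y ↔ y ≤ x := by
  constructor
  · intro h
    by_contra hc
    exact absurd h (not_le.2 (digammaGap_lt hx (not_le.1 hc)))
  · intro h
    rcases h.eq_or_lt with rfl | h
    · exact le_rfl
    · exact (digammaGap_lt hy h).le

theorem digammaGap_inj {x y : ℝ} (hx : 0 < x) (hy : 0 < y) (h : digammaGap x = digammaGap y) :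
    x = y :=
  le_antisymm ((digammaGap_le_iff hy hx).1 h.ge) ((digammaGap_le_iff hx hy).1 h.le)

/-- Shows that the gap blows up at 0. Half of the term 1/x in the first step survives because log((x
+ 1)/x) is estimated by the tangent of log at 2. -/
theorem le_digammaGap {x : ℝ} (hx : 0 < x) : 1 / (2 * x) - 1 ≤ digammaGap x := by
  have h1 := digammaGap_eq_add hx
  have h2 := digammaGap_nonneg (by linarith : 0 < x + 1)
  have h3 : Real.log (x + 1) - Real.log x ≤ 1 / (2 * x) + 1 := by
    rw [← Real.log_div (by linarith) hx.ne']
    have h4 : Real.log ((x + 1) / x) = Real.log ((x + 1) / x / 2) + Real.log 2 := by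
      rw [← Real.log_mul (by positivity) (by norm_num)]
      congr 1
      ring
    have h5 := Real.log_le_sub_one_of_pos (show 0 < (x + 1) / x / 2 by positivity)
    have h6 := Real.log_two_lt_d9
    have h7 : (x + 1) / x / 2 = 1 / (2 * x) + 1 / 2 := by
      field_simp
      ring
    rw [h4]
    linarith
  have h8 : 1 / x = 1 / (2 * x) + 1 / (2 * x) := by
    field_simp
    ring
  rw [digammaGapStep] at h1
  linarith

/-- The complex Γ is holomorphic on the right half plane, so its derivative is continuous there; on
the real axis ψ is that derivative divided by Γ. -/
theorem continuousOn_digamma : ContinuousOn digamma (Set.Ioi 0) := by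
  have hopen : IsOpen {s : ℂ | 0 < s.re} := Complex.continuous_re.isOpen_preimage _ isOpen_Ioi
  have hne : ∀ s : ℂ, 0 < s.re → ∀ m : ℕ, s ≠ -m := by
    rintro s hs m rfl
    have : (0 : ℝ) ≤ m := Nat.cast_nonneg m
    simp at hs
    linarith
  have hdiff : DifferentiableOn ℂ Complex.Gamma {s : ℂ | 0 < s.re} := fun s hs =>
    (Complex.differentiableAt_Gamma s (hne s hs)).differentiableWithinAt
  have hcont : ContinuousOn (deriv Complex.Gamma) {s : ℂ | 0 < s.re} :=
    (hdiff.deriv hopen).continuousOn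
  have heq : ∀ x : ℝ, x ∈ Set.Ioi (0 : ℝ) →
      digamma x = (deriv Complex.Gamma (x : ℂ)).re / Real.Gamma x := by
    intro x hx
    have h1 : HasDerivAt Real.Gamma (deriv Complex.Gamma (x : ℂ)).re x :=
      (Complex.differentiableAt_Gamma x (hne _ (by simpa using hx))).hasDerivAt.real_of_complex
    exact (hasDerivAt_log_gamma hx).unique (h1.log (Real.Gamma_pos_of_pos hx).ne')
  refine ContinuousOn.congr (ContinuousOn.div ?_ ?_ fun x hx => (Real.Gamma_pos_of_pos hx).ne') heq
  · exact Complex.continuous_re.comp_continuousOn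
      (hcont.comp Complex.continuous_ofReal.continuousOn fun x hx => by simpa using hx)
  · intro x hx
    refine (Real.differentiableAt_Gamma fun m => ?_).continuousAt.continuousWithinAt
    have : (0 : ℝ) ≤ m := Nat.cast_nonneg m
    have : 0 < x := hx
    linarith

theorem exists_digammaGap_eq {y : ℝ} (hy : 0 < y) : ∃ x, 0 < x ∧ digammaGap x = y := by
  -- The lower bound 1/(2l) - 1 of the gap at `l` equals y, and the upper bound of the gap at 1/y +
  -- 1 is again y, so the intermediate value theorem applies between these points.
  set l := 1 / (2 * (y + 1)) with hl
  have hl0 : 0 < l := by positivity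
  have h1 : y ≤ digammaGap l := by
    refine le_trans (le_of_eq ?_) (le_digammaGap hl0)
    rw [hl]
    field_simp
    ring
  have h2 : digammaGap (1 / y + 1) ≤ y := by
    simpa using digammaGap_add_one_le (show 0 < 1 / y by positivity)
  have hr0 : 0 < 1 / y + 1 := by positivity
  have hlr : l ≤ 1 / y + 1 := (digammaGap_le_iff hr0 hl0).1 (h2.trans h1)
  have hc : ContinuousOn digammaGap (Set.Icc l (1 / y + 1)) := by
    have hs : Set.Icc l (1 / y + 1) ⊆ Set.Ioi 0 := fun t ht => hl0.trans_le ht.1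
    refine ContinuousOn.sub (Real.continuousOn_log.mono fun t ht => ?_) (continuousOn_digamma.mono hs)
    have : 0 < t := hs ht
    simpa using this.ne'
  obtain ⟨x, hx, hxy⟩ := intermediate_value_Icc' hlr hc ⟨h2, h1⟩
  exact ⟨x, hl0.trans_le hx.1, hxy⟩


/-! ### Gamma and inverted gamma laws. -/

theorem integrable_and_integral_of_lintegral {α : Type*} [MeasurableSpace α] {μ : Measure α}
    {f : α → ℝ} {c : ℝ} (hf : AEStronglyMeasurable f μ) (h0 : 0 ≤ᵐ[μ] f) (hc : 0 ≤ c)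
    (h : ∫⁻ x, ENNReal.ofReal (f x) ∂μ = ENNReal.ofReal c) :
    Integrable f μ ∧ ∫ x, f x ∂μ = c := by
  refine ⟨(lintegral_ofReal_ne_top_iff_integrable hf h0).1 (by rw [h]; exact ENNReal.ofReal_ne_top), ?_⟩
  rw [integral_eq_lintegral_of_nonneg_ae h0 hf, h, ENNReal.toReal_ofReal hc]

theorem ae_pos_gammaMeasure (α r : ℝ) : ∀ᵐ t ∂gammaMeasure α r, 0 < t := by
  rw [gammaMeasure, ae_withDensity_iff (by unfold gammaPDF; fun_prop)]
  filter_upwards [(Set.finite_singleton (0 : ℝ)).countable.ae_notMem volume] with t ht h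
  rcases lt_trichotomy t 0 with h' | h' | h'
  · exact absurd (gammaPDF_of_neg h') h
  · exact absurd h' ht
  · exact h'

/-- Multiplying the gamma density of shape α by t^m gives a multiple of the density of shape α + m,
which integrates to one. -/
theorem gamma_rpow_moment {α r m : ℝ} (hα : 0 < α) (hr : 0 < r) (hm : 0 < α + m) :
    Integrable (fun t : ℝ => t ^ m) (gammaMeasure α r) ∧
      ∫ t, t ^ m ∂gammaMeasure α r = Real.Gamma (α + m) / (Real.Gamma α * r ^ m) := by
  have h1 := Real.Gamma_pos_of_pos hα
  have h2 := Real.Gamma_pos_of_pos hm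
  have h3 := Real.rpow_pos_of_pos hr m
  refine integrable_and_integral_of_lintegral (by fun_prop) ?_ (by positivity) ?_
  · filter_upwards [ae_pos_gammaMeasure α r] with t ht
    exact Real.rpow_nonneg ht.le _
  · rw [gammaMeasure, lintegral_withDensity_eq_lintegral_mul _ (by unfold gammaPDF; fun_prop) (by fun_prop)]
    have : ∀ᵐ t : ℝ, (gammaPDF α r * fun t => ENNReal.ofReal (t ^ m)) t =
        ENNReal.ofReal (Real.Gamma (α + m) / (Real.Gamma α * r ^ m)) * gammaPDF (α + m) r t := by
      filter_upwards [(Set.finite_singleton (0 : ℝ)).countable.ae_notMem volume] with t ht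
      rcases lt_trichotomy t 0 with h' | h' | h'
      · simp [gammaPDF_of_neg h']
      · exact absurd h' ht
      · rw [Pi.mul_apply, gammaPDF_of_nonneg h'.le, gammaPDF_of_nonneg h'.le,
          ← ENNReal.ofReal_mul (by positivity), ← ENNReal.ofReal_mul (by positivity)]
        congr 1
        rw [Real.rpow_add hr, show α + m - 1 = (α - 1) + m by ring, Real.rpow_add h']
        field_simp
    rw [lintegral_congr_ae this, lintegral_const_mul _ (by unfold gammaPDF; fun_prop),
      lintegral_gammaPDF_eq_one hm hr, mul_one]

theorem gamma_pow_moment {α r : ℝ} (hα : 0 < α) (hr : 0 < r) (m : ℕ) :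
    Integrable (fun t : ℝ => t ^ m) (gammaMeasure α r) ∧
      ∫ t, t ^ m ∂gammaMeasure α r = Real.Gamma (α + m) / (Real.Gamma α * r ^ m) := by
  simpa only [Real.rpow_natCast] using gamma_rpow_moment (m := m) hα hr (by positivity)

theorem gamma_mean {α r : ℝ} (hα : 0 < α) (hr : 0 < r) : ∫ t, t ∂gammaMeasure α r = α / r := by
  have := (gamma_pow_moment hα hr 1).2
  simp only [pow_one, Nat.cast_one, Real.Gamma_add_one hα.ne'] at this
  rw [this]
  have := Real.Gamma_pos_of_pos hα
  field_simp

theorem gamma_sq_mean {α r : ℝ} (hα : 0 < α) (hr : 0 < r) :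
    ∫ t, t ^ 2 ∂gammaMeasure α r = α * (α + 1) / r ^ 2 := by
  have := (gamma_pow_moment hα hr 2).2
  rw [this, show α + (2 : ℕ) = (α + 1) + 1 by push_cast; ring, Real.Gamma_add_one (by positivity),
    Real.Gamma_add_one hα.ne']
  have := Real.Gamma_pos_of_pos hα
  field_simp

/-- The moment generating function of log T at m is E[T^m]; its derivative at 0 is the mean of log
T. -/
theorem gamma_log_mean {α r : ℝ} (hα : 0 < α) (hr : 0 < r) :
    Integrable Real.log (gammaMeasure α r) ∧
      ∫ t, Real.log t ∂gammaMeasure α r = digamma α - Real.log r := by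
  have hexp : ∀ m : ℝ, (fun t => Real.exp (m * Real.log t)) =ᵐ[gammaMeasure α r] fun t => t ^ m := by
    intro m
    filter_upwards [ae_pos_gammaMeasure α r] with t ht
    rw [Real.rpow_def_of_pos ht, mul_comm]
  have hmem : 0 ∈ interior (integrableExpSet Real.log (gammaMeasure α r)) := by
    refine mem_interior.2 ⟨Set.Ioi (-α), fun m hm => ?_, isOpen_Ioi, by simpa using hα⟩
    refine (integrable_congr (hexp m)).2 (gamma_rpow_moment hα hr ?_).1
    have : -α < m := hm
    linarith
  refine ⟨integrable_of_mem_interior_integrableExpSet hmem, ?_⟩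
  rw [← deriv_mgf_zero hmem]
  have hG := Real.Gamma_pos_of_pos hα
  have hmgf : mgf Real.log (gammaMeasure α r) =ᶠ[nhds 0] fun m =>
      Real.exp (Real.log (Real.Gamma (α + m)) - Real.log (Real.Gamma α) - m * Real.log r) := by
    filter_upwards [lt_mem_nhds (show -α < 0 by linarith)] with m hm
    have h2 := Real.Gamma_pos_of_pos (show 0 < α + m by linarith)
    rw [mgf, integral_congr_ae (hexp m), (gamma_rpow_moment hα hr (by linarith)).2, Real.exp_sub,
      Real.exp_sub, Real.exp_log h2, Real.exp_log hG, mul_comm m, ← Real.rpow_def_of_pos hr, div_div]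
  rw [hmgf.deriv_eq]
  have h1 : HasDerivAt (fun m : ℝ => Real.log (Real.Gamma (α + m))) (digamma α) 0 := by
    have := hasDerivAt_log_gamma (show 0 < α + 0 by simpa using hα)
    simpa using this.comp_const_add α 0
  have h2 := (((h1.sub_const (Real.log (Real.Gamma α))).sub
    ((hasDerivAt_id (0 : ℝ)).mul_const (Real.log r))).exp).deriv
  simpa using h2

/-- The inverted gamma law is the law of `1 / T` with `T` gamma distributed. -/
theorem invGamma_eq_map {α β : ℝ} (hα : 0 < α) (hβ : 0 < β) :
    (volume : Measure ℝ).withDensity (fun s => ENNReal.ofReal (invGammaPDF α β s)) =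
      (gammaMeasure α β).map fun t => t⁻¹ := by
  have hm : Measurable fun s => ENNReal.ofReal (invGammaPDF α β s) := by
    unfold invGammaPDF
    refine Measurable.ennreal_ofReal (Measurable.ite measurableSet_Ioi (by fun_prop) measurable_const)
  refine Measure.ext_of_lintegral _ fun φ hφ => ?_
  have hφ' : Measurable fun t : ℝ => φ t⁻¹ := hφ.comp measurable_inv
  rw [lintegral_withDensity_eq_lintegral_mul _ hm hφ, lintegral_map hφ measurable_inv, gammaMeasure,
    lintegral_withDensity_eq_lintegral_mul _ (by unfold gammaPDF; fun_prop) hφ']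
  have e1 : ∫⁻ s, ((fun s => ENNReal.ofReal (invGammaPDF α β s)) * φ) s =
      ∫⁻ s in Set.Ioi 0, ((fun s => ENNReal.ofReal (invGammaPDF α β s)) * φ) s := by
    rw [← lintegral_indicator measurableSet_Ioi]
    refine lintegral_congr fun s => ?_
    by_cases hs : 0 < s
    · simp [Set.indicator, hs]
    · simp [Set.indicator, hs, invGammaPDF]
  have e2 : ∫⁻ t, (gammaPDF α β * fun t => φ t⁻¹) t =
      ∫⁻ t in Set.Ioi 0, (gammaPDF α β * fun t => φ t⁻¹) t := by
    rw [← lintegral_indicator measurableSet_Ioi]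
    refine lintegral_congr_ae ?_
    filter_upwards [(Set.finite_singleton (0 : ℝ)).countable.ae_notMem volume] with t ht
    by_cases hs : 0 < t
    · simp [Set.indicator, hs]
    · have : t < 0 := lt_of_le_of_ne (not_lt.1 hs) ht
      simp [Set.indicator, hs, gammaPDF_of_neg this]
  have himg : (fun t : ℝ => t⁻¹) '' Set.Ioi 0 = Set.Ioi 0 := by
    ext x
    constructor
    · rintro ⟨t, ht, rfl⟩
      exact Set.mem_Ioi.2 (inv_pos.2 ht)
    · intro hx
      exact ⟨x⁻¹, Set.mem_Ioi.2 (inv_pos.2 hx), inv_inv x⟩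
  -- Change of variables s = 1/t on the half line, with Jacobian t⁻².
  rw [e1, e2, ← himg, lintegral_image_eq_lintegral_abs_deriv_mul measurableSet_Ioi
    (fun x hx => (hasDerivAt_inv (ne_of_gt hx)).hasDerivWithinAt) inv_injective.injOn, himg]
  refine setLIntegral_congr_fun measurableSet_Ioi fun t ht => ?_
  have ht : 0 < t := ht
  simp only [Pi.mul_apply]
  rw [← mul_assoc, gammaPDF_of_nonneg ht.le, ← ENNReal.ofReal_mul (abs_nonneg _)]
  congr 2
  rw [invGammaPDF, if_pos (inv_pos.2 ht), abs_neg, abs_of_pos (by positivity), Real.inv_rpow ht.le,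
    ← Real.rpow_neg ht.le, show -(-α - 1) = (α - 1) + 2 by ring, Real.rpow_add ht, Real.rpow_two,
    div_inv_eq_mul]
  field_simp

/-! ### Normal and normal inverted gamma laws as images of standard laws. -/

/-- The standard normal law on `ι → ℝ`. -/
abbrev stdNormal (ι : Type*) [Fintype ι] : Measure (ι → ℝ) :=
  Measure.pi fun _ : ι => gaussianReal 0 1

theorem sqrt_pow_eq {x : ℝ} (hx : 0 ≤ x) (m : ℕ) : Real.sqrt (x ^ m) = Real.sqrt x ^ m := by
  rw [← Real.sqrt_sq (pow_nonneg (Real.sqrt_nonneg x) m), ← pow_mul, mul_comm, pow_mul,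
    Real.sq_sqrt hx]

theorem measurable_mulVec {ι κ : Type*} [Fintype ι] (A : Matrix κ ι ℝ) :
    Measurable fun z : ι → ℝ => A *ᵥ z :=
  measurable_pi_lambda _ fun i => by
    simp only [mulVec, dotProduct]
    fun_prop

section normal

variable {ι : Type*} [Fintype ι] [DecidableEq ι]

theorem normalPDF_std (x : ι → ℝ) :
    normalPDF (0 : ι → ℝ) (1 : Matrix ι ι ℝ) x = ∏ i, gaussianPDFReal 0 1 (x i) := by
  simp only [normalPDF, gaussianPDFReal, Finset.prod_mul_distrib, ← Real.exp_sum]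
  simp only [inv_one, one_mulVec, sub_zero, det_one, mul_one, NNReal.coe_one, Finset.prod_const,
    Finset.card_univ, dotProduct, Finset.mul_sum]
  congr 1
  · rw [inv_pow, ← sqrt_pow_eq (by positivity)]
  · congr 1
    refine Finset.sum_congr rfl fun i _ => ?_
    ring

theorem measurable_normalPDF (m : ι → ℝ) (S : Matrix ι ι ℝ) : Measurable (normalPDF m S) := by
  unfold normalPDF
  refine Measurable.const_mul (Real.measurable_exp.comp (Measurable.const_mul ?_ _)) _
  simp only [dotProduct, mulVec]
  fun_prop

theorem stdNormal_eq_withDensity :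
    stdNormal ι = volume.withDensity fun x => ENNReal.ofReal (normalPDF 0 1 x) := by
  refine (Measure.pi_eq fun s hs => ?_)
  rw [withDensity_apply _ (MeasurableSet.univ_pi hs), ← lintegral_indicator (MeasurableSet.univ_pi hs)]
  have h1 : ∀ x : ι → ℝ, (Set.univ.pi s).indicator
      (fun x => ENNReal.ofReal (normalPDF (0 : ι → ℝ) (1 : Matrix ι ι ℝ) x)) x =
      ENNReal.ofReal (∏ i, (s i).indicator (gaussianPDFReal 0 1) (x i)) := by
    intro x
    by_cases hx : x ∈ Set.univ.pi s
    · rw [Set.indicator_of_mem hx, normalPDF_std]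
      congr 1
      refine Finset.prod_congr rfl fun i _ => ?_
      rw [Set.indicator_of_mem (hx i trivial)]
    · rw [Set.indicator_of_notMem hx]
      simp only [Set.mem_univ_pi, not_forall] at hx
      obtain ⟨i, hi⟩ := hx
      rw [Finset.prod_eq_zero (Finset.mem_univ i) (Set.indicator_of_notMem hi _), ENNReal.ofReal_zero]
  have hint : ∀ i, Integrable ((s i).indicator (gaussianPDFReal 0 1)) volume := fun i =>
    (integrable_gaussianPDFReal 0 1).indicator (hs i)
  have hnn : ∀ i t, 0 ≤ (s i).indicator (gaussianPDFReal 0 1) t := fun i t =>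
    Set.indicator_nonneg (fun t _ => gaussianPDFReal_nonneg 0 1 t) t
  have hint' : Integrable (fun x : ι → ℝ => ∏ i, (s i).indicator (gaussianPDFReal 0 1) (x i)) :=
    Integrable.fintype_prod hint
  rw [lintegral_congr h1, ← ofReal_integral_eq_lintegral_ofReal hint'
    (Filter.Eventually.of_forall fun x => Finset.prod_nonneg fun i _ => hnn i _)]
  have h2 := integral_fintype_prod_eq_prod (𝕜 := ℝ)
    (fun i => (s i).indicator (gaussianPDFReal 0 1)) (μ := fun _ => volume)
  rw [← volume_pi] at h2
  rw [h2, ENNReal.ofReal_prod_of_nonneg fun i _ => integral_nonneg (hnn i)]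
  refine Finset.prod_congr rfl fun i _ => ?_
  rw [integral_indicator (hs i), gaussianReal_apply_eq_integral 0 one_ne_zero]

theorem normalPDF_affine (b : ι → ℝ) (A : Matrix ι ι ℝ) (x : ι → ℝ) :
    normalPDF b (A * Aᵀ) x = |A.det⁻¹| * normalPDF 0 1 (A⁻¹ *ᵥ (x - b)) := by
  simp only [normalPDF, inv_one, one_mulVec, sub_zero, det_one, mul_one]
  rw [det_mul, det_transpose, ← sq, Real.sqrt_mul (by positivity), Real.sqrt_sq_eq_abs, mul_inv,
    abs_inv, Matrix.mul_inv_rev, ← transpose_nonsing_inv, ← mulVec_mulVec, dotProduct_mulVec,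
    vecMul_transpose]
  ring

/-- The multivariate normal law is the image of the standard one under an affine map. -/
theorem normal_eq_map (b : ι → ℝ) {A : Matrix ι ι ℝ} (hA : A.det ≠ 0) :
    (volume : Measure (ι → ℝ)).withDensity (fun x => ENNReal.ofReal (normalPDF b (A * Aᵀ) x)) =
      (stdNormal ι).map fun z => b + A *ᵥ z := by
  have hmA := measurable_mulVec A
  have hmAi := measurable_mulVec A⁻¹
  refine Measure.ext_of_lintegral _ fun φ hφ => ?_
  have hφb : Measurable fun z => φ (b + A *ᵥ z) := hφ.comp (hmA.const_add b)
  have hm := (measurable_normalPDF (0 : ι → ℝ) (1 : Matrix ι ι ℝ)).ennreal_ofReal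
  rw [lintegral_withDensity_eq_lintegral_mul _ (measurable_normalPDF _ _).ennreal_ofReal hφ,
    lintegral_map hφ (hmA.const_add b), stdNormal_eq_withDensity,
    lintegral_withDensity_eq_lintegral_mul _ hm hφb]
  have hg : Measurable fun x : ι → ℝ =>
      ENNReal.ofReal (normalPDF 0 1 (A⁻¹ *ᵥ x)) * φ (b + x) :=
    (hm.comp hmAi).mul (hφ.comp (measurable_const_add b))
  simp only [Pi.mul_apply]
  have e1 : ∫⁻ z, ENNReal.ofReal (normalPDF 0 1 z) * φ (b + A *ᵥ z) =
      ∫⁻ z, ENNReal.ofReal (normalPDF 0 1 (A⁻¹ *ᵥ (toLin' A z))) * φ (b + toLin' A z) := by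
    refine lintegral_congr fun z => ?_
    have : A⁻¹ *ᵥ (A *ᵥ z) = z := by
      rw [mulVec_mulVec, nonsing_inv_mul _ (isUnit_iff_ne_zero.2 hA), one_mulVec]
    simp [this]
  have hmT : Measurable (toLin' A) := hmA
  rw [e1, ← lintegral_map hg hmT, Real.map_matrix_volume_pi_eq_smul_volume_pi hA,
    lintegral_smul_measure, ← lintegral_add_left_eq_self _ b, smul_eq_mul,
    ← lintegral_const_mul _ hg]
  refine lintegral_congr fun x => ?_
  rw [normalPDF_affine b A, ENNReal.ofReal_mul (abs_nonneg _), add_sub_cancel_left,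
    mul_assoc]

theorem measurable_invGammaPDF (α β : ℝ) : Measurable (invGammaPDF α β) :=
  Measurable.ite measurableSet_Ioi (by fun_prop) measurable_const

theorem measurable_normalPDF_smul (b : ι → ℝ) (V : Matrix ι ι ℝ) :
    Measurable fun θ : (ι → ℝ) × ℝ => normalPDF b (θ.2 • V) θ.1 := by
  have hs : Continuous fun θ : (ι → ℝ) × ℝ => θ.2 • V := continuous_snd.smul continuous_const
  have hdet := hs.matrix_det.measurable
  have hinv : ∀ i j, Measurable fun θ : (ι → ℝ) × ℝ => (θ.2 • V)⁻¹ i j := by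
    intro i j
    simp only [inv_def, Ring.inverse_eq_inv', Matrix.smul_apply, smul_eq_mul]
    exact hdet.inv.mul (hs.matrix_adjugate.matrix_elem i j).measurable
  have hx : ∀ i, Measurable fun θ : (ι → ℝ) × ℝ => (θ.1 - b) i := fun i =>
    (((measurable_pi_apply i).comp measurable_fst).sub measurable_const :
      Measurable fun θ : (ι → ℝ) × ℝ => θ.1 i - b i)
  unfold normalPDF
  refine (Measurable.sqrt (hdet.const_mul _)).inv.mul
    (Real.measurable_exp.comp (Measurable.const_mul ?_ _))
  exact Finset.measurable_sum _ fun i _ => (hx i).mul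
    (Finset.measurable_sum _ fun j _ => (hinv i j).mul (hx j))

/-- The normal inverted gamma law as the law of `(b + T^(-1/2) L z, 1 / T)` with `z` standard normal
and `T` gamma distributed. -/
theorem NIGa_eq_map (b : ι → ℝ) {L : Matrix ι ι ℝ} (hL : L.det ≠ 0) {d a : ℝ} (hd : 0 < d)
    (ha : 0 < a) :
    NIGa b (L * Lᵀ) d a = ((stdNormal ι).prod (gammaMeasure (d / 2) (a / 2))).map
      fun p => (b + Real.sqrt p.2⁻¹ • (L *ᵥ p.1), p.2⁻¹) := by
  have : IsProbabilityMeasure (gammaMeasure (d / 2) (a / 2)) :=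
    isProbabilityMeasure_gammaMeasure (by positivity) (by positivity)
  have hn := measurable_normalPDF_smul b (L * Lᵀ)
  have hg := (measurable_invGammaPDF (d / 2) (a / 2))
  have hmap : Measurable fun p : (ι → ℝ) × ℝ => (b + Real.sqrt p.2⁻¹ • (L *ᵥ p.1), p.2⁻¹) :=
    Measurable.prodMk (((measurable_snd.inv.sqrt).smul
      ((measurable_mulVec L).comp measurable_fst)).const_add b) measurable_snd.inv
  have hφm (φ : (ι → ℝ) × ℝ → ENNReal) (hφ : Measurable φ) :
      Measurable fun p : (ι → ℝ) × ℝ => φ (b + Real.sqrt p.2⁻¹ • (L *ᵥ p.1), p.2⁻¹) :=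
    hφ.comp hmap
  have hdens : Measurable fun θ : (ι → ℝ) × ℝ => ENNReal.ofReal
      (normalPDF b (θ.2 • (L * Lᵀ)) θ.1 * invGammaPDF (d / 2) (a / 2) θ.2) :=
    (hn.mul (hg.comp measurable_snd)).ennreal_ofReal
  refine Measure.ext_of_lintegral _ fun φ hφ => ?_
  have hG : Measurable fun q : (ι → ℝ) × ℝ => φ (b + Real.sqrt q.2 • (L *ᵥ q.1), q.2) :=
    hφ.comp (Measurable.prodMk (((measurable_snd.sqrt).smul
      ((measurable_mulVec L).comp measurable_fst)).const_add b) measurable_snd)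
  rw [NIGa, lintegral_withDensity_eq_lintegral_mul _ hdens hφ, lintegral_map hφ hmap, Measure.volume_eq_prod,
    lintegral_prod_symm' _ (hdens.mul hφ),
    lintegral_prod_symm' _ (hφm φ hφ)]
  -- For fixed s > 0 the fibre is normal with covariance root √s L; for s ≤ 0 both sides vanish with
  -- the inverted gamma density.
  have e : ∀ s : ℝ, ∫⁻ x : ι → ℝ, ((fun θ : (ι → ℝ) × ℝ => ENNReal.ofReal
      (normalPDF b (θ.2 • (L * Lᵀ)) θ.1 * invGammaPDF (d / 2) (a / 2) θ.2)) * φ) (x, s) =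
      ENNReal.ofReal (invGammaPDF (d / 2) (a / 2) s) *
        ∫⁻ z, φ (b + Real.sqrt s • (L *ᵥ z), s) ∂stdNormal ι := by
    intro s
    by_cases hs : 0 < s
    · have hsq := Real.sqrt_pos.2 hs
      have hdet : (Real.sqrt s • L).det ≠ 0 := by
        rw [det_smul]
        exact mul_ne_zero (pow_ne_zero _ hsq.ne') hL
      have hmat : s • (L * Lᵀ) = (Real.sqrt s • L) * (Real.sqrt s • L)ᵀ := by
        rw [transpose_smul, smul_mul_smul, Real.mul_self_sqrt hs.le]
      have hφs : Measurable fun x : ι → ℝ => φ (x, s) := hφ.comp measurable_prodMk_right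
      have h1 := congrArg (fun μ : Measure (ι → ℝ) => ∫⁻ x, φ (x, s) ∂μ) (normal_eq_map b hdet)
      rw [lintegral_withDensity_eq_lintegral_mul _ (measurable_normalPDF _ _).ennreal_ofReal hφs,
        lintegral_map hφs ((measurable_mulVec _).const_add b), ← hmat] at h1
      simp only [smul_mulVec] at h1
      rw [← h1, ← lintegral_const_mul _ ((measurable_normalPDF _ _).ennreal_ofReal.mul hφs)]
      refine lintegral_congr fun x => ?_
      simp only [Pi.mul_apply]
      rw [mul_comm (normalPDF _ _ _), ENNReal.ofReal_mul, mul_assoc]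
      rw [invGammaPDF, if_pos hs]
      have := Real.Gamma_pos_of_pos (show 0 < d / 2 by positivity)
      positivity
    · have : invGammaPDF (d / 2) (a / 2) s = 0 := if_neg hs
      simp [this]
  rw [lintegral_congr e]
  have hH : Measurable fun s : ℝ => ∫⁻ z, φ (b + Real.sqrt s • (L *ᵥ z), s) ∂stdNormal ι :=
    hG.lintegral_prod_left'
  have h2 := congrArg (fun μ : Measure ℝ =>
    ∫⁻ s, ∫⁻ z, φ (b + Real.sqrt s • (L *ᵥ z), s) ∂stdNormal ι ∂μ)
    (invGamma_eq_map (show 0 < d / 2 by positivity) (show 0 < a / 2 by positivity))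
  rw [lintegral_withDensity_eq_lintegral_mul _ hg.ennreal_ofReal hH,
    lintegral_map hH measurable_inv] at h2
  exact h2

end normal


/-! ### Linear algebra of the split design matrix. -/

theorem exists_mul_transpose_eq {ι : Type*} [Fintype ι] [DecidableEq ι] {A : Matrix ι ι ℝ}
    (hA : A.PosDef) : ∃ L : Matrix ι ι ℝ, L.det ≠ 0 ∧ L * Lᵀ = A⁻¹ := by
  have h := hA.inv
  obtain ⟨B, hB⟩ : ∃ B : Matrix ι ι ℝ, A⁻¹ = star B * B := by
    open scoped MatrixOrder in
    exact CStarAlgebra.nonneg_iff_eq_star_mul_self.1 h.posSemidef.nonneg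
  have hB' : A⁻¹ = Bᵀ * B := by simpa [star_eq_conjTranspose] using hB
  refine ⟨Bᵀ, ?_, by simpa using hB'.symm⟩
  intro h0
  have := h.det_pos
  rw [hB', det_mul, h0, zero_mul] at this
  exact lt_irrefl _ this

theorem posDef_transpose_mul_self {ι κ : Type*} [Fintype ι] [Fintype κ] (A : Matrix κ ι ℝ)
    (hA : ∀ v, A *ᵥ v = 0 → v = 0) : (Aᵀ * A).PosDef := by
  have := PosDef.conjTranspose_mul_self A (fun v w h => by
    have := hA (v - w) (by rw [mulVec_sub, h, sub_self])
    exact sub_eq_zero.1 this)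
  simpa using this

namespace Setting

variable {n k q : ℕ} (M : Setting n k q)

theorem X_mulVec_eq_zero {v : Fin k ⊕ Fin q → ℝ} (h : M.X *ᵥ v = 0) : v = 0 := by
  have h1 := LinearMap.finrank_range_add_finrank_ker M.X.mulVecLin
  have h2 : Module.finrank ℝ (LinearMap.range M.X.mulVecLin) = k + q := M.rank_eq
  rw [h2, Module.finrank_fintype_fun_eq_card] at h1
  simp only [Fintype.card_sum, Fintype.card_fin] at h1
  have h3 : LinearMap.ker M.X.mulVecLin = ⊥ := Submodule.finrank_eq_zero.1 (by omega)
  exact (LinearMap.ker_eq_bot'.1 h3) v h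

theorem X_mulVec (v : Fin k ⊕ Fin q → ℝ) :
    M.X *ᵥ v = M.Xk *ᵥ (v ∘ Sum.inl) + M.Xc *ᵥ (v ∘ Sum.inr) :=
  fromCols_mulVec _ _ _

theorem n_pos (M : Setting n k q) : 0 < n := by
  have h := rank_le_card_height (fromCols M.Xk M.Xc)
  rw [M.rank_eq, Fintype.card_fin] at h
  have := M.k_pos
  omega

theorem n_cast_pos (M : Setting n k q) : (0 : ℝ) < n := Nat.cast_pos.2 M.n_pos

theorem Xk_mulVec_eq_zero {v : Fin k → ℝ} (h : M.Xk *ᵥ v = 0) : v = 0 := by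
  have := M.X_mulVec_eq_zero (v := Sum.elim v 0) (by simp [X_mulVec, h])
  simpa using congrArg (· ∘ Sum.inl) this

/-- The Gram matrix `X_kᵀX_k`. -/
abbrev gram : Matrix (Fin k) (Fin k) ℝ := M.Xkᵀ * M.Xk

/-- The Schur complement `X_{\k}ᵀ M_k X_{\k}`. -/
abbrev schur : Matrix (Fin q) (Fin q) ℝ := M.Xcᵀ * M.residualProj * M.Xc

/-- The matrix `(X_kᵀX_k)⁻¹ X_kᵀ X_{\k}` of regression coefficients. -/
abbrev coef : Matrix (Fin k) (Fin q) ℝ := M.gram⁻¹ * (M.Xkᵀ * M.Xc)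

theorem posDef_gram : M.gram.PosDef := posDef_transpose_mul_self _ fun _ => M.Xk_mulVec_eq_zero

theorem isUnit_det_gram : IsUnit M.gram.det := M.posDef_gram.det_pos.ne'.isUnit

theorem gram_transpose : M.gramᵀ = M.gram := by simp [gram]

theorem residualProj_transpose : M.residualProjᵀ = M.residualProj := by
  simp [residualProj, transpose_nonsing_inv, Matrix.mul_assoc]

theorem residualProj_mul_Xk : M.residualProj * M.Xk = 0 := by
  rw [residualProj, Matrix.sub_mul, Matrix.one_mul, Matrix.mul_assoc, Matrix.mul_assoc,
    nonsing_inv_mul _ M.isUnit_det_gram, Matrix.mul_one, sub_self]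

theorem Xk_transpose_mul_residualProj : M.Xkᵀ * M.residualProj = 0 := by
  rw [← M.residualProj_transpose, ← transpose_mul, residualProj_mul_Xk, transpose_zero]

theorem residualProj_mul_self : M.residualProj * M.residualProj = M.residualProj := by
  change (1 - M.Xk * (M.Xkᵀ * M.Xk)⁻¹ * M.Xkᵀ) * M.residualProj = M.residualProj
  rw [Matrix.sub_mul, Matrix.one_mul, Matrix.mul_assoc, Xk_transpose_mul_residualProj, Matrix.mul_zero, sub_zero]

/-- The residual of a response in the column space of `X`. -/
theorem residualProj_mulVec (v : Fin k ⊕ Fin q → ℝ) :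
    M.residualProj *ᵥ (M.X *ᵥ v) = M.residualProj *ᵥ (M.Xc *ᵥ (v ∘ Sum.inr)) := by
  rw [X_mulVec, mulVec_add, mulVec_mulVec, residualProj_mul_Xk, zero_mulVec, zero_add]

theorem dotProduct_residualProj (v w : Fin n → ℝ) :
    v ⬝ᵥ (M.residualProj *ᵥ w) = (M.residualProj *ᵥ v) ⬝ᵥ (M.residualProj *ᵥ w) := by
  conv_lhs => rw [← M.residualProj_mul_self, ← mulVec_mulVec, dotProduct_mulVec, ← mulVec_transpose,
    residualProj_transpose]

/-- The residual projection kills the columns of X_k, so only the excluded coefficients matter,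
through the Schur complement. -/
theorem Q_eq (v : Fin k ⊕ Fin q → ℝ) :
    M.Q v = (1 / (n : ℝ)) * ((v ∘ Sum.inr) ⬝ᵥ (M.schur *ᵥ (v ∘ Sum.inr))) := by
  rw [Q, dotProduct_residualProj, residualProj_mulVec, ← dotProduct_residualProj, schur,
    ← mulVec_mulVec, ← mulVec_mulVec, dotProduct_mulVec (v ∘ Sum.inr), vecMul_transpose]

/-- Writing the residual as an element of the column space of X keeps v visible as its excluded
part. Injectivity of X then makes the Schur complement positive definite. -/
theorem residual_decomp (v : Fin q → ℝ) :
    M.residualProj *ᵥ (M.Xc *ᵥ v) = M.X *ᵥ Sum.elim (-(M.coef *ᵥ v)) v := by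
  rw [X_mulVec, residualProj]
  simp only [Sum.elim_comp_inl, Sum.elim_comp_inr, mulVec_neg, mulVec_mulVec, Matrix.mul_assoc,
    Matrix.sub_mul, Matrix.one_mul, sub_mulVec, coef]
  abel

theorem posDef_schur : M.schur.PosDef := by
  have h := posDef_transpose_mul_self (M.residualProj * M.Xc) (fun v hv => by
    rw [← mulVec_mulVec, residual_decomp] at hv
    simpa using congrArg (· ∘ Sum.inr) (M.X_mulVec_eq_zero hv))
  rwa [transpose_mul, residualProj_transpose, Matrix.mul_assoc, ← Matrix.mul_assoc M.residualProj,
    residualProj_mul_self, ← Matrix.mul_assoc] at h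

theorem isUnit_det_schur : IsUnit M.schur.det := M.posDef_schur.det_pos.ne'.isUnit

/-- A square root of `(X_kᵀX_k)⁻¹`. -/
def rootK : Matrix (Fin k) (Fin k) ℝ := Classical.choose (exists_mul_transpose_eq M.posDef_gram)

/-- A square root of the inverse Schur complement. -/
def rootC : Matrix (Fin q) (Fin q) ℝ := Classical.choose (exists_mul_transpose_eq M.posDef_schur)

theorem det_rootK : M.rootK.det ≠ 0 :=
  (Classical.choose_spec (exists_mul_transpose_eq M.posDef_gram)).1

theorem rootK_mul : M.rootK * M.rootKᵀ = M.gram⁻¹ :=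
  (Classical.choose_spec (exists_mul_transpose_eq M.posDef_gram)).2

theorem det_rootC : M.rootC.det ≠ 0 :=
  (Classical.choose_spec (exists_mul_transpose_eq M.posDef_schur)).1

theorem rootC_mul : M.rootC * M.rootCᵀ = M.schur⁻¹ :=
  (Classical.choose_spec (exists_mul_transpose_eq M.posDef_schur)).2

theorem rootC_transpose_mul : M.rootCᵀ * (M.schur * M.rootC) = 1 := by
  rw [mul_eq_one_comm, Matrix.mul_assoc, rootC_mul, mul_nonsing_inv _ M.isUnit_det_schur]

theorem rootK_transpose_mul : M.rootKᵀ * (M.gram * M.rootK) = 1 := by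
  rw [mul_eq_one_comm, Matrix.mul_assoc, rootK_mul, mul_nonsing_inv _ M.isUnit_det_gram]

/-- A square root of `g (XᵀX)⁻¹` adapted to the splitting of the columns. -/
def root : Matrix (Fin k ⊕ Fin q) (Fin k ⊕ Fin q) ℝ :=
  Real.sqrt M.g • fromBlocks M.rootK (-(M.coef * M.rootC)) 0 M.rootC

theorem det_root : M.root.det ≠ 0 := by
  rw [root, det_smul, det_fromBlocks_zero₂₁]
  exact mul_ne_zero (pow_ne_zero _ (Real.sqrt_pos.2 M.g_pos).ne') (mul_ne_zero M.det_rootK M.det_rootC)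

theorem schur_eq : M.schur = M.Xcᵀ * M.Xc - (M.Xkᵀ * M.Xc)ᵀ * M.coef := by
  simp only [schur, residualProj, Matrix.mul_sub, Matrix.sub_mul, Matrix.mul_one, transpose_mul,
    transpose_transpose, Matrix.mul_assoc, coef]

theorem coef_transpose : M.coefᵀ = (M.Xkᵀ * M.Xc)ᵀ * M.gram⁻¹ := by
  rw [coef, transpose_mul, transpose_nonsing_inv, gram_transpose]

theorem root_mul : M.root * M.rootᵀ = M.g • (M.Xᵀ * M.X)⁻¹ := by
  have h1 : M.Xᵀ * M.X = fromBlocks M.gram (M.Xkᵀ * M.Xc) (M.Xkᵀ * M.Xc)ᵀ (M.Xcᵀ * M.Xc) := by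
    rw [X, transpose_fromCols, fromRows_mul_fromCols, transpose_mul, transpose_transpose]
  have h2 : fromBlocks M.rootK (-(M.coef * M.rootC)) 0 M.rootC *
      (fromBlocks M.rootK (-(M.coef * M.rootC)) 0 M.rootC)ᵀ =
      fromBlocks (M.gram⁻¹ + M.coef * M.schur⁻¹ * M.coefᵀ) (-(M.coef * M.schur⁻¹))
        (-(M.schur⁻¹ * M.coefᵀ)) M.schur⁻¹ := by
    rw [fromBlocks_transpose, fromBlocks_multiply, ← rootK_mul, ← rootC_mul]
    simp only [transpose_neg, transpose_mul, transpose_zero, Matrix.neg_mul, Matrix.mul_neg, neg_neg,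
      Matrix.mul_zero, Matrix.zero_mul, zero_add, Matrix.mul_assoc]
  have hg := mul_nonsing_inv _ M.isUnit_det_gram
  have hs := mul_nonsing_inv _ M.isUnit_det_schur
  have hc : M.gram * M.coef = M.Xkᵀ * M.Xc := by
    rw [coef, ← Matrix.mul_assoc, hg, Matrix.one_mul]
  have hd : M.Xcᵀ * M.Xc = M.schur + (M.Xkᵀ * M.Xc)ᵀ * M.coef := by
    rw [schur_eq, sub_add_cancel]
  -- The block inverse formula, verified by multiplying out.
  have h3 : (M.Xᵀ * M.X)⁻¹ = fromBlocks (M.gram⁻¹ + M.coef * M.schur⁻¹ * M.coefᵀ)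
      (-(M.coef * M.schur⁻¹)) (-(M.schur⁻¹ * M.coefᵀ)) M.schur⁻¹ := by
    apply inv_eq_right_inv
    rw [h1, fromBlocks_multiply, ← fromBlocks_one]
    congr 1
    · rw [Matrix.mul_add, hg, ← Matrix.mul_assoc, ← Matrix.mul_assoc, hc, Matrix.mul_neg,
        Matrix.mul_assoc, add_assoc, add_neg_cancel, add_zero]
    · rw [Matrix.mul_neg, ← Matrix.mul_assoc, hc, neg_add_cancel]
    · rw [hd, Matrix.mul_add, Matrix.mul_neg, Matrix.add_mul, ← Matrix.mul_assoc M.schur, hs,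
        Matrix.one_mul, coef_transpose]
      simp only [Matrix.mul_assoc]
      abel
    · rw [hd, Matrix.mul_neg, Matrix.add_mul, hs, ← Matrix.mul_assoc]
      abel
  rw [root, transpose_smul, smul_mul_smul, Real.mul_self_sqrt M.g_pos.le, h2, h3]

end Setting


/-! ### The prior in standardized variables. -/

namespace Setting

variable {n k q : ℕ} (M : Setting n k q)

/-- The standardized prior mean of the excluded coefficients. -/
def shift : Fin q → ℝ := M.rootC⁻¹ *ᵥ M.bc

/-- The law of the pair of standardized excluded coefficients and precision. -/
abbrev noise : Measure ((Fin q → ℝ) × ℝ) :=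
  (stdNormal (Fin q)).prod (gammaMeasure (M.d / 2) (M.a / 2))

/-- The law of all the standardized variables. -/
abbrev canon : Measure ((Fin k → ℝ) × ((Fin q → ℝ) × ℝ)) :=
  (stdNormal (Fin k)).prod M.noise

/-- The parameters of the full model as a function of the standardized variables. -/
def param (ω : (Fin k → ℝ) × ((Fin q → ℝ) × ℝ)) : (Fin k ⊕ Fin q → ℝ) × ℝ :=
  (Sum.elim M.bk M.bc + Real.sqrt ω.2.2⁻¹ • (M.root *ᵥ Sum.elim ω.1 ω.2.1), ω.2.2⁻¹)

instance : IsProbabilityMeasure (gammaMeasure (M.d / 2) (M.a / 2)) :=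
  isProbabilityMeasure_gammaMeasure (half_pos M.d_pos) (half_pos M.a_pos)

theorem measurable_sumElim :
    Measurable fun p : (Fin k → ℝ) × (Fin q → ℝ) => (Sum.elim p.1 p.2 : Fin k ⊕ Fin q → ℝ) := by
  refine measurable_pi_lambda _ fun i => ?_
  rcases i with i | i
  · exact (measurable_pi_apply i).comp measurable_fst
  · exact (measurable_pi_apply i).comp measurable_snd

theorem measurable_param : Measurable M.param := by
  have h : Measurable fun ω : (Fin k → ℝ) × ((Fin q → ℝ) × ℝ) =>
      Real.sqrt ω.2.2⁻¹ • (M.root *ᵥ Sum.elim ω.1 ω.2.1) :=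
    measurable_snd.snd.inv.sqrt.smul ((measurable_mulVec M.root).comp
      (measurable_sumElim.comp (measurable_fst.prodMk measurable_snd.fst)))
  exact (h.const_add _).prodMk measurable_snd.snd.inv

theorem prior_eq_map : M.prior = M.canon.map M.param := by
  have h1 := measurePreserving_sumPiEquivProdPi_symm (fun _ : Fin k ⊕ Fin q => gaussianReal 0 1)
  have h2 : MeasurePreserving (MeasurableEquiv.prodAssoc
      (α := Fin k → ℝ) (β := Fin q → ℝ) (γ := ℝ)).symm M.canon
      (((stdNormal (Fin k)).prod (stdNormal (Fin q))).prod (gammaMeasure (M.d / 2) (M.a / 2))) :=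
    (measurePreserving_prodAssoc _ _ _).symm
  have h3 := (h1.prod (MeasurePreserving.id (gammaMeasure (M.d / 2) (M.a / 2)))).comp h2
  rw [prior, ← root_mul, NIGa_eq_map _ M.det_root M.d_pos M.a_pos, ← h3.map_eq, Measure.map_map]
  · congr 1
  · exact Measurable.prodMk (Measurable.const_add ((measurable_snd.inv.sqrt).smul
      ((measurable_mulVec M.root).comp measurable_fst)) _) measurable_snd.inv
  · exact h3.measurable

instance : IsProbabilityMeasure M.prior := by
  rw [prior_eq_map]
  exact Measure.isProbabilityMeasure_map M.measurable_param.aemeasurable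

/-- `Q_k(β) / σ²` in terms of the standardized variables. -/
def excess (ω : (Fin q → ℝ) × ℝ) : ℝ :=
  (1 / (n : ℝ)) * ∑ i, (Real.sqrt ω.2 * M.shift i + Real.sqrt M.g * ω.1 i) ^ 2

theorem excess_nonneg (ω : (Fin q → ℝ) × ℝ) : 0 ≤ M.excess ω :=
  mul_nonneg (by positivity) (Finset.sum_nonneg fun _ _ => sq_nonneg _)

theorem measurable_excess : Measurable M.excess := by
  unfold excess
  fun_prop

theorem schur_quadForm_rootC (v : Fin q → ℝ) :
    (M.rootC *ᵥ v) ⬝ᵥ (M.schur *ᵥ (M.rootC *ᵥ v)) = ∑ i, v i ^ 2 := by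
  rw [mulVec_mulVec, ← vecMul_transpose, ← dotProduct_mulVec, mulVec_mulVec, rootC_transpose_mul,
    one_mulVec]
  simp [dotProduct, sq]

theorem rootC_shift : M.rootC *ᵥ M.shift = M.bc := by
  rw [shift, mulVec_mulVec, mul_nonsing_inv _ M.det_rootC.isUnit, one_mulVec]

theorem Q_prior_mean :
    M.Q (Sum.elim M.bk M.bc) = (1 / (n : ℝ)) * ∑ i, M.shift i ^ 2 := by
  rw [Q_eq, Sum.elim_comp_inr, ← rootC_shift, schur_quadForm_rootC]

theorem param_inr (ω : (Fin k → ℝ) × ((Fin q → ℝ) × ℝ)) :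
    (M.param ω).1 ∘ Sum.inr =
      M.rootC *ᵥ (M.shift + (Real.sqrt ω.2.2⁻¹ * Real.sqrt M.g) • ω.2.1) := by
  rw [mulVec_add, rootC_shift, mulVec_smul, param, root, smul_mulVec, fromBlocks_mulVec, smul_smul]
  funext i
  simp

theorem param_inl (ω : (Fin k → ℝ) × ((Fin q → ℝ) × ℝ)) :
    (M.param ω).1 ∘ Sum.inl = M.bk + (Real.sqrt ω.2.2⁻¹ * Real.sqrt M.g) •
      (M.rootK *ᵥ ω.1 - M.coef *ᵥ (M.rootC *ᵥ ω.2.1)) := by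
  rw [param, root, smul_mulVec, fromBlocks_mulVec, smul_smul]
  funext i
  simp [sub_eq_add_neg, neg_mulVec, mulVec_mulVec, mul_add]

theorem projMean_eq : M.projMean = M.bk + M.coef *ᵥ M.bc := by
  rw [projMean, mulVec_mulVec]

/-- The off-diagonal block of `root` is chosen so that the noise of the excluded coefficients
cancels here; given T, the projected coefficients depend on the k-dimensional noise only. -/
theorem param_proj (ω : (Fin k → ℝ) × ((Fin q → ℝ) × ℝ)) :
    (M.param ω).1 ∘ Sum.inl + M.coef *ᵥ ((M.param ω).1 ∘ Sum.inr) =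
      M.projMean + (Real.sqrt ω.2.2⁻¹ * Real.sqrt M.g) • (M.rootK *ᵥ ω.1) := by
  rw [param_inl, param_inr, projMean_eq, mulVec_add, mulVec_add, rootC_shift, mulVec_smul, mulVec_smul,
    smul_sub]
  abel

/-- Dividing by σ² multiplies by T, which cancels the factor T^(-1/2) of the noise and moves √T to
the shift. -/
theorem Q_param {ω : (Fin k → ℝ) × ((Fin q → ℝ) × ℝ)} (hω : 0 < ω.2.2) :
    M.Q (M.param ω).1 / (M.param ω).2 = M.excess ω.2 := by
  rw [Q_eq, param_inr, schur_quadForm_rootC, param, excess, div_inv_eq_mul, mul_assoc,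
    Finset.sum_mul]
  congr 1
  refine Finset.sum_congr rfl fun i _ => ?_
  have h : Real.sqrt ω.2.2 * Real.sqrt ω.2.2⁻¹ = 1 := by
    rw [← Real.sqrt_mul hω.le, mul_inv_cancel₀ hω.ne', Real.sqrt_one]
  have h2 := Real.mul_self_sqrt hω.le
  simp only [Pi.add_apply, Pi.smul_apply, smul_eq_mul]
  calc (M.shift i + Real.sqrt ω.2.2⁻¹ * Real.sqrt M.g * ω.2.1 i) ^ 2 * ω.2.2
      = (Real.sqrt ω.2.2 * M.shift i +
        (Real.sqrt ω.2.2 * Real.sqrt ω.2.2⁻¹) * Real.sqrt M.g * ω.2.1 i) ^ 2 := by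
        linear_combination (-(M.shift i + Real.sqrt ω.2.2⁻¹ * Real.sqrt M.g * ω.2.1 i) ^ 2) * h2
    _ = _ := by rw [h, one_mul]

theorem R_param {ω : (Fin k → ℝ) × ((Fin q → ℝ) × ℝ)} (hω : 0 < ω.2.2) :
    M.R (M.param ω) = (1 + M.excess ω.2)⁻¹ := by
  rw [R, Q_param M hω]

theorem measurable_Q : Measurable M.Q := by
  unfold Q
  simp only [dotProduct]
  refine Measurable.const_mul (Finset.measurable_sum _ fun i _ => ?_) _
  exact ((measurable_pi_apply i).comp (measurable_mulVec M.X)).mul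
    ((measurable_pi_apply i).comp ((measurable_mulVec M.residualProj).comp (measurable_mulVec M.X)))

theorem measurable_R : Measurable M.R :=
  (((M.measurable_Q.comp measurable_fst).div measurable_snd).const_add 1).inv

theorem ae_canon_pos : ∀ᵐ ω ∂M.canon, 0 < ω.2.2 := by
  have h1 : ∀ᵐ p ∂M.noise, 0 < p.2 :=
    Measure.quasiMeasurePreserving_snd.ae (ae_pos_gammaMeasure _ _)
  exact Measure.quasiMeasurePreserving_snd.ae h1

theorem ae_noise_pos : ∀ᵐ p ∂M.noise, 0 < p.2 :=
  Measure.quasiMeasurePreserving_snd.ae (ae_pos_gammaMeasure _ _)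

/-- Turns prior expectations of functions of R_k and σ² into integrals over the excluded noise and
the precision. -/
theorem prior_transfer {f : (Fin k ⊕ Fin q → ℝ) × ℝ → ℝ} {h : (Fin q → ℝ) × ℝ → ℝ}
    (hf : Measurable f) (hh : Measurable h)
    (hfh : ∀ ω : (Fin k → ℝ) × ((Fin q → ℝ) × ℝ), 0 < ω.2.2 → f (M.param ω) = h ω.2) :
    (Integrable f M.prior ↔ Integrable h M.noise) ∧ ∫ θ, f θ ∂M.prior = ∫ p, h p ∂M.noise := by
  have hae : (fun ω => f (M.param ω)) =ᵐ[M.canon] fun ω => h ω.2 := by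
    filter_upwards [M.ae_canon_pos] with ω hω using hfh ω hω
  have hsnd : MeasurePreserving Prod.snd M.canon M.noise := measurePreserving_snd
  constructor
  · rw [prior_eq_map, integrable_map_measure hf.aestronglyMeasurable M.measurable_param.aemeasurable,
      ← hsnd.integrable_comp hh.aestronglyMeasurable]
    exact integrable_congr hae
  · rw [prior_eq_map, integral_map M.measurable_param.aemeasurable hf.aestronglyMeasurable,
      integral_congr_ae hae, ← hsnd.map_eq, integral_map hsnd.measurable.aemeasurable
        hh.aestronglyMeasurable]

end Setting


/-! ### Gaussian and noncentral chi-square moments. -/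

theorem integrable_pow_gaussian (m : ℕ) : Integrable (fun x : ℝ => x ^ m) (gaussianReal 0 1) := by
  refine integrable_pow_of_mem_interior_integrableExpSet (X := fun x : ℝ => x) ?_ m
  rw [integrableExpSet_fun_id_gaussianReal]
  simp

theorem gaussian_moment_one : ∫ x, x ∂gaussianReal 0 1 = 0 := by simp

theorem gaussian_moment_two : ∫ x, x ^ 2 ∂gaussianReal 0 1 = 1 := by
  have h := variance_fun_id_gaussianReal (μ := 0) (v := 1)
  rw [variance_of_integral_eq_zero (by fun_prop) (by simp)] at h
  simpa using h

theorem gaussian_moment_three : ∫ x, x ^ 3 ∂gaussianReal 0 1 = 0 := by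
  have h := gaussianReal_map_neg (μ := 0) (v := 1)
  rw [neg_zero] at h
  have h2 : ∫ x, x ^ 3 ∂gaussianReal 0 1 = ∫ x, (-x) ^ 3 ∂gaussianReal 0 1 := by
    conv_lhs => rw [← h]
    rw [integral_map (by fun_prop) (by fun_prop)]
  have h3 : ∀ x : ℝ, (-x) ^ 3 = -(x ^ 3) := fun x => by ring
  simp only [h3, integral_neg] at h2
  linarith

theorem gaussian_moment_four : ∫ x, x ^ 4 ∂gaussianReal 0 1 = 3 := by
  rw [integral_gaussianReal_eq_integral_smul one_ne_zero]
  have h1 : ∀ x : ℝ, gaussianPDFReal 0 1 x • x ^ 4 =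
      (fun t : ℝ => (Real.sqrt (2 * Real.pi))⁻¹ * (t ^ (4 : ℝ) * Real.exp (-(1 / 2) * t ^ (2 : ℝ)))) |x| := by
    intro x
    have e4 : |x| ^ (4 : ℝ) = x ^ 4 := by
      rw [show (4 : ℝ) = ((4 : ℕ) : ℝ) by norm_num, Real.rpow_natCast, Even.pow_abs ⟨2, rfl⟩]
    have e2 : |x| ^ (2 : ℝ) = x ^ 2 := by
      rw [show (2 : ℝ) = ((2 : ℕ) : ℝ) by norm_num, Real.rpow_natCast, sq_abs]
    simp only [gaussianPDFReal, smul_eq_mul, e4, e2]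
    simp
    ring_nf
  rw [integral_congr_ae (Filter.Eventually.of_forall h1), integral_comp_abs (f := fun t : ℝ =>
    (Real.sqrt (2 * Real.pi))⁻¹ * (t ^ (4 : ℝ) * Real.exp (-(1 / 2) * t ^ (2 : ℝ)))), integral_const_mul,
    integral_rpow_mul_exp_neg_mul_rpow (by norm_num) (by norm_num) (by norm_num)]
  have e1 : Real.Gamma ((4 + 1) / 2) = 3 / 4 * Real.sqrt Real.pi := by
    rw [show ((4 : ℝ) + 1) / 2 = (1 / 2 + 1) + 1 by norm_num, Real.Gamma_add_one (by norm_num),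
      Real.Gamma_add_one (by norm_num), Real.Gamma_one_half_eq]
    ring
  have e2 : ((1 : ℝ) / 2) ^ (-(4 + 1 : ℝ) / 2) = 4 * Real.sqrt 2 := by
    rw [one_div, Real.inv_rpow (by norm_num), ← Real.rpow_neg (by norm_num),
      show -(-(4 + 1 : ℝ) / 2) = 2 + 1 / 2 by norm_num, Real.rpow_add (by norm_num),
      ← Real.sqrt_eq_rpow]
    norm_num
  rw [e1, e2, Real.sqrt_mul (by norm_num)]
  have := Real.sqrt_pos.2 Real.pi_pos
  have : 0 < Real.sqrt 2 := by positivity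
  field_simp

theorem gaussian_exp_neg_sq {c : ℝ} (hc : 0 ≤ c) :
    ∫ x, Real.exp (-(c * x ^ 2)) ∂gaussianReal 0 1 = (1 + 2 * c) ^ (-(1 / 2) : ℝ) := by
  rw [integral_gaussianReal_eq_integral_smul one_ne_zero]
  have h1 : ∀ x : ℝ, gaussianPDFReal 0 1 x • Real.exp (-(c * x ^ 2)) =
      (Real.sqrt (2 * Real.pi))⁻¹ * Real.exp (-(1 / 2 + c) * x ^ 2) := by
    intro x
    simp only [gaussianPDFReal, smul_eq_mul, sub_zero, NNReal.coe_one, mul_one]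
    rw [mul_assoc, ← Real.exp_add]
    congr 2
    ring
  rw [integral_congr_ae (Filter.Eventually.of_forall h1), integral_const_mul, integral_gaussian,
    Real.rpow_neg (by positivity), ← Real.sqrt_eq_rpow, ← Real.sqrt_inv, ← Real.sqrt_inv,
    ← Real.sqrt_mul (by positivity)]
  congr 1
  have := Real.pi_pos
  field_simp

/-- Degree four is what the second moment of a squared affine Gaussian requires. -/
theorem gaussian_quartic (a₀ a₁ a₂ a₃ a₄ : ℝ) :
    Integrable (fun x : ℝ => a₀ + (a₁ * x + (a₂ * x ^ 2 + (a₃ * x ^ 3 + a₄ * x ^ 4))))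
      (gaussianReal 0 1) ∧
    ∫ x, (a₀ + (a₁ * x + (a₂ * x ^ 2 + (a₃ * x ^ 3 + a₄ * x ^ 4)))) ∂gaussianReal 0 1 =
      a₀ + a₂ + 3 * a₄ := by
  have h0 : Integrable (fun _ : ℝ => a₀) (gaussianReal 0 1) := integrable_const _
  have h1 : Integrable (fun x : ℝ => a₁ * x) (gaussianReal 0 1) := by
    simpa using (integrable_pow_gaussian 1).const_mul a₁
  have h2 := (integrable_pow_gaussian 2).const_mul a₂
  have h3 := (integrable_pow_gaussian 3).const_mul a₃
  have h4 := (integrable_pow_gaussian 4).const_mul a₄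
  have h34 : Integrable (fun x : ℝ => a₃ * x ^ 3 + a₄ * x ^ 4) (gaussianReal 0 1) := h3.add h4
  have h24 : Integrable (fun x : ℝ => a₂ * x ^ 2 + (a₃ * x ^ 3 + a₄ * x ^ 4)) (gaussianReal 0 1) :=
    h2.add h34
  have h14 : Integrable (fun x : ℝ => a₁ * x + (a₂ * x ^ 2 + (a₃ * x ^ 3 + a₄ * x ^ 4)))
    (gaussianReal 0 1) := h1.add h24
  refine ⟨h0.add h14, ?_⟩
  rw [integral_add h0 h14, integral_add h1 h24, integral_add h2 h34, integral_add h3 h4,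
    integral_const_mul, integral_const_mul, integral_const_mul, integral_const_mul,
    gaussian_moment_one, gaussian_moment_two, gaussian_moment_three, gaussian_moment_four]
  simp
  ring

/-- Mean and variance of the square of a normal variable. -/
theorem gaussian_sq_affine (v s : ℝ) :
    MemLp (fun x : ℝ => (v + s * x) ^ 2) 2 (gaussianReal 0 1) ∧
    ∫ x, (v + s * x) ^ 2 ∂gaussianReal 0 1 = v ^ 2 + s ^ 2 ∧
    variance (fun x : ℝ => (v + s * x) ^ 2) (gaussianReal 0 1) = 4 * s ^ 2 * v ^ 2 + 2 * s ^ 4 := by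
  have e2 : ∀ x : ℝ, (v + s * x) ^ 2 =
      v ^ 2 + (2 * v * s * x + (s ^ 2 * x ^ 2 + (0 * x ^ 3 + 0 * x ^ 4))) := fun x => by ring
  have e4 : ∀ x : ℝ, ((v + s * x) ^ 2) ^ 2 = v ^ 4 + (4 * v ^ 3 * s * x + (6 * v ^ 2 * s ^ 2 * x ^ 2 +
      (4 * v * s ^ 3 * x ^ 3 + s ^ 4 * x ^ 4))) := fun x => by ring
  have hL : MemLp (fun x : ℝ => (v + s * x) ^ 2) 2 (gaussianReal 0 1) := by
    rw [memLp_two_iff_integrable_sq (by fun_prop)]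
    simp only [e4]
    exact (gaussian_quartic _ _ _ _ _).1
  have hm : ∫ x, (v + s * x) ^ 2 ∂gaussianReal 0 1 = v ^ 2 + s ^ 2 := by
    simp only [e2]
    rw [(gaussian_quartic _ _ _ _ _).2]
    ring
  refine ⟨hL, hm, ?_⟩
  rw [variance_eq_sub hL, hm]
  simp only [Pi.pow_apply, e4]
  rw [(gaussian_quartic _ _ _ _ _).2]
  ring

theorem integral_eval_stdNormal {ι : Type*} [Fintype ι] (i : ι) {f : ℝ → ℝ} (hf : Measurable f) :
    ∫ w, f (w i) ∂stdNormal ι = ∫ x, f x ∂gaussianReal 0 1 := by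
  have h := measurePreserving_eval (fun _ : ι => gaussianReal 0 1) i
  rw [← h.map_eq, integral_map h.measurable.aemeasurable hf.aestronglyMeasurable]

/-- First and second moments of a noncentral chi-square variable. -/
theorem noncentral_moments {ι : Type*} [Fintype ι] (v : ι → ℝ) (s : ℝ) :
    ∫ w, ∑ i, (v i + s * w i) ^ 2 ∂stdNormal ι = ∑ i, v i ^ 2 + s ^ 2 * Fintype.card ι ∧
    ∫ w, (∑ i, (v i + s * w i) ^ 2) ^ 2 ∂stdNormal ι =
      4 * s ^ 2 * ∑ i, v i ^ 2 + 2 * s ^ 4 * Fintype.card ι +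
        (∑ i, v i ^ 2 + s ^ 2 * Fintype.card ι) ^ 2 := by
  have hL : ∀ i, MemLp (fun w : ι → ℝ => (v i + s * w i) ^ 2) 2 (stdNormal ι) := fun i =>
    (gaussian_sq_affine (v i) s).1.comp_measurePreserving
      (measurePreserving_eval (fun _ : ι => gaussianReal 0 1) i)
  have hm : ∫ w, ∑ i, (v i + s * w i) ^ 2 ∂stdNormal ι = ∑ i, v i ^ 2 + s ^ 2 * Fintype.card ι := by
    rw [integral_finsetSum _ fun i _ => (hL i).integrable (by norm_num)]
    have : ∀ i, ∫ w, (v i + s * w i) ^ 2 ∂stdNormal ι = v i ^ 2 + s ^ 2 := by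
      intro i
      rw [← (gaussian_sq_affine (v i) s).2.1,
        integral_eval_stdNormal i (f := fun x => (v i + s * x) ^ 2) (by fun_prop)]
    simp only [this, Finset.sum_add_distrib, Finset.sum_const, Finset.card_univ, nsmul_eq_mul]
    ring
  refine ⟨hm, ?_⟩
  have hLs : MemLp (fun w : ι → ℝ => ∑ i, (v i + s * w i) ^ 2) 2 (stdNormal ι) :=
    memLp_finsetSum _ fun i _ => hL i
  have h1 := variance_eq_sub hLs
  -- Independence of the coordinates adds the variances; the second moment is variance plus squared
  -- mean.
  have h2 := variance_sum_pi (X := fun i (x : ℝ) => (v i + s * x) ^ 2)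
    (μ := fun _ : ι => gaussianReal 0 1) fun i => (gaussian_sq_affine (v i) s).1
  have h3 : (∑ i, fun ω : ι → ℝ => (v i + s * ω i) ^ 2) =
      fun w : ι → ℝ => ∑ i, (v i + s * w i) ^ 2 := by
    ext w
    simp
  rw [h3] at h2
  rw [hm, h2] at h1
  simp only [(gaussian_sq_affine _ s).2.2, Finset.sum_add_distrib, Finset.sum_const, Finset.card_univ,
    nsmul_eq_mul, ← Finset.mul_sum, Pi.pow_apply] at h1
  linarith

/-- The power mean inequality bounds the power of the sum by a multiple of the sum of the powers,
which are one-dimensional moments. -/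
theorem integrable_normSq_pow (ι : Type*) [Fintype ι] (m : ℕ) :
    Integrable (fun w : ι → ℝ => (∑ i, w i ^ 2) ^ (m + 1)) (stdNormal ι) := by
  have h : Integrable (fun w : ι → ℝ => (Fintype.card ι : ℝ) ^ m * ∑ i, (w i ^ 2) ^ (m + 1))
      (stdNormal ι) := by
    refine (integrable_finsetSum _ fun i _ => ?_).const_mul _
    have h1 := (measurePreserving_eval (fun _ : ι => gaussianReal 0 1) i).integrable_comp_of_integrable
      (integrable_pow_gaussian (2 * (m + 1)))
    simp only [← pow_mul]
    exact h1
  refine h.mono' (by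
    have : Measurable fun w : ι → ℝ => (∑ i, w i ^ 2) ^ (m + 1) := by fun_prop
    exact this.aestronglyMeasurable) (Filter.Eventually.of_forall fun w => ?_)
  have hnn : 0 ≤ ∑ i, w i ^ 2 := Finset.sum_nonneg fun _ _ => sq_nonneg _
  rw [Real.norm_of_nonneg (by positivity)]
  have hc := pow_sum_div_card_le_sum_pow (s := Finset.univ) (f := fun i => w i ^ 2)
    (fun i _ => sq_nonneg _) m
  rcases isEmpty_or_nonempty ι with hι | hι
  · simp
  · rwa [div_le_iff₀' (by rw [Finset.card_univ]; have := Fintype.card_pos (α := ι); positivity),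
      Finset.card_univ] at hc


/-! ### Moments of Q_k/σ², and of R_k and its inverse. -/

namespace Setting

variable {n k q : ℕ} (M : Setting n k q)

theorem shift_sq_sum : ∑ i, M.shift i ^ 2 = n * M.Q (Sum.elim M.bk M.bc) := by
  rw [Q_prior_mean, ← mul_assoc, mul_one_div_cancel M.n_cast_pos.ne', one_mul]

theorem Q_prior_mean_nonneg : 0 ≤ M.Q (Sum.elim M.bk M.bc) := by
  rw [Q_prior_mean]
  exact mul_nonneg (by positivity) (Finset.sum_nonneg fun _ _ => sq_nonneg _)

/-- The inequality (u + v)² ≤ 2u² + 2v² separates the precision from the noise, so that moments of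
all orders can be bounded. -/
theorem excess_le {ω : (Fin q → ℝ) × ℝ} (hω : 0 < ω.2) :
    M.excess ω ≤ 2 * (M.Q (Sum.elim M.bk M.bc) * ω.2 + M.g / n * ∑ i, ω.1 i ^ 2) := by
  have hn := M.n_cast_pos
  have h1 : ∑ i, (Real.sqrt ω.2 * M.shift i + Real.sqrt M.g * ω.1 i) ^ 2 ≤
      ∑ i, (2 * ω.2 * M.shift i ^ 2 + 2 * M.g * ω.1 i ^ 2) := by
    refine Finset.sum_le_sum fun i _ => ?_
    refine (add_sq_le (a := Real.sqrt ω.2 * M.shift i) (b := Real.sqrt M.g * ω.1 i)).trans_eq ?_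
    rw [mul_pow, mul_pow, Real.sq_sqrt hω.le, Real.sq_sqrt M.g_pos.le]
    ring
  rw [Finset.sum_add_distrib, ← Finset.mul_sum, ← Finset.mul_sum, shift_sq_sum] at h1
  calc M.excess ω ≤ (1 / (n : ℝ)) * _ := mul_le_mul_of_nonneg_left h1 (by positivity)
    _ = _ := by
      field_simp

theorem integrable_precision_pow (m : ℕ) :
    Integrable (fun ω : (Fin q → ℝ) × ℝ => ω.2 ^ m) M.noise :=
  (gamma_pow_moment (half_pos M.d_pos) (half_pos M.a_pos) m).1.comp_snd (stdNormal (Fin q))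

theorem integral_precision_comp (f : ℝ → ℝ) :
    ∫ ω, f ω.2 ∂M.noise = ∫ t, f t ∂gammaMeasure (M.d / 2) (M.a / 2) := by
  rw [integral_fun_snd]
  simp

theorem integral_coord_comp (f : (Fin q → ℝ) → ℝ) :
    ∫ ω, f ω.1 ∂M.noise = ∫ w, f w ∂stdNormal (Fin q) := by
  rw [integral_fun_fst]
  simp

theorem excess_pow_le {ω : (Fin q → ℝ) × ℝ} (hω : 0 < ω.2) (m : ℕ) :
    M.excess ω ^ (m + 1) ≤ 2 ^ (m + 1) * 2 ^ m *
      (M.Q (Sum.elim M.bk M.bc) ^ (m + 1) * ω.2 ^ (m + 1) +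
        (M.g / n) ^ (m + 1) * (∑ i, ω.1 i ^ 2) ^ (m + 1)) := by
  have h0 := M.Q_prior_mean_nonneg
  have h1 : 0 ≤ ∑ i, ω.1 i ^ 2 := Finset.sum_nonneg fun i _ => sq_nonneg (ω.1 i)
  have h2 : 0 ≤ M.g / n := div_nonneg M.g_pos.le (Nat.cast_nonneg n)
  refine (pow_le_pow_left₀ (M.excess_nonneg ω) (M.excess_le hω) _).trans ?_
  have h3 := add_pow_le (mul_nonneg h0 hω.le) (mul_nonneg h2 h1) (m + 1)
  rw [mul_pow _ ω.2, mul_pow (M.g / n)] at h3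
  rw [mul_pow, mul_assoc]
  exact mul_le_mul_of_nonneg_left h3 (by positivity)

theorem integrable_excess_pow_bound (m : ℕ) :
    Integrable (fun ω : (Fin q → ℝ) × ℝ => 2 ^ (m + 1) * 2 ^ m *
      (M.Q (Sum.elim M.bk M.bc) ^ (m + 1) * ω.2 ^ (m + 1) +
        (M.g / n) ^ (m + 1) * (∑ i, ω.1 i ^ 2) ^ (m + 1))) M.noise :=
  (((M.integrable_precision_pow (m + 1)).const_mul _).add
    (((integrable_normSq_pow (Fin q) m).comp_fst _).const_mul _)).const_mul _

theorem integrable_excess_pow (m : ℕ) : Integrable (fun ω => M.excess ω ^ (m + 1)) M.noise := by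
  refine (M.integrable_excess_pow_bound m).mono' (M.measurable_excess.pow_const _).aestronglyMeasurable ?_
  filter_upwards [M.ae_noise_pos] with ω hω
  rw [Real.norm_of_nonneg (pow_nonneg (M.excess_nonneg ω) _)]
  exact M.excess_pow_le hω m

theorem integral_excess_pow_le (m : ℕ) :
    ∫ ω, M.excess ω ^ (m + 1) ∂M.noise ≤ 2 ^ (m + 1) * 2 ^ m *
      (M.Q (Sum.elim M.bk M.bc) ^ (m + 1) * (∫ t, t ^ (m + 1) ∂gammaMeasure (M.d / 2) (M.a / 2)) +
        (M.g / n) ^ (m + 1) * ∫ w, (∑ i, w i ^ 2) ^ (m + 1) ∂stdNormal (Fin q)) := by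
  have h := integral_mono_ae (M.integrable_excess_pow m) (M.integrable_excess_pow_bound m) (by
    filter_upwards [M.ae_noise_pos] with ω hω using M.excess_pow_le hω m)
  refine h.trans_eq ?_
  rw [integral_const_mul, integral_add ((M.integrable_precision_pow (m + 1)).const_mul _)
    (((integrable_normSq_pow (Fin q) m).comp_fst _).const_mul _), integral_const_mul,
    integral_const_mul, M.integral_precision_comp (fun t => t ^ (m + 1)),
    M.integral_coord_comp (fun w => (∑ i, w i ^ 2) ^ (m + 1))]

theorem integrable_excess : Integrable M.excess M.noise := by
  simpa using M.integrable_excess_pow 0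

theorem mean_precision : ∫ t, t ∂gammaMeasure (M.d / 2) (M.a / 2) = M.d / M.a := by
  rw [gamma_mean (half_pos M.d_pos) (half_pos M.a_pos)]
  have := M.a_pos
  field_simp

theorem mean_precision_sq :
    ∫ t, t ^ 2 ∂gammaMeasure (M.d / 2) (M.a / 2) = M.d * (M.d + 2) / M.a ^ 2 := by
  rw [gamma_sq_mean (half_pos M.d_pos) (half_pos M.a_pos)]
  have := M.a_pos
  field_simp

/-- Conditionally on the precision t, `excess` is a scaled noncentral chi-square variable; averaging
over t afterwards gives the prior moments. -/
theorem integral_excess_coord {t : ℝ} (ht : 0 < t) :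
    ∫ w, M.excess (w, t) ∂stdNormal (Fin q) =
      M.Q (Sum.elim M.bk M.bc) * t + M.g / n * q ∧
    ∫ w, M.excess (w, t) ^ 2 ∂stdNormal (Fin q) =
      4 * (M.g / n) * (M.Q (Sum.elim M.bk M.bc) * t) + 2 * (M.g / n) ^ 2 * q +
        (M.Q (Sum.elim M.bk M.bc) * t + M.g / n * q) ^ 2 := by
  have hn := M.n_cast_pos
  obtain ⟨h1, h2⟩ := noncentral_moments (fun i => Real.sqrt t * M.shift i) (Real.sqrt M.g)
  have hs : ∑ i, (Real.sqrt t * M.shift i) ^ 2 = t * (n * M.Q (Sum.elim M.bk M.bc)) := by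
    simp only [mul_pow, Real.sq_sqrt ht.le]
    rw [← Finset.mul_sum, shift_sq_sum]
  have h4 : Real.sqrt M.g ^ 4 = M.g ^ 2 := by
    rw [show (4 : ℕ) = 2 * 2 from rfl, pow_mul, Real.sq_sqrt M.g_pos.le]
  rw [hs, Real.sq_sqrt M.g_pos.le, Fintype.card_fin] at h1 h2
  rw [h4] at h2
  simp only [excess, mul_pow (1 / (n : ℝ))]
  rw [integral_const_mul, integral_const_mul, h1, h2]
  constructor
  · field_simp
  · field_simp

theorem integral_excess :
    ∫ ω, M.excess ω ∂M.noise = M.g / n * q + M.Q (Sum.elim M.bk M.bc) * (M.d / M.a) := by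
  rw [integral_prod_symm _ M.integrable_excess]
  have h : ∀ᵐ t ∂gammaMeasure (M.d / 2) (M.a / 2), ∫ w, M.excess (w, t) ∂stdNormal (Fin q) =
      M.Q (Sum.elim M.bk M.bc) * t + M.g / n * q := by
    filter_upwards [ae_pos_gammaMeasure (M.d / 2) (M.a / 2)] with t ht
    exact (M.integral_excess_coord ht).1
  have hi : Integrable (fun t : ℝ => t) (gammaMeasure (M.d / 2) (M.a / 2)) := by
    simpa using (gamma_pow_moment (half_pos M.d_pos) (half_pos M.a_pos) 1).1
  rw [integral_congr_ae h, integral_add (hi.const_mul _) (integrable_const _), integral_const_mul,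
    mean_precision]
  simp
  ring

theorem integral_excess_sq :
    ∫ ω, M.excess ω ^ 2 ∂M.noise =
      4 * (M.g / n) * M.Q (Sum.elim M.bk M.bc) * (M.d / M.a) + 2 * (M.g / n) ^ 2 * q +
      (M.Q (Sum.elim M.bk M.bc) ^ 2 * (M.d * (M.d + 2) / M.a ^ 2) +
        2 * M.Q (Sum.elim M.bk M.bc) * (M.g / n * q) * (M.d / M.a) + (M.g / n * q) ^ 2) := by
  rw [integral_prod_symm _ (M.integrable_excess_pow 1)]
  set Q := M.Q (Sum.elim M.bk M.bc)
  set γ := M.g / n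
  have h : ∀ᵐ t ∂gammaMeasure (M.d / 2) (M.a / 2), ∫ w, M.excess (w, t) ^ (1 + 1) ∂stdNormal (Fin q) =
      Q ^ 2 * t ^ 2 + ((4 * γ * Q + 2 * Q * (γ * q)) * t + (2 * γ ^ 2 * q + (γ * q) ^ 2)) := by
    filter_upwards [ae_pos_gammaMeasure (M.d / 2) (M.a / 2)] with t ht
    rw [(M.integral_excess_coord ht).2]
    ring
  have hi : Integrable (fun t : ℝ => t) (gammaMeasure (M.d / 2) (M.a / 2)) := by
    simpa using (gamma_pow_moment (half_pos M.d_pos) (half_pos M.a_pos) 1).1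
  have hi2 := (gamma_pow_moment (half_pos M.d_pos) (half_pos M.a_pos) 2).1
  have hi3 : Integrable (fun t : ℝ => (4 * γ * Q + 2 * Q * (γ * q)) * t + (2 * γ ^ 2 * q + (γ * q) ^ 2))
      (gammaMeasure (M.d / 2) (M.a / 2)) := (hi.const_mul _).add (integrable_const _)
  rw [integral_congr_ae h, integral_add (hi2.const_mul _) hi3,
    integral_add (hi.const_mul _) (integrable_const _), integral_const_mul, integral_const_mul,
    mean_precision, mean_precision_sq]
  simp
  ring

theorem invR_transfer :
    (Integrable (fun θ => (M.R θ)⁻¹) M.prior ↔ Integrable (fun ω => 1 + M.excess ω) M.noise) ∧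
      M.meanInvR = ∫ ω, (1 + M.excess ω) ∂M.noise :=
  M.prior_transfer M.measurable_R.inv (M.measurable_excess.const_add 1) fun ω hω => by
    rw [R_param M hω, inv_inv]

theorem invR_sq_transfer :
    (Integrable (fun θ => (M.R θ)⁻¹ ^ 2) M.prior ↔ Integrable (fun ω => (1 + M.excess ω) ^ 2) M.noise) ∧
      ∫ θ, (M.R θ)⁻¹ ^ 2 ∂M.prior = ∫ ω, (1 + M.excess ω) ^ 2 ∂M.noise :=
  M.prior_transfer (M.measurable_R.inv.pow_const 2) ((M.measurable_excess.const_add 1).pow_const 2)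
    fun ω hω => by rw [R_param M hω, inv_inv]

theorem integrable_one_add_excess_sq :
    Integrable (fun ω => (1 + M.excess ω) ^ 2) M.noise ∧
    ∫ ω, (1 + M.excess ω) ^ 2 ∂M.noise =
      1 + (2 * ∫ ω, M.excess ω ∂M.noise) + ∫ ω, M.excess ω ^ 2 ∂M.noise := by
  have e : ∀ ω, (1 + M.excess ω) ^ 2 = (1 + 2 * M.excess ω) + M.excess ω ^ 2 := fun ω => by ring
  simp only [e]
  have h1 : Integrable (fun ω => 1 + 2 * M.excess ω) M.noise :=
    (integrable_const _).add (M.integrable_excess.const_mul 2)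
  refine ⟨h1.add (M.integrable_excess_pow 1), ?_⟩
  rw [integral_add h1 (M.integrable_excess_pow 1), integral_add (integrable_const _)
    (M.integrable_excess.const_mul 2), integral_const_mul]
  simp

theorem meanInvR_eq_add : M.meanInvR = 1 + ∫ ω, M.excess ω ∂M.noise := by
  rw [M.invR_transfer.2, integral_add (integrable_const _) M.integrable_excess]
  simp

theorem memLp_invR : MemLp (fun θ => (M.R θ)⁻¹) 2 M.prior := by
  have hm : Measurable fun θ => (M.R θ)⁻¹ := M.measurable_R.inv
  rw [memLp_two_iff_integrable_sq hm.aestronglyMeasurable]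
  exact M.invR_sq_transfer.1.2 M.integrable_one_add_excess_sq.1

theorem varInvR_eq_sub :
    M.varInvR = ∫ ω, M.excess ω ^ 2 ∂M.noise - (∫ ω, M.excess ω ∂M.noise) ^ 2 := by
  have h : ∫ θ, (M.R θ)⁻¹ ∂M.prior = 1 + ∫ ω, M.excess ω ∂M.noise := M.meanInvR_eq_add
  rw [varInvR, variance_eq_sub M.memLp_invR, h]
  simp only [Pi.pow_apply]
  rw [M.invR_sq_transfer.2, M.integrable_one_add_excess_sq.2]
  ring

theorem meanInvR_eq :
    M.meanInvR = 1 + M.g / n * q + M.Q (Sum.elim M.bk M.bc) * (M.d / M.a) := by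
  rw [meanInvR_eq_add, integral_excess, add_assoc]

theorem varInvR_eq :
    M.varInvR = 2 * M.d / M.a * M.Q (Sum.elim M.bk M.bc) *
      (M.Q (Sum.elim M.bk M.bc) / M.a + 2 * M.g / n) + 2 * M.g ^ 2 / (n : ℝ) ^ 2 * q := by
  have hn := M.n_cast_pos
  have ha := M.a_pos
  rw [varInvR_eq_sub, integral_excess, integral_excess_sq]
  field_simp
  ring

theorem R_transfer :
    (Integrable M.R M.prior ↔ Integrable (fun ω => (1 + M.excess ω)⁻¹) M.noise) ∧
      M.meanR = ∫ ω, (1 + M.excess ω)⁻¹ ∂M.noise :=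
  M.prior_transfer M.measurable_R (M.measurable_excess.const_add 1).inv fun _ hω => R_param M hω

theorem RPrec_transfer :
    (Integrable (fun θ => M.R θ / θ.2) M.prior ↔
      Integrable (fun ω : (Fin q → ℝ) × ℝ => (1 + M.excess ω)⁻¹ * ω.2) M.noise) ∧
      M.meanRPrec = ∫ ω : (Fin q → ℝ) × ℝ, (1 + M.excess ω)⁻¹ * ω.2 ∂M.noise :=
  M.prior_transfer (M.measurable_R.div measurable_snd)
    ((M.measurable_excess.const_add 1).inv.mul measurable_snd) fun ω hω => by
      rw [R_param M hω, param, div_inv_eq_mul]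

theorem logR_transfer :
    (Integrable (fun θ => Real.log (M.R θ)) M.prior ↔
      Integrable (fun ω => -Real.log (1 + M.excess ω)) M.noise) ∧
      M.meanLogR = ∫ ω, -Real.log (1 + M.excess ω) ∂M.noise :=
  M.prior_transfer M.measurable_R.log (M.measurable_excess.const_add 1).log.neg fun ω hω => by
      rw [R_param M hω, Real.log_inv]

theorem one_add_excess_pos (ω : (Fin q → ℝ) × ℝ) : 0 < 1 + M.excess ω := by
  linarith [M.excess_nonneg ω]

theorem inv_one_add_excess_le_one (ω : (Fin q → ℝ) × ℝ) : (1 + M.excess ω)⁻¹ ≤ 1 :=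
  inv_le_one_of_one_le₀ (by linarith [M.excess_nonneg ω])

theorem integrable_inv_one_add_excess : Integrable (fun ω => (1 + M.excess ω)⁻¹) M.noise := by
  refine (integrable_const (1 : ℝ)).mono' (M.measurable_excess.const_add 1).inv.aestronglyMeasurable
    (Filter.Eventually.of_forall fun ω => ?_)
  rw [Real.norm_of_nonneg (inv_nonneg.2 (M.one_add_excess_pos ω).le)]
  exact M.inv_one_add_excess_le_one ω

theorem integrable_precision : Integrable (fun ω : (Fin q → ℝ) × ℝ => ω.2) M.noise := by
  simpa using M.integrable_precision_pow 1

theorem integrable_inv_mul_precision :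
    Integrable (fun ω : (Fin q → ℝ) × ℝ => (1 + M.excess ω)⁻¹ * ω.2) M.noise := by
  refine M.integrable_precision.mono'
    ((M.measurable_excess.const_add 1).inv.mul measurable_snd).aestronglyMeasurable ?_
  filter_upwards [M.ae_noise_pos] with ω hω
  rw [Real.norm_of_nonneg (mul_nonneg (inv_nonneg.2 (M.one_add_excess_pos ω).le) hω.le)]
  exact mul_le_of_le_one_left hω.le (M.inv_one_add_excess_le_one ω)

theorem integrable_log_one_add_excess :
    Integrable (fun ω => Real.log (1 + M.excess ω)) M.noise := by
  refine M.integrable_excess.mono' (M.measurable_excess.const_add 1).log.aestronglyMeasurable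
    (Filter.Eventually.of_forall fun ω => ?_)
  rw [Real.norm_of_nonneg (Real.log_nonneg (by linarith [M.excess_nonneg ω]))]
  linarith [Real.log_le_sub_one_of_pos (M.one_add_excess_pos ω)]

theorem integrable_R : Integrable M.R M.prior :=
  M.R_transfer.1.2 M.integrable_inv_one_add_excess

theorem integrable_RPrec : Integrable (fun θ => M.R θ / θ.2) M.prior :=
  M.RPrec_transfer.1.2 M.integrable_inv_mul_precision

theorem integrable_logR : Integrable (fun θ => Real.log (M.R θ)) M.prior :=
  M.logR_transfer.1.2 M.integrable_log_one_add_excess.neg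

theorem meanR_pos : 0 < M.meanR := by
  rw [M.R_transfer.2, integral_pos_iff_support_of_nonneg
    (fun ω => inv_nonneg.2 (M.one_add_excess_pos ω).le) M.integrable_inv_one_add_excess]
  have : Function.support (fun ω => (1 + M.excess ω)⁻¹) = Set.univ := by
    ext ω
    simpa using (M.one_add_excess_pos ω).ne'
  rw [this]
  simp

theorem meanRPrec_pos : 0 < M.meanRPrec := by
  have h0 : 0 ≤ᵐ[M.noise] fun ω : (Fin q → ℝ) × ℝ => (1 + M.excess ω)⁻¹ * ω.2 := by
    filter_upwards [M.ae_noise_pos] with ω hω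
    exact mul_nonneg (inv_nonneg.2 (M.one_add_excess_pos ω).le) hω.le
  rw [M.RPrec_transfer.2]
  refine (integral_nonneg_of_ae h0).lt_of_ne fun h => ?_
  have h1 := (integral_eq_zero_iff_of_nonneg_ae h0 M.integrable_inv_mul_precision).1 h.symm
  have h2 : ∀ᵐ ω ∂M.noise, False := by
    filter_upwards [h1, M.ae_noise_pos] with ω hω1 hω2
    exact (mul_pos (inv_pos.2 (M.one_add_excess_pos ω)) hω2).ne' hω1
  exact IsProbabilityMeasure.ne_zero M.noise (by simpa using h2)

theorem shift_eq_zero (h : M.bc = 0) : M.shift = 0 := by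
  rw [shift, h, mulVec_zero]

theorem excess_central (h : M.bc = 0) (ω : (Fin q → ℝ) × ℝ) :
    M.excess ω = M.g / n * ∑ i, ω.1 i ^ 2 := by
  simp only [excess, M.shift_eq_zero h, Pi.zero_apply, mul_zero, zero_add, mul_pow,
    Real.sq_sqrt M.g_pos.le, ← Finset.mul_sum]
  ring

/-- With zero shift `excess` is a function of the noise alone, hence independent of the precision.
-/
theorem meanRPrec_central (h : M.bc = 0) : M.meanRPrec = M.meanR * (M.d / M.a) := by
  rw [M.RPrec_transfer.2, M.R_transfer.2, ← mean_precision]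
  simp only [M.excess_central h]
  rw [integral_prod_mul (fun w : Fin q → ℝ => (1 + M.g / n * ∑ i, w i ^ 2)⁻¹) (fun t : ℝ => t),
    M.integral_coord_comp (fun w : Fin q → ℝ => (1 + M.g / n * ∑ i, w i ^ 2)⁻¹)]

end Setting

/-! ### The incomplete gamma formula for E[R_k] in the central case. -/

theorem integral_exp_neg_normSq {q : ℕ} {c : ℝ} (hc : 0 ≤ c) :
    ∫ w, Real.exp (-(c * ∑ i, w i ^ 2)) ∂stdNormal (Fin q) = (1 + 2 * c) ^ (-(q : ℝ) / 2) := by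
  have h : ∀ w : Fin q → ℝ, Real.exp (-(c * ∑ i, w i ^ 2)) = ∏ i, Real.exp (-(c * w i ^ 2)) := by
    intro w
    rw [← Real.exp_sum, Finset.sum_neg_distrib, Finset.mul_sum]
  simp only [h]
  rw [integral_fintype_prod_eq_prod (𝕜 := ℝ) (fun (_ : Fin q) (x : ℝ) => Real.exp (-(c * x ^ 2)))]
  simp only [gaussian_exp_neg_sq hc, Finset.prod_const, Finset.card_univ, Fintype.card_fin]
  rw [← Real.rpow_natCast, ← Real.rpow_mul (by positivity)]
  congr 1
  ring

/-- Write 1/u = ∫₀^∞ exp(-tu) dt and exchange integrals: the chi-square Laplace transform produces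
(1 + 2tc)^(-q/2) = (2c(t + z))^(-q/2) with z = 1/(2c), and the shift t ↦ t + z gives the incomplete
gamma integral. -/
theorem integral_inv_one_add_normSq (q : ℕ) {c : ℝ} (hc : 0 < c) :
    ∫ w, (1 + c * ∑ i, w i ^ 2)⁻¹ ∂stdNormal (Fin q) =
      (2 * c) ^ (-(q : ℝ) / 2) * Real.exp (1 / (2 * c)) * upperGamma (1 - (q : ℝ) / 2) (1 / (2 * c)) := by
  set z := 1 / (2 * c) with hz
  have hz0 : 0 < z := by positivity
  have h1 : ∀ w : Fin q → ℝ, (1 + c * ∑ i, w i ^ 2)⁻¹ =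
      ∫ t in Set.Ioi (0 : ℝ), Real.exp (-t) * Real.exp (-(t * c * ∑ i, w i ^ 2)) := by
    intro w
    have hS : 0 ≤ c * ∑ i, w i ^ 2 := mul_nonneg hc.le (Finset.sum_nonneg fun _ _ => sq_nonneg _)
    have := integral_exp_mul_Ioi (a := -(1 + c * ∑ i, w i ^ 2)) (by linarith) 0
    simp only [mul_zero, Real.exp_zero, neg_div_neg_eq, one_div] at this
    rw [← this]
    refine integral_congr_ae (Filter.Eventually.of_forall fun t => ?_)
    simp only
    rw [← Real.exp_add]
    congr 1
    ring
  simp only [h1]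
  rw [integral_integral_swap]
  · have h2 : ∀ t ∈ Set.Ioi (0 : ℝ), ∫ w, Real.exp (-t) * Real.exp (-(t * c * ∑ i, w i ^ 2))
        ∂stdNormal (Fin q) = ((2 * c) ^ (-(q : ℝ) / 2) * Real.exp z) *
          (Real.exp (-(t + z)) * (t + z) ^ (1 - (q : ℝ) / 2 - 1)) := by
      intro t ht
      have ht : 0 < t := ht
      rw [integral_const_mul, integral_exp_neg_normSq (by positivity),
        show 1 + 2 * (t * c) = 2 * c * (t + z) by rw [hz]; field_simp; ring,
        Real.mul_rpow (by positivity) (by positivity), neg_add, Real.exp_add, Real.exp_neg z,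
        show 1 - (q : ℝ) / 2 - 1 = -(q : ℝ) / 2 by ring]
      have := Real.exp_pos z
      field_simp
    rw [setIntegral_congr_fun measurableSet_Ioi h2, integral_const_mul, upperGamma]
    congr 1
    have h3 := (measurePreserving_add_right (volume : Measure ℝ) z).setIntegral_preimage_emb
      (measurableEmbedding_addRight z) (fun t => Real.exp (-t) * t ^ (1 - (q : ℝ) / 2 - 1)) (Set.Ioi z)
    rwa [Set.preimage_add_const_Ioi, sub_self] at h3
  · have hi : Integrable (fun t : ℝ => Real.exp (-t)) (volume.restrict (Set.Ioi 0)) := by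
      have := integrableOn_exp_mul_Ioi (a := -1) (by norm_num) 0
      simpa [IntegrableOn] using this
    refine (hi.comp_snd (stdNormal (Fin q))).mono' ?_ ?_
    · have : Measurable fun p : (Fin q → ℝ) × ℝ =>
          Real.exp (-p.2) * Real.exp (-(p.2 * c * ∑ i, p.1 i ^ 2)) := by fun_prop
      exact this.aestronglyMeasurable
    · have : ∀ᵐ p ∂(stdNormal (Fin q)).prod (volume.restrict (Set.Ioi (0 : ℝ))), 0 < p.2 :=
        Measure.quasiMeasurePreserving_snd.ae (ae_restrict_mem measurableSet_Ioi)
      filter_upwards [this] with p hp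
      have hS : 0 ≤ p.2 * c * ∑ i, p.1 i ^ 2 :=
        mul_nonneg (mul_nonneg hp.le hc.le) (Finset.sum_nonneg fun _ _ => sq_nonneg _)
      simp only [Function.uncurry]
      rw [Real.norm_of_nonneg (by positivity)]
      exact mul_le_of_le_one_right (Real.exp_pos _).le (Real.exp_le_one_iff.2 (by linarith))

theorem Setting.meanR_central {n k q : ℕ} (M : Setting n k q) (h : M.bc = 0) :
    M.meanR = (2 * M.g / n) ^ (-(q : ℝ) / 2) * Real.exp (n / (2 * M.g)) *
      upperGamma (1 - (q : ℝ) / 2) (n / (2 * M.g)) := by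
  have hn := M.n_cast_pos
  have hg := M.g_pos
  rw [M.R_transfer.2]
  simp only [M.excess_central h]
  rw [M.integral_coord_comp (fun w : Fin q → ℝ => (1 + M.g / n * ∑ i, w i ^ 2)⁻¹),
    integral_inv_one_add_normSq q (by positivity), show 1 / (2 * (M.g / n)) = n / (2 * M.g) by
      field_simp, mul_div_assoc]


/-! ### Kullback-Leibler divergence through densities. -/

section divergence

variable {α : Type*} [MeasurableSpace α] {μ ν : Measure α}

theorem klDiv_eq_ofReal_integral [IsProbabilityMeasure μ] [IsProbabilityMeasure ν] (hac : μ ≪ ν)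
    {l : α → ℝ} (hl : llr μ ν =ᵐ[μ] l) (hi : Integrable l μ) :
    klDiv μ ν = ENNReal.ofReal (∫ x, l x ∂μ) ∧ 0 ≤ ∫ x, l x ∂μ := by
  have hi' : Integrable (llr μ ν) μ := (integrable_congr hl).2 hi
  have h0 := integral_llr_add_sub_measure_univ_nonneg hac hi'
  rw [klDiv_of_ac_of_integrable hac hi']
  simp only [probReal_univ, add_sub_cancel_right, integral_congr_ae hl] at h0 ⊢
  exact ⟨trivial, h0⟩

/-- The log-likelihood ratio with respect to a measure given by a positive density. -/
theorem llr_withDensity_right {l : Measure α} [SigmaFinite l] [IsFiniteMeasure μ] (hμ : μ ≪ l)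
    {g : α → ℝ} (hg : Measurable g) (hpos : ∀ᵐ x ∂l, 0 < g x) :
    μ ≪ l.withDensity (fun x => ENNReal.ofReal (g x)) ∧
      llr μ (l.withDensity fun x => ENNReal.ofReal (g x)) =ᵐ[μ]
        fun x => Real.log (μ.rnDeriv l x).toReal - Real.log (g x) := by
  have hne : ∀ᵐ x ∂l, ENNReal.ofReal (g x) ≠ 0 := by
    filter_upwards [hpos] with x hx using (ENNReal.ofReal_pos.2 hx).ne'
  refine ⟨hμ.trans (withDensity_absolutelyContinuous' hg.ennreal_ofReal.aemeasurable hne), ?_⟩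
  have h1 := Measure.rnDeriv_withDensity_right μ l hg.ennreal_ofReal.aemeasurable hne
    (Filter.Eventually.of_forall fun _ => ENNReal.ofReal_ne_top)
  filter_upwards [hμ.ae_le h1, hμ.ae_le hpos, Measure.rnDeriv_pos hμ,
    hμ.ae_le (Measure.rnDeriv_lt_top μ l)] with x hx hgx hp ht
  have hr : 0 < (μ.rnDeriv l x).toReal := ENNReal.toReal_pos hp.ne' ht.ne
  rw [llr, hx, ENNReal.toReal_mul, ENNReal.toReal_inv, ENNReal.toReal_ofReal hgx.le,
    Real.log_mul (inv_ne_zero hgx.ne') hr.ne', Real.log_inv]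
  ring

theorem llr_withDensity_withDensity {l : Measure α} [SigmaFinite l] {f g : α → ℝ}
    (hf : Measurable f) (hg : Measurable g) (hf0 : ∀ᵐ x ∂l, 0 < f x) (hg0 : ∀ᵐ x ∂l, 0 < g x)
    [IsFiniteMeasure (l.withDensity fun x => ENNReal.ofReal (f x))] :
    l.withDensity (fun x => ENNReal.ofReal (f x)) ≪ l.withDensity (fun x => ENNReal.ofReal (g x)) ∧
      llr (l.withDensity fun x => ENNReal.ofReal (f x)) (l.withDensity fun x => ENNReal.ofReal (g x))
        =ᵐ[l.withDensity fun x => ENNReal.ofReal (f x)] fun x => Real.log (f x) - Real.log (g x) := by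
  have hac : l.withDensity (fun x => ENNReal.ofReal (f x)) ≪ l := withDensity_absolutelyContinuous _ _
  obtain ⟨h1, h2⟩ := llr_withDensity_right hac hg hg0
  refine ⟨h1, h2.trans ?_⟩
  filter_upwards [hac.ae_le (Measure.rnDeriv_withDensity l hf.ennreal_ofReal), hac.ae_le hf0] with x hx hx0
  rw [hx, ENNReal.toReal_ofReal hx0.le]

end divergence

/-! ### Divergence of normal sampling laws and the KL-projection. -/

section sampling

theorem normalPDF_pos {ι : Type*} [Fintype ι] [DecidableEq ι] (m : ι → ℝ) {S : Matrix ι ι ℝ}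
    (hS : 0 < S.det) (x : ι → ℝ) : 0 < normalPDF m S x := by
  unfold normalPDF
  have := Real.pi_pos
  positivity

theorem log_normalPDF {ι : Type*} [Fintype ι] [DecidableEq ι] (m : ι → ℝ) {S : Matrix ι ι ℝ}
    (hS : 0 < S.det) (x : ι → ℝ) : Real.log (normalPDF m S x) =
      -(1 / 2) * (Fintype.card ι * Real.log (2 * Real.pi) + Real.log S.det) -
        1 / 2 * ((x - m) ⬝ᵥ (S⁻¹ *ᵥ (x - m))) := by
  unfold normalPDF
  have := Real.pi_pos
  rw [Real.log_mul (by positivity) (Real.exp_pos _).ne', Real.log_exp, Real.log_inv,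
    Real.log_sqrt (by positivity), Real.log_mul (by positivity) hS.ne', Real.log_pow]
  ring

variable {n : ℕ}

theorem log_normalPDF_smul_one (m : Fin n → ℝ) {s : ℝ} (hs : 0 < s) (y : Fin n → ℝ) :
    Real.log (normalPDF m (s • (1 : Matrix (Fin n) (Fin n) ℝ)) y) =
      -(n / 2) * Real.log (2 * Real.pi) - n / 2 * Real.log s - (∑ i, (y i - m i) ^ 2) / (2 * s) := by
  have hdet : (s • (1 : Matrix (Fin n) (Fin n) ℝ)).det = s ^ n := by simp
  have hinv : (s • (1 : Matrix (Fin n) (Fin n) ℝ))⁻¹ = s⁻¹ • (1 : Matrix (Fin n) (Fin n) ℝ) := by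
    apply inv_eq_right_inv
    rw [smul_mul_smul, mul_inv_cancel₀ hs.ne', one_smul, Matrix.one_mul]
  rw [log_normalPDF m (by rw [hdet]; positivity), hdet, hinv, smul_mulVec, one_mulVec,
    dotProduct_smul, Real.log_pow, Fintype.card_fin]
  have : (y - m) ⬝ᵥ (y - m) = ∑ i, (y i - m i) ^ 2 := by simp [dotProduct, sq]
  rw [this, smul_eq_mul]
  field_simp
  ring

variable {ι : Type*} [Fintype ι]

theorem sampling_eq_map (X : Matrix (Fin n) ι ℝ) {θ : (ι → ℝ) × ℝ} (hθ : 0 < θ.2) :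
    sampling X θ = (stdNormal (Fin n)).map fun z => X *ᵥ θ.1 + Real.sqrt θ.2 • z := by
  have hdet : (Real.sqrt θ.2 • (1 : Matrix (Fin n) (Fin n) ℝ)).det ≠ 0 := by
    have := Real.sqrt_pos.2 hθ
    rw [det_smul, det_one, mul_one]
    positivity
  have h := normal_eq_map (X *ᵥ θ.1) hdet
  rw [transpose_smul, transpose_one, smul_mul_smul, Real.mul_self_sqrt hθ.le, Matrix.one_mul] at h
  simp only [smul_mulVec, one_mulVec] at h
  exact h

theorem measurable_affine (m : Fin n → ℝ) (s : ℝ) : Measurable fun z : Fin n → ℝ => m + s • z := by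
  fun_prop

theorem isProbabilityMeasure_sampling (X : Matrix (Fin n) ι ℝ) {θ : (ι → ℝ) × ℝ} (hθ : 0 < θ.2) :
    IsProbabilityMeasure (sampling X θ) := by
  rw [sampling_eq_map X hθ]
  exact Measure.isProbabilityMeasure_map (measurable_affine _ _).aemeasurable

theorem sampling_sq_dist (X : Matrix (Fin n) ι ℝ) {θ : (ι → ℝ) × ℝ} (hθ : 0 < θ.2) (m : Fin n → ℝ) :
    Integrable (fun y : Fin n → ℝ => ∑ i, (y i - m i) ^ 2) (sampling X θ) ∧
    ∫ y, ∑ i, (y i - m i) ^ 2 ∂sampling X θ = ∑ i, ((X *ᵥ θ.1) i - m i) ^ 2 + θ.2 * n := by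
  have hmeas : Measurable fun y : Fin n → ℝ => ∑ i, (y i - m i) ^ 2 := by fun_prop
  have hmap := (measurable_affine (X *ᵥ θ.1) (Real.sqrt θ.2)).aemeasurable (μ := stdNormal (Fin n))
  have e : ∀ z : Fin n → ℝ, ∑ i, ((X *ᵥ θ.1 + Real.sqrt θ.2 • z) i - m i) ^ 2 =
      ∑ i, ((X *ᵥ θ.1) i - m i + Real.sqrt θ.2 * z i) ^ 2 := fun z =>
    Finset.sum_congr rfl fun i _ => by simp only [Pi.add_apply, Pi.smul_apply, smul_eq_mul]; ring
  rw [sampling_eq_map X hθ]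
  constructor
  · rw [integrable_map_measure hmeas.aestronglyMeasurable hmap]
    simp only [Function.comp_def, e]
    refine integrable_finsetSum _ fun i _ => ?_
    exact ((gaussian_sq_affine ((X *ᵥ θ.1) i - m i) (Real.sqrt θ.2)).1.comp_measurePreserving
      (measurePreserving_eval (fun _ : Fin n => gaussianReal 0 1) i)).integrable (by norm_num)
  · rw [integral_map hmap hmeas.aestronglyMeasurable]
    simp only [e]
    rw [(noncentral_moments (fun i => (X *ᵥ θ.1) i - m i) (Real.sqrt θ.2)).1, Real.sq_sqrt hθ.le,
      Fintype.card_fin]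

/-- The Kullback-Leibler divergence of two normal sampling laws. -/
theorem klDiv_sampling {κ : Type*} [Fintype κ] (X : Matrix (Fin n) ι ℝ) (Y : Matrix (Fin n) κ ℝ)
    {θ : (ι → ℝ) × ℝ} {η : (κ → ℝ) × ℝ} (hθ : 0 < θ.2) (hη : 0 < η.2) :
    let K := n / 2 * (Real.log η.2 - Real.log θ.2 - 1) +
      (∑ i, ((X *ᵥ θ.1) i - (Y *ᵥ η.1) i) ^ 2 + θ.2 * n) / (2 * η.2)
    klDiv (sampling X θ) (sampling Y η) = ENNReal.ofReal K ∧ 0 ≤ K := by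
  intro K
  have := isProbabilityMeasure_sampling X hθ
  have := isProbabilityMeasure_sampling Y hη
  have hd : ∀ s : ℝ, 0 < s → 0 < (s • (1 : Matrix (Fin n) (Fin n) ℝ)).det := fun s hs => by
    simp only [det_smul, det_one, mul_one]
    positivity
  have hfin : IsFiniteMeasure (sampling X θ) := inferInstance
  unfold sampling at hfin
  obtain ⟨h1, h2⟩ := llr_withDensity_withDensity (l := (volume : Measure (Fin n → ℝ)))
    (measurable_normalPDF (X *ᵥ θ.1) (θ.2 • (1 : Matrix (Fin n) (Fin n) ℝ)))
    (measurable_normalPDF (Y *ᵥ η.1) (η.2 • (1 : Matrix (Fin n) (Fin n) ℝ)))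
    (Filter.Eventually.of_forall (normalPDF_pos _ (hd _ hθ)))
    (Filter.Eventually.of_forall (normalPDF_pos _ (hd _ hη)))
  simp only [log_normalPDF_smul_one _ hθ, log_normalPDF_smul_one _ hη] at h2
  have i1 := sampling_sq_dist X hθ (X *ᵥ θ.1)
  have i2 := sampling_sq_dist X hθ (Y *ᵥ η.1)
  have h3 : llr (sampling X θ) (sampling Y η) =ᵐ[sampling X θ] fun y =>
      (n / 2 * (Real.log η.2 - Real.log θ.2) - (1 / (2 * θ.2)) * ∑ i, (y i - (X *ᵥ θ.1) i) ^ 2) +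
        (1 / (2 * η.2)) * ∑ i, (y i - (Y *ᵥ η.1) i) ^ 2 := by
    refine h2.trans (Filter.Eventually.of_forall fun y => ?_)
    simp only
    ring
  have i3 : Integrable (fun y => (n : ℝ) / 2 * (Real.log η.2 - Real.log θ.2) -
      (1 / (2 * θ.2)) * ∑ i, (y i - (X *ᵥ θ.1) i) ^ 2) (sampling X θ) :=
    (integrable_const _).sub (i1.1.const_mul _)
  have hac : sampling X θ ≪ sampling Y η := h1
  have h4 := klDiv_eq_ofReal_integral hac h3 (i3.add (i2.1.const_mul (1 / (2 * η.2))))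
  rw [integral_add i3 (i2.1.const_mul _), integral_sub (integrable_const _) (i1.1.const_mul _),
    integral_const_mul (1 / (2 * θ.2)), integral_const_mul (1 / (2 * η.2)), i1.2, i2.2] at h4
  have hK : K = (∫ _, (n : ℝ) / 2 * (Real.log η.2 - Real.log θ.2) ∂sampling X θ -
      1 / (2 * θ.2) * (∑ i, ((X *ᵥ θ.1) i - (X *ᵥ θ.1) i) ^ 2 + θ.2 * n)) +
      1 / (2 * η.2) * (∑ i, ((X *ᵥ θ.1) i - (Y *ᵥ η.1) i) ^ 2 + θ.2 * n) := by
    simp only [K, sub_self]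
    simp
    field_simp
  rw [hK]
  exact h4

end sampling

/-- The function log t + c/t has its unique minimum at t = c, by log u ≤ u - 1 at u = c/t. It serves
for σ_k² in the projection, for g and a in the score, for the maximum of a density, and for strict
Jensen. -/
theorem log_add_div_ge {c t : ℝ} (hc : 0 < c) (ht : 0 < t) :
    Real.log c + 1 ≤ Real.log t + c / t ∧ (Real.log c + 1 = Real.log t + c / t → t = c) := by
  have h : Real.log (c / t) = Real.log c - Real.log t := Real.log_div hc.ne' ht.ne'
  constructor
  · linarith [Real.log_le_sub_one_of_pos (div_pos hc ht)]
  · intro he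
    by_contra hne
    have hne' : c / t ≠ 1 := fun h1 => hne ((div_eq_one_iff_eq ht.ne').1 h1).symm
    linarith [Real.log_lt_sub_one_of_pos (div_pos hc ht) hne']

namespace Setting

variable {n k q : ℕ} (M : Setting n k q)

/-- The closed form of the KL-projection. -/
def projParam (θ : (Fin k ⊕ Fin q → ℝ) × ℝ) : (Fin k → ℝ) × ℝ :=
  (θ.1 ∘ Sum.inl + M.coef *ᵥ (θ.1 ∘ Sum.inr), θ.2 + M.Q θ.1)

theorem sum_sq_eq_dotProduct {m : ℕ} (v w : Fin m → ℝ) :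
    ∑ i, (v i - w i) ^ 2 = (v - w) ⬝ᵥ (v - w) := by
  simp [dotProduct, sq]

theorem Q_nonneg (v : Fin k ⊕ Fin q → ℝ) : 0 ≤ M.Q v := by
  rw [Q, dotProduct_residualProj]
  exact mul_nonneg (by positivity) (Finset.sum_nonneg fun i _ => mul_self_nonneg _)

/-- Pythagoras: the residual of Xv is orthogonal to the column space of X_k. -/
theorem sq_dist_fit (v : Fin k ⊕ Fin q → ℝ) (w : Fin k → ℝ) :
    ∑ i, ((M.X *ᵥ v) i - (M.Xk *ᵥ w) i) ^ 2 = n * M.Q v +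
      (M.Xk *ᵥ (v ∘ Sum.inl + M.coef *ᵥ (v ∘ Sum.inr) - w)) ⬝ᵥ
        (M.Xk *ᵥ (v ∘ Sum.inl + M.coef *ᵥ (v ∘ Sum.inr) - w)) := by
  set u := v ∘ Sum.inl + M.coef *ᵥ (v ∘ Sum.inr) - w with hu
  have h1 : M.X *ᵥ v - M.Xk *ᵥ w = M.residualProj *ᵥ (M.X *ᵥ v) + M.Xk *ᵥ u := by
    rw [residualProj_mulVec, residual_decomp, X_mulVec, X_mulVec, hu]
    simp only [Sum.elim_comp_inl, Sum.elim_comp_inr, mulVec_neg, mulVec_sub, mulVec_add]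
    abel
  have h2 : (M.residualProj *ᵥ (M.X *ᵥ v)) ⬝ᵥ (M.Xk *ᵥ u) = 0 := by
    rw [dotProduct_mulVec, ← mulVec_transpose, mulVec_mulVec, Xk_transpose_mul_residualProj,
      zero_mulVec, zero_dotProduct]
  rw [sum_sq_eq_dotProduct, h1, add_dotProduct, dotProduct_add, dotProduct_add, h2,
    dotProduct_comm (M.Xk *ᵥ u), h2, Q, M.dotProduct_residualProj (M.X *ᵥ v) (M.X *ᵥ v), ← mul_assoc,
    mul_one_div_cancel M.n_cast_pos.ne']
  ring

/-- Up to constants the divergence is (n/2)(log s + (σ² + Q_k)/s) + D/(2s), where s is the submodel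
variance and D ≥ 0 is the squared distance of the fitted vectors. The first part forces s = σ² +
Q_k, the second forces D = 0, and X_k is injective. -/
theorem klDiv_sampling_ge {θ : (Fin k ⊕ Fin q → ℝ) × ℝ} (hθ : 0 < θ.2) {η : (Fin k → ℝ) × ℝ}
    (hη : 0 < η.2) :
    klDiv (sampling M.X θ) (sampling M.Xk (M.projParam θ)) ≤
        klDiv (sampling M.X θ) (sampling M.Xk η) ∧
      (klDiv (sampling M.X θ) (sampling M.Xk η) ≤
        klDiv (sampling M.X θ) (sampling M.Xk (M.projParam θ)) → η = M.projParam θ) := by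
  have hn := M.n_cast_pos
  have hQ := M.Q_nonneg θ.1
  have hp : 0 < (M.projParam θ).2 := by
    simp only [projParam]
    linarith
  obtain ⟨e1, p1⟩ := klDiv_sampling M.X M.Xk hθ hη
  obtain ⟨e2, p2⟩ := klDiv_sampling M.X M.Xk hθ hp
  rw [sq_dist_fit] at e1 p1 e2 p2
  rw [e1, e2, ENNReal.ofReal_le_ofReal_iff p1, ENNReal.ofReal_le_ofReal_iff p2]
  have hz : θ.1 ∘ Sum.inl + M.coef *ᵥ (θ.1 ∘ Sum.inr) - (M.projParam θ).1 = 0 := by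
    simp [projParam]
  set u := θ.1 ∘ Sum.inl + M.coef *ᵥ (θ.1 ∘ Sum.inr) - η.1 with hu
  rw [hz]
  set D := (M.Xk *ᵥ u) ⬝ᵥ (M.Xk *ᵥ u) with hD
  have hD0 : 0 ≤ D := Finset.sum_nonneg fun i _ => mul_self_nonneg _
  have hs : (M.projParam θ).2 = θ.2 + M.Q θ.1 := rfl
  have hc : 0 < θ.2 + M.Q θ.1 := by linarith
  obtain ⟨g1, g2⟩ := log_add_div_ge hc hη
  have k1 : (n : ℝ) / 2 * (Real.log η.2 - Real.log θ.2 - 1) + (n * M.Q θ.1 + D + θ.2 * n) / (2 * η.2) =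
      n / 2 * (Real.log η.2 + (θ.2 + M.Q θ.1) / η.2 - Real.log θ.2 - 1) + D / (2 * η.2) := by
    field_simp
    ring
  have k2 : (n : ℝ) / 2 * (Real.log (M.projParam θ).2 - Real.log θ.2 - 1) +
      (n * M.Q θ.1 + (M.Xk *ᵥ 0) ⬝ᵥ (M.Xk *ᵥ 0) + θ.2 * n) / (2 * (M.projParam θ).2) =
      n / 2 * (Real.log (θ.2 + M.Q θ.1) + 1 - Real.log θ.2 - 1) := by
    rw [hs, mulVec_zero, zero_dotProduct]
    field_simp
    ring
  rw [k1, k2]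
  have hD1 : 0 ≤ D / (2 * η.2) := by positivity
  have hmul : (n : ℝ) / 2 * (Real.log (θ.2 + M.Q θ.1) + 1 - Real.log θ.2 - 1) ≤
      n / 2 * (Real.log η.2 + (θ.2 + M.Q θ.1) / η.2 - Real.log θ.2 - 1) :=
    mul_le_mul_of_nonneg_left (by linarith) (by positivity)
  refine ⟨by linarith, fun hle => ?_⟩
  have hD2 : D / (2 * η.2) = 0 := by linarith
  have hD3 : D = 0 := by
    rcases div_eq_zero_iff.1 hD2 with h | h
    · exact h
    · linarith
  have he : (n : ℝ) / 2 * (Real.log (θ.2 + M.Q θ.1) + 1 - Real.log θ.2 - 1) =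
      n / 2 * (Real.log η.2 + (θ.2 + M.Q θ.1) / η.2 - Real.log θ.2 - 1) := by linarith
  have he2 := mul_left_cancel₀ (by positivity) he
  have ht := g2 (by linarith)
  have hu0 : u = 0 := M.Xk_mulVec_eq_zero (dotProduct_self_eq_zero.1 hD3)
  refine Prod.ext ?_ ht
  rw [hu, sub_eq_zero] at hu0
  exact hu0.symm

/-- Since the minimizer is unique, the arbitrary choice in `klProjection` has only one possible
value. -/
theorem klProjection_eq {θ : (Fin k ⊕ Fin q → ℝ) × ℝ} (hθ : 0 < θ.2) :
    M.klProjection θ = M.projParam θ := by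
  have hp : 0 < (M.projParam θ).2 := by
    have := M.Q_nonneg θ.1
    simp only [projParam]
    linarith
  have hmin : M.IsKLProjection θ (M.projParam θ) :=
    ⟨hp, fun ζ hζ => (M.klDiv_sampling_ge hθ hζ).1⟩
  have hspec : M.IsKLProjection θ (M.klProjection θ) := Classical.epsilon_spec ⟨_, hmin⟩
  exact (M.klDiv_sampling_ge hθ hspec.1).2 (hspec.2 _ hp)

theorem measurable_projParam : Measurable M.projParam := by
  have h1 : Measurable fun θ : (Fin k ⊕ Fin q → ℝ) × ℝ => θ.1 ∘ Sum.inl :=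
    measurable_pi_lambda _ fun i => (measurable_pi_apply (Sum.inl i)).comp measurable_fst
  have h2 : Measurable fun θ : (Fin k ⊕ Fin q → ℝ) × ℝ => θ.1 ∘ Sum.inr :=
    measurable_pi_lambda _ fun i => (measurable_pi_apply (Sum.inr i)).comp measurable_fst
  exact (h1.add ((measurable_mulVec M.coef).comp h2)).prodMk
    (measurable_snd.add (M.measurable_Q.comp measurable_fst))

theorem ae_prior_pos : ∀ᵐ θ ∂M.prior, 0 < θ.2 := by
  rw [prior_eq_map, ae_map_iff M.measurable_param.aemeasurable (measurableSet_lt measurable_const measurable_snd)]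
  filter_upwards [M.ae_canon_pos] with ω hω
  exact inv_pos.2 hω

theorem klPrior_eq_map : M.klPrior = M.prior.map M.projParam := by
  refine Measure.map_congr ?_
  filter_upwards [M.ae_prior_pos] with θ hθ using M.klProjection_eq hθ

end Setting


/-! ### Integrability of log-densities, and the densities of conjugate laws. -/

section density

variable {α : Type*} [MeasurableSpace α] {μ l : Measure α}

theorem ae_le_of_withDensity_le [SigmaFinite l] {f g : α → ENNReal} (hf : Measurable f)
    (h : l.withDensity f ≤ l.withDensity g) : f ≤ᵐ[l] g :=
  ae_le_of_forall_setLIntegral_le_of_sigmaFinite hf fun s hs _ => by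
    rw [← withDensity_apply _ hs, ← withDensity_apply _ hs]
    exact h s

/-- Integrability of the logarithm of a density that is dominated by a function with integrable
logarithm, in the presence of a finite reference measure with the same property. -/
theorem integrable_log_rnDeriv [SigmaFinite l] [IsProbabilityMeasure μ] {g G : α → ℝ}
    (hg : Measurable g) (hpos : ∀ᵐ x ∂l, 0 < g x)
    [IsProbabilityMeasure (l.withDensity fun x => ENNReal.ofReal (g x))]
    (hgi : Integrable (fun x => Real.log (g x)) μ)
    (hG : μ ≤ l.withDensity fun x => ENNReal.ofReal (G x))
    (hGi : Integrable (fun x => Real.log (G x)) μ) :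
    Integrable (fun x => Real.log (μ.rnDeriv l x).toReal) μ := by
  have hac : μ ≪ l := (Measure.absolutelyContinuous_of_le hG).trans (withDensity_absolutelyContinuous _ _)
  obtain ⟨hac', hllr⟩ := llr_withDensity_right hac hg hpos
  set ν := l.withDensity fun x => ENNReal.ofReal (g x) with hν
  have hle : ∀ᵐ x ∂μ, μ.rnDeriv l x ≤ ENNReal.ofReal (G x) := by
    refine hac.ae_le (ae_le_of_withDensity_le (Measure.measurable_rnDeriv μ l) ?_)
    rwa [Measure.withDensity_rnDeriv_eq _ _ hac]
  have hneg := exp_neg_llr hac'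
  have hint : Integrable (fun x => (ν.rnDeriv μ x).toReal) μ := Measure.integrable_toReal_rnDeriv
  refine (((hint.add hgi.norm).add hGi.norm)).mono'
    (Measure.measurable_rnDeriv μ l).ennreal_toReal.log.aestronglyMeasurable ?_
  filter_upwards [hle, hllr, hneg, Measure.rnDeriv_pos hac,
    hac.ae_le (Measure.rnDeriv_lt_top μ l)] with x h1 h2 h3 h4 h5
  have hr : 0 < (μ.rnDeriv l x).toReal := ENNReal.toReal_pos h4.ne' h5.ne
  have hG0 : 0 < G x := ENNReal.ofReal_pos.1 (h4.trans_le h1)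
  have hrG : (μ.rnDeriv l x).toReal ≤ G x := ENNReal.toReal_le_of_le_ofReal hG0.le h1
  have hlog := Real.log_le_log hr hrG
  -- Lower bound: exp(-llr) is the density of ν with respect to μ, so the log-density of μ is at
  -- least log g + 1 minus an integrable function. The upper bound is log G.
  have hexp := Real.add_one_le_exp (-llr μ ν x)
  rw [h3, h2] at hexp
  simp only [Pi.add_apply, Real.norm_eq_abs]
  have h6 : 0 ≤ (ν.rnDeriv μ x).toReal := ENNReal.toReal_nonneg
  rw [abs_le]
  constructor
  · linarith [neg_abs_le (Real.log (g x)), abs_nonneg (Real.log (G x))]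
  · linarith [le_abs_self (Real.log (G x)), abs_nonneg (Real.log (g x))]

end density

section NIGa

variable {ι : Type*} [Fintype ι] [DecidableEq ι]

theorem isProbabilityMeasure_NIGa (b : ι → ℝ) {L : Matrix ι ι ℝ} (hL : L.det ≠ 0) {d a : ℝ}
    (hd : 0 < d) (ha : 0 < a) : IsProbabilityMeasure (NIGa b (L * Lᵀ) d a) := by
  have : IsProbabilityMeasure (gammaMeasure (d / 2) (a / 2)) :=
    isProbabilityMeasure_gammaMeasure (by positivity) (by positivity)
  rw [NIGa_eq_map b hL hd ha]
  exact Measure.isProbabilityMeasure_map (Measurable.prodMk (Measurable.const_add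
    ((measurable_snd.inv.sqrt).smul ((measurable_mulVec L).comp measurable_fst)) _)
    measurable_snd.inv).aemeasurable

theorem log_density_NIGa (b : ι → ℝ) {V : Matrix ι ι ℝ} (hV : 0 < V.det) {α β s : ℝ} (hα : 0 < α)
    (hβ : 0 < β) (hs : 0 < s) (x : ι → ℝ) :
    0 < normalPDF b (s • V) x * invGammaPDF α β s ∧
    Real.log (normalPDF b (s • V) x * invGammaPDF α β s) =
      -(1 / 2) * (Fintype.card ι * Real.log (2 * Real.pi) + Real.log V.det) +
        (α * Real.log β - Real.log (Real.Gamma α)) -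
        (Fintype.card ι / 2 + α + 1) * Real.log s -
        ((x - b) ⬝ᵥ (V⁻¹ *ᵥ (x - b)) / 2 + β) / s := by
  have hdet : 0 < (s • V).det := by
    rw [det_smul]
    positivity
  have hG := Real.Gamma_pos_of_pos hα
  have hn := normalPDF_pos b hdet x
  have hinv : (s • V)⁻¹ = s⁻¹ • V⁻¹ := by
    apply inv_eq_right_inv
    rw [smul_mul_smul, mul_inv_cancel₀ hs.ne', one_smul, mul_nonsing_inv _ hV.ne'.isUnit]
  have hi : 0 < invGammaPDF α β s := by
    rw [invGammaPDF, if_pos hs]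
    positivity
  refine ⟨mul_pos hn hi, ?_⟩
  have hlog : Real.log (invGammaPDF α β s) =
      α * Real.log β - Real.log (Real.Gamma α) + (-α - 1) * Real.log s - β / s := by
    rw [invGammaPDF, if_pos hs, Real.log_mul (by positivity) (by positivity),
      Real.log_mul (by positivity) (by positivity), Real.log_div (by positivity) hG.ne', Real.log_exp,
      Real.log_rpow hβ, Real.log_rpow hs]
    ring
  have hlogdet : Real.log (s • V).det = Fintype.card ι * Real.log s + Real.log V.det := by
    rw [det_smul, Real.log_mul (by positivity) hV.ne', Real.log_pow]
  rw [Real.log_mul hn.ne' hi.ne', log_normalPDF b hdet, hlog, hlogdet, hinv, smul_mulVec,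
    dotProduct_smul, smul_eq_mul]
  field_simp
  ring

/-- Dropping the quadratic form leaves a multiple of s^(-r) exp(-β/s), whose maximum is at s = β/r.
-/
theorem exists_density_NIGa_le (b : ι → ℝ) {V : Matrix ι ι ℝ} (hV : V.PosDef) {α β : ℝ}
    (hα : 0 < α) (hβ : 0 < β) :
    ∃ C : ℝ, 0 < C ∧ ∀ s x, normalPDF b (s • V) x * invGammaPDF α β s ≤
      Set.indicator {s : ℝ | 0 < s} (fun _ => C) s := by
  set r : ℝ := Fintype.card ι / 2 + α + 1 with hr
  have hr0 : 0 < r := by positivity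
  refine ⟨Real.exp (-(1 / 2) * (Fintype.card ι * Real.log (2 * Real.pi) + Real.log V.det) +
    (α * Real.log β - Real.log (Real.Gamma α)) - r * (Real.log (β / r) + 1)), Real.exp_pos _,
    fun s x => ?_⟩
  by_cases hs : 0 < s
  · rw [Set.indicator_of_mem (by exact hs)]
    obtain ⟨h1, h2⟩ := log_density_NIGa b hV.det_pos hα hβ hs x
    rw [← Real.log_le_iff_le_exp h1, h2, ← hr]
    have h3 : 0 ≤ (x - b) ⬝ᵥ (V⁻¹ *ᵥ (x - b)) := by
      simpa using hV.inv.posSemidef.dotProduct_mulVec_nonneg (x - b)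
    have h4 := mul_le_mul_of_nonneg_left (log_add_div_ge (div_pos hβ hr0) hs).1 hr0.le
    have h5 : r * (β / r / s) = β / s := by field_simp
    have h6 : ((x - b) ⬝ᵥ (V⁻¹ *ᵥ (x - b)) / 2 + β) / s =
      (x - b) ⬝ᵥ (V⁻¹ *ᵥ (x - b)) / 2 / s + β / s := add_div _ _ _
    have h7 : 0 ≤ (x - b) ⬝ᵥ (V⁻¹ *ᵥ (x - b)) / 2 / s := by positivity
    rw [mul_add r (Real.log s), h5] at h4
    linarith
  · rw [Set.indicator_of_notMem (by exact hs), invGammaPDF, if_neg hs, mul_zero]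

theorem NIGa_eq_withDensity_restrict (b : ι → ℝ) (V : Matrix ι ι ℝ) (d a : ℝ) :
    NIGa b V d a = ((volume : Measure ((ι → ℝ) × ℝ)).restrict {θ | 0 < θ.2}).withDensity fun θ =>
      ENNReal.ofReal (normalPDF b (θ.2 • V) θ.1 * invGammaPDF (d / 2) (a / 2) θ.2) := by
  have hs : MeasurableSet {θ : (ι → ℝ) × ℝ | 0 < θ.2} := measurableSet_lt measurable_const measurable_snd
  rw [NIGa, ← withDensity_indicator hs]
  congr 1
  funext θ
  by_cases h : 0 < θ.2
  · rw [Set.indicator_of_mem (by exact h)]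
  · rw [Set.indicator_of_notMem (by exact h), invGammaPDF, if_neg h, mul_zero, ENNReal.ofReal_zero]

theorem measurable_density_NIGa (b : ι → ℝ) (V : Matrix ι ι ℝ) (α β : ℝ) :
    Measurable fun θ : (ι → ℝ) × ℝ => normalPDF b (θ.2 • V) θ.1 * invGammaPDF α β θ.2 :=
  (measurable_normalPDF_smul b V).mul ((measurable_invGammaPDF α β).comp measurable_snd)

end NIGa


/-! ### A bound for the density of the KL-prior. -/

namespace Setting

variable {n k q : ℕ} (M : Setting n k q)

theorem Q_sumElim_eq (x : Fin k → ℝ) (y : Fin q → ℝ) :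
    M.Q (Sum.elim x y) = (1 / (n : ℝ)) * (y ⬝ᵥ (M.schur *ᵥ y)) := by
  rw [Q_eq, Sum.elim_comp_inr]

theorem measurable_Q_sumElim_zero : Measurable fun y : Fin q → ℝ => M.Q (Sum.elim (0 : Fin k → ℝ) y) :=
  M.measurable_Q.comp (measurable_sumElim.comp (measurable_const.prodMk measurable_id))

/-- In the coordinates `rootC` the sublevel set is a ball of radius √(nt), contained in a cube. The
order t^(q/2) is the growth in σ_k² allowed for the density. -/
theorem volume_Q_lt_le {t : ℝ} (ht : 0 < t) :
    volume {y : Fin q → ℝ | M.Q (Sum.elim (0 : Fin k → ℝ) y) < t} ≤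
      ENNReal.ofReal (|M.rootC.det| * (2 * Real.sqrt (n * t)) ^ q) := by
  have hn := M.n_cast_pos
  have hsub : {y : Fin q → ℝ | M.Q (Sum.elim (0 : Fin k → ℝ) y) < t} ⊆
      (Matrix.toLin' M.rootC) '' Set.Icc (fun _ => -Real.sqrt (n * t)) (fun _ => Real.sqrt (n * t)) := by
    intro y hy
    refine ⟨M.rootC⁻¹ *ᵥ y, ?_, ?_⟩
    · have h1 : y = M.rootC *ᵥ (M.rootC⁻¹ *ᵥ y) := by
        rw [mulVec_mulVec, mul_nonsing_inv _ M.det_rootC.isUnit, one_mulVec]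
      rw [Set.mem_ofPred_eq, Q_sumElim_eq, h1, schur_quadForm_rootC, one_div, inv_mul_lt_iff₀ hn] at hy
      have h2 : ∀ i, |(M.rootC⁻¹ *ᵥ y) i| ≤ Real.sqrt (n * t) := fun i =>
        Real.abs_le_sqrt ((Finset.single_le_sum (f := fun i => (M.rootC⁻¹ *ᵥ y) i ^ 2)
          (fun _ _ => sq_nonneg _) (Finset.mem_univ i)).trans hy.le)
      exact ⟨fun i => (abs_le.1 (h2 i)).1, fun i => (abs_le.1 (h2 i)).2⟩
    · rw [toLin'_apply, mulVec_mulVec, mul_nonsing_inv _ M.det_rootC.isUnit, one_mulVec]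
  refine (measure_mono hsub).trans ?_
  rw [Measure.addHaar_image_linearMap, LinearMap.det_toLin', Real.volume_Icc_pi,
    Finset.prod_const, Finset.card_univ, Fintype.card_fin, ENNReal.ofReal_mul (abs_nonneg _),
    ENNReal.ofReal_pow (by positivity)]
  gcongr
  linarith

/-- The measure preserving change of variables `(β, σ²) ↦ (β_{\k}, (β_k*, σ_k²))`. -/
theorem measurePreserving_excluded_projParam :
    MeasurePreserving (fun θ : (Fin k ⊕ Fin q → ℝ) × ℝ => (θ.1 ∘ Sum.inr, M.projParam θ)) := by
  have h1 : MeasurePreserving (fun θ : (Fin k ⊕ Fin q → ℝ) × ℝ =>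
      (θ.1 ∘ Sum.inr, (θ.1 ∘ Sum.inl, θ.2))) := by
    have e1 := (volume_measurePreserving_sumPiEquivProdPi (fun _ : Fin k ⊕ Fin q => ℝ)).prod
      (MeasurePreserving.id (volume : Measure ℝ))
    have e2 := (Measure.measurePreserving_swap (μ := (volume : Measure (Fin k → ℝ)))
      (ν := (volume : Measure (Fin q → ℝ)))).prod (MeasurePreserving.id (volume : Measure ℝ))
    have e3 := measurePreserving_prodAssoc (volume : Measure (Fin q → ℝ))
      (volume : Measure (Fin k → ℝ)) (volume : Measure ℝ)
    exact e3.comp (e2.comp e1)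
  have hmeas : Measurable (Function.uncurry fun (y : Fin q → ℝ) (p : (Fin k → ℝ) × ℝ) =>
      p + (M.coef *ᵥ y, M.Q (Sum.elim (0 : Fin k → ℝ) y))) :=
    measurable_snd.add (((measurable_mulVec M.coef).comp measurable_fst).prodMk
      (M.measurable_Q_sumElim_zero.comp measurable_fst))
  have h2 := (MeasurePreserving.id (volume : Measure (Fin q → ℝ))).skew_product
    -- For fixed excluded coefficients the projection translates the retained coefficients and σ²,
    -- so the map is a shear and preserves volume.
    (μc := (volume : Measure ((Fin k → ℝ) × ℝ))) (μd := (volume : Measure ((Fin k → ℝ) × ℝ))) hmeas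
    (Filter.Eventually.of_forall fun y =>
       ((measurePreserving_add_right (volume : Measure (Fin k → ℝ)) (M.coef *ᵥ y)).prod
        (measurePreserving_add_right (volume : Measure ℝ)
          (M.Q (Sum.elim (0 : Fin k → ℝ) y)))).map_eq)
  have h3 := h2.comp h1
  have h4 : (fun θ : (Fin k ⊕ Fin q → ℝ) × ℝ => (θ.1 ∘ Sum.inr, M.projParam θ)) =
      (fun p : (Fin q → ℝ) × ((Fin k → ℝ) × ℝ) =>
        (id p.1, p.2 + (M.coef *ᵥ p.1, M.Q (Sum.elim (0 : Fin k → ℝ) p.1)))) ∘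
        fun θ => (θ.1 ∘ Sum.inr, (θ.1 ∘ Sum.inl, θ.2)) := by
    funext θ
    simp only [Function.comp_apply, projParam, id, Prod.mk_add_mk, Q_eq, Sum.elim_comp_inr]
  rw [h4]
  exact h3

theorem prior_le : ∃ C : ℝ, 0 < C ∧
    M.prior ≤ ENNReal.ofReal C • volume.restrict {θ : (Fin k ⊕ Fin q → ℝ) × ℝ | 0 < θ.2} := by
  have hn : (M.g • (M.Xᵀ * M.X)⁻¹).PosDef :=
    (posDef_transpose_mul_self _ fun _ => M.X_mulVec_eq_zero).inv.smul M.g_pos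
  obtain ⟨C, hC, h⟩ := exists_density_NIGa_le (Sum.elim M.bk M.bc) hn (half_pos M.d_pos) (half_pos M.a_pos)
  refine ⟨C, hC, ?_⟩
  rw [prior, NIGa_eq_withDensity_restrict, ← withDensity_const]
  refine withDensity_mono (Filter.Eventually.of_forall fun θ => ENNReal.ofReal_le_ofReal ((h _ _).trans ?_))
  exact Set.indicator_le_self' (fun _ _ => hC.le) _

/-- The prior density is bounded, and over a given (β_k*, σ_k²) the condition σ² = σ_k² - Q_k > 0
restricts the excluded coefficients to an ellipsoid of volume of order σ_k^q. The bound has an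
integrable logarithm, which makes the divergence from the KL-prior finite. -/
theorem klPrior_le : ∃ C : ℝ, 0 < C ∧
    M.klPrior ≤ (volume.restrict {η : (Fin k → ℝ) × ℝ | 0 < η.2}).withDensity fun η =>
      ENNReal.ofReal (C * Real.sqrt η.2 ^ q) := by
  obtain ⟨C, hC, h⟩ := M.prior_le
  have hn := M.n_cast_pos
  have hdet : 0 < |M.rootC.det| := abs_pos.2 M.det_rootC
  refine ⟨C * (|M.rootC.det| * (2 * Real.sqrt n) ^ q), by positivity, Measure.le_iff.2 fun A hA => ?_⟩
  set S : Set ((Fin q → ℝ) × ((Fin k → ℝ) × ℝ)) :=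
    {p | p.2 ∈ A ∧ M.Q (Sum.elim (0 : Fin k → ℝ) p.1) < p.2.2} with hS
  have hSm : MeasurableSet S := (measurable_snd hA).inter (measurableSet_lt
    (M.measurable_Q_sumElim_zero.comp measurable_fst) measurable_snd.snd)
  have hmp := M.measurePreserving_excluded_projParam
  have h0 : ∀ y, 0 ≤ M.Q (Sum.elim (0 : Fin k → ℝ) y) := fun y => M.Q_nonneg _
  have hpos : MeasurableSet {η : (Fin k → ℝ) × ℝ | 0 < η.2} :=
    measurableSet_lt measurable_const measurable_snd
  rw [klPrior_eq_map, Measure.map_apply M.measurable_projParam hA, withDensity_apply _ hA,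
    Measure.restrict_restrict hA]
  calc M.prior (M.projParam ⁻¹' A)
      ≤ (ENNReal.ofReal C • volume.restrict {θ : (Fin k ⊕ Fin q → ℝ) × ℝ | 0 < θ.2})
          (M.projParam ⁻¹' A) := h _
    _ = ENNReal.ofReal C * volume S := by
        rw [Measure.smul_apply, smul_eq_mul, Measure.restrict_apply (M.measurable_projParam hA),
          ← hmp.measure_preimage hSm.nullMeasurableSet]
        congr 2
        ext θ
        simp only [Set.mem_inter_iff, Set.mem_preimage, Set.mem_ofPred_eq, hS, and_congr_right_iff]
        intro _
        simp [projParam, Q_eq]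
    _ = ENNReal.ofReal C * ∫⁻ η, volume {y | (y, η) ∈ S} := by
        rw [Measure.volume_eq_prod, Measure.prod_apply_symm hSm]
        rfl
    _ ≤ ENNReal.ofReal C * ∫⁻ η in A ∩ {η : (Fin k → ℝ) × ℝ | 0 < η.2},
          ENNReal.ofReal (|M.rootC.det| * (2 * Real.sqrt (n * η.2)) ^ q) := by
        refine mul_le_mul' le_rfl ?_
        rw [← lintegral_indicator (hA.inter hpos)]
        refine lintegral_mono fun η => ?_
        by_cases hη : η ∈ A ∩ {η : (Fin k → ℝ) × ℝ | 0 < η.2}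
        · rw [Set.indicator_of_mem hη]
          exact (measure_mono fun y hy => hy.2).trans (M.volume_Q_lt_le hη.2)
        · rw [Set.indicator_of_notMem hη, nonpos_iff_eq_zero]
          convert measure_empty (μ := (volume : Measure (Fin q → ℝ)))
          ext y
          simp only [hS, Set.mem_ofPred_eq, Set.mem_empty_iff_false, iff_false]
          exact fun hy => hη ⟨hy.1, (h0 y).trans_lt hy.2⟩
    _ = _ := by
        rw [← lintegral_const_mul]
        · congr 1
          funext η
          rw [← ENNReal.ofReal_mul hC.le, Real.sqrt_mul hn.le]
          congr 1
          ring
        · fun_prop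

end Setting


/-! ### Expectations under the KL-prior and the score. -/

namespace Setting

variable {n k q : ℕ} (M : Setting n k q)

theorem projParam_param {ω : (Fin k → ℝ) × ((Fin q → ℝ) × ℝ)} (hω : 0 < ω.2.2) :
    M.projParam (M.param ω) = (M.projMean + (Real.sqrt ω.2.2⁻¹ * Real.sqrt M.g) • (M.rootK *ᵥ ω.1),
      (1 + M.excess ω.2) / ω.2.2) := by
  have h := M.Q_param hω
  have h2 : (M.param ω).2 = ω.2.2⁻¹ := rfl
  rw [h2, div_inv_eq_mul, ← eq_div_iff hω.ne'] at h
  rw [projParam, param_proj, h, h2]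
  congr 1
  field_simp

theorem klPrior_transfer {f : (Fin k → ℝ) × ℝ → ℝ} {h : (Fin k → ℝ) × ((Fin q → ℝ) × ℝ) → ℝ}
    (hf : Measurable f)
    (hfh : ∀ ω : (Fin k → ℝ) × ((Fin q → ℝ) × ℝ), 0 < ω.2.2 →
      f (M.projMean + (Real.sqrt ω.2.2⁻¹ * Real.sqrt M.g) • (M.rootK *ᵥ ω.1),
        (1 + M.excess ω.2) / ω.2.2) = h ω) :
    (Integrable f M.klPrior ↔ Integrable h M.canon) ∧ ∫ θ, f θ ∂M.klPrior = ∫ p, h p ∂M.canon := by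
  have hm := M.measurable_projParam.comp M.measurable_param
  have hae : (fun ω => f ((M.projParam ∘ M.param) ω)) =ᵐ[M.canon] h := by
    filter_upwards [M.ae_canon_pos] with ω hω
    rw [Function.comp_apply, M.projParam_param hω, hfh ω hω]
  rw [klPrior_eq_map, prior_eq_map, Measure.map_map M.measurable_projParam M.measurable_param]
  constructor
  · rw [integrable_map_measure hf.aestronglyMeasurable hm.aemeasurable]
    exact integrable_congr hae
  · rw [integral_map hm.aemeasurable hf.aestronglyMeasurable, integral_congr_ae hae]

theorem klPrior_transfer_noise {f : (Fin k → ℝ) × ℝ → ℝ} {h : (Fin q → ℝ) × ℝ → ℝ}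
    (hf : Measurable f) (hh : Measurable h)
    (hfh : ∀ ω : (Fin k → ℝ) × ((Fin q → ℝ) × ℝ), 0 < ω.2.2 →
      f (M.projMean + (Real.sqrt ω.2.2⁻¹ * Real.sqrt M.g) • (M.rootK *ᵥ ω.1),
        (1 + M.excess ω.2) / ω.2.2) = h ω.2) :
    (Integrable f M.klPrior ↔ Integrable h M.noise) ∧ ∫ θ, f θ ∂M.klPrior = ∫ p, h p ∂M.noise := by
  have hsnd : MeasurePreserving Prod.snd M.canon M.noise := measurePreserving_snd
  obtain ⟨h1, h2⟩ := M.klPrior_transfer (h := fun ω => h ω.2) hf hfh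
  refine ⟨h1.trans (hsnd.integrable_comp hh.aestronglyMeasurable), h2.trans ?_⟩
  rw [← hsnd.map_eq, integral_map hsnd.measurable.aemeasurable hh.aestronglyMeasurable]

/-- The expectation of `log σ_k²` under the KL-prior. -/
def meanLogVar : ℝ := Real.log (M.a / 2) - digamma (M.d / 2) - M.meanLogR

theorem klPrior_log_var : Integrable (fun η : (Fin k → ℝ) × ℝ => Real.log η.2) M.klPrior ∧
    ∫ η : (Fin k → ℝ) × ℝ, Real.log η.2 ∂M.klPrior = M.meanLogVar := by
  obtain ⟨h1, h2⟩ := M.klPrior_transfer_noise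
    (f := fun η => Real.log η.2) (h := fun ω => Real.log (1 + M.excess ω) - Real.log ω.2)
    measurable_snd.log ((M.measurable_excess.const_add 1).log.sub measurable_snd.log)
    (fun ω hω => Real.log_div (M.one_add_excess_pos ω.2).ne' hω.ne')
  obtain ⟨g1, g2⟩ := gamma_log_mean (half_pos M.d_pos) (half_pos M.a_pos)
  have h3 : Integrable (fun ω : (Fin q → ℝ) × ℝ => Real.log ω.2) M.noise := g1.comp_snd _
  have h4 := M.logR_transfer.2
  rw [integral_neg] at h4
  refine ⟨h1.2 (M.integrable_log_one_add_excess.sub h3), h2.trans ?_⟩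
  rw [integral_sub M.integrable_log_one_add_excess h3, M.integral_precision_comp Real.log, g2, meanLogVar,
    h4]
  ring

theorem klPrior_inv_var : Integrable (fun η : (Fin k → ℝ) × ℝ => η.2⁻¹) M.klPrior ∧
    ∫ η : (Fin k → ℝ) × ℝ, η.2⁻¹ ∂M.klPrior = M.meanRPrec := by
  obtain ⟨h1, h2⟩ := M.klPrior_transfer_noise
    (f := fun η => η.2⁻¹) (h := fun ω => (1 + M.excess ω)⁻¹ * ω.2)
    measurable_snd.inv ((M.measurable_excess.const_add 1).inv.mul measurable_snd)
    (fun ω hω => by rw [inv_div, div_eq_inv_mul])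
  exact ⟨h1.2 M.integrable_inv_mul_precision, h2.trans M.RPrec_transfer.2.symm⟩

theorem gram_quadForm_rootK (v : Fin k → ℝ) :
    (M.rootK *ᵥ v) ⬝ᵥ (M.gram *ᵥ (M.rootK *ᵥ v)) = ∑ i, v i ^ 2 := by
  rw [mulVec_mulVec, ← vecMul_transpose, ← dotProduct_mulVec, mulVec_mulVec, rootK_transpose_mul,
    one_mulVec]
  simp [dotProduct, sq]

/-- The quadratic form of the Gram matrix at the error of a candidate prior mean. -/
def meanError (b : Fin k → ℝ) : ℝ := (M.projMean - b) ⬝ᵥ (M.gram *ᵥ (M.projMean - b))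

theorem meanError_nonneg (b : Fin k → ℝ) : 0 ≤ M.meanError b := by
  have h := M.posDef_gram.posSemidef.dotProduct_mulVec_nonneg (M.projMean - b)
  rwa [star_trivial] at h

theorem meanError_eq_zero {b : Fin k → ℝ} (h : M.meanError b = 0) : b = M.projMean := by
  by_contra hne
  have := M.posDef_gram.dotProduct_mulVec_pos (x := M.projMean - b) (sub_ne_zero.2 (Ne.symm hne))
  simp only [star_trivial] at this
  exact this.ne' h

/-- Given the precision and the excluded noise, the quadratic form over σ_k² is R_k times a
noncentral chi-square variable in the retained noise, with noncentrality proportional to T. Its mean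
T·`meanError` + gk, weighted by R_k, gives the two terms. -/
theorem klPrior_quadForm (b : Fin k → ℝ) :
    Integrable (fun η : (Fin k → ℝ) × ℝ => ((η.1 - b) ⬝ᵥ (M.gram *ᵥ (η.1 - b))) / η.2) M.klPrior ∧
    ∫ η : (Fin k → ℝ) × ℝ, ((η.1 - b) ⬝ᵥ (M.gram *ᵥ (η.1 - b))) / η.2 ∂M.klPrior =
      M.meanError b * M.meanRPrec + M.g * k * M.meanR := by
  set v := M.rootK⁻¹ *ᵥ (M.projMean - b) with hv
  have hv1 : M.projMean - b = M.rootK *ᵥ v := by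
    rw [hv, mulVec_mulVec, mul_nonsing_inv _ M.det_rootK.isUnit, one_mulVec]
  have hv2 : M.meanError b = ∑ i, v i ^ 2 := by rw [meanError, hv1, gram_quadForm_rootK]
  have hfm : Measurable fun η : (Fin k → ℝ) × ℝ => ((η.1 - b) ⬝ᵥ (M.gram *ᵥ (η.1 - b))) / η.2 := by
    simp only [dotProduct, mulVec]
    fun_prop
  have hhm : Measurable fun ω : (Fin k → ℝ) × ((Fin q → ℝ) × ℝ) => (1 + M.excess ω.2)⁻¹ *
      ∑ i, (Real.sqrt ω.2.2 * v i + Real.sqrt M.g * ω.1 i) ^ 2 := by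
    refine ((M.measurable_excess.comp measurable_snd).const_add 1).inv.mul ?_
    fun_prop
  obtain ⟨h1, h2⟩ := M.klPrior_transfer (h := fun ω => (1 + M.excess ω.2)⁻¹ *
      ∑ i, (Real.sqrt ω.2.2 * v i + Real.sqrt M.g * ω.1 i) ^ 2) hfm (fun ω hω => by
    have e1 : M.projMean + (Real.sqrt ω.2.2⁻¹ * Real.sqrt M.g) • (M.rootK *ᵥ ω.1) - b =
        M.rootK *ᵥ (v + (Real.sqrt ω.2.2⁻¹ * Real.sqrt M.g) • ω.1) := by
      rw [mulVec_add, ← hv1, mulVec_smul]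
      abel
    rw [e1, gram_quadForm_rootK, div_div_eq_mul_div, div_eq_inv_mul, Finset.sum_mul]
    congr 1
    refine Finset.sum_congr rfl fun i _ => ?_
    have h3 : Real.sqrt ω.2.2 * Real.sqrt ω.2.2⁻¹ = 1 := by
      rw [← Real.sqrt_mul hω.le, mul_inv_cancel₀ hω.ne', Real.sqrt_one]
    simp only [Pi.add_apply, Pi.smul_apply, smul_eq_mul]
    have h4 := Real.mul_self_sqrt hω.le
    calc (v i + Real.sqrt ω.2.2⁻¹ * Real.sqrt M.g * ω.1 i) ^ 2 * ω.2.2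
        = (Real.sqrt ω.2.2 * v i +
          (Real.sqrt ω.2.2 * Real.sqrt ω.2.2⁻¹) * Real.sqrt M.g * ω.1 i) ^ 2 := by
          linear_combination (-(v i + Real.sqrt ω.2.2⁻¹ * Real.sqrt M.g * ω.1 i) ^ 2) * h4
      _ = _ := by rw [h3, one_mul])
  have hint : Integrable (fun ω : (Fin k → ℝ) × ((Fin q → ℝ) × ℝ) => (1 + M.excess ω.2)⁻¹ *
      ∑ i, (Real.sqrt ω.2.2 * v i + Real.sqrt M.g * ω.1 i) ^ 2) M.canon := by
    have i1 : Integrable (fun ω : (Fin k → ℝ) × ((Fin q → ℝ) × ℝ) => 2 * (∑ i, v i ^ 2) * ω.2.2)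
        M.canon := (M.integrable_precision.comp_snd _).const_mul _
    have i2 : Integrable (fun ω : (Fin k → ℝ) × ((Fin q → ℝ) × ℝ) => 2 * M.g * (∑ i, ω.1 i ^ 2) ^ (0 + 1))
        M.canon := ((integrable_normSq_pow (Fin k) 0).comp_fst _).const_mul _
    refine (i1.add i2).mono' hhm.aestronglyMeasurable ?_
    filter_upwards [M.ae_canon_pos] with ω hω
    have e1 := M.inv_one_add_excess_le_one ω.2
    have e2 := (inv_pos.2 (M.one_add_excess_pos ω.2)).le
    have e3 : 0 ≤ ∑ i, (Real.sqrt ω.2.2 * v i + Real.sqrt M.g * ω.1 i) ^ 2 :=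
      Finset.sum_nonneg fun i _ => sq_nonneg _
    rw [Real.norm_of_nonneg (mul_nonneg e2 e3)]
    refine (mul_le_of_le_one_left e3 e1).trans ?_
    simp only [Pi.add_apply, zero_add, pow_one]
    rw [mul_assoc, mul_assoc, Finset.sum_mul, Finset.mul_sum, Finset.mul_sum, Finset.mul_sum,
      ← Finset.sum_add_distrib]
    refine Finset.sum_le_sum fun i _ => ?_
    have e4 := Real.sq_sqrt hω.le
    have e5 := Real.sq_sqrt M.g_pos.le
    have e6 := sq_nonneg (Real.sqrt ω.2.2 * v i - Real.sqrt M.g * ω.1 i)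
    have e7 : v i ^ 2 * ω.2.2 = (Real.sqrt ω.2.2 * v i) ^ 2 := by rw [mul_pow, e4, mul_comm]
    have e8 : M.g * ω.1 i ^ 2 = (Real.sqrt M.g * ω.1 i) ^ 2 := by rw [mul_pow, e5]
    rw [e7, e8]
    linarith
  refine ⟨h1.2 hint, h2.trans ?_⟩
  rw [integral_prod_symm _ hint, hv2, M.RPrec_transfer.2, M.R_transfer.2, ← integral_const_mul,
    ← integral_const_mul, ← integral_add (M.integrable_inv_mul_precision.const_mul _)
      (M.integrable_inv_one_add_excess.const_mul _)]
  refine integral_congr_ae ?_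
  filter_upwards [M.ae_noise_pos] with ω hω
  rw [integral_const_mul, (noncentral_moments (fun i => Real.sqrt ω.2 * v i) (Real.sqrt M.g)).1,
    Fintype.card_fin, Real.sq_sqrt M.g_pos.le]
  simp only [mul_pow, Real.sq_sqrt hω.le, ← Finset.mul_sum]
  ring

/-- The part of `KL(KL-prior, conjugate law)` that depends on the hyperparameters of the conjugate
law. -/
def score (h : Hyper k) : ℝ :=
  k / 2 * Real.log h.g + (M.meanError h.b * M.meanRPrec + M.g * k * M.meanR) / (2 * h.g) +
    (Real.log (Real.Gamma (h.d / 2)) - h.d / 2 * Real.log (h.a / 2) + h.d / 2 * M.meanLogVar +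
      h.a / 2 * M.meanRPrec)

instance : IsProbabilityMeasure M.klPrior := by
  rw [klPrior_eq_map]
  exact Measure.isProbabilityMeasure_map M.measurable_projParam.aemeasurable

theorem isProbabilityMeasure_conjugate (h : Hyper k) : IsProbabilityMeasure (M.conjugate h) := by
  have e : h.g • (M.Xkᵀ * M.Xk)⁻¹ = (Real.sqrt h.g • M.rootK) * (Real.sqrt h.g • M.rootK)ᵀ := by
    rw [transpose_smul, smul_mul_smul, Real.mul_self_sqrt h.g_pos.le, rootK_mul]
  rw [conjugate, e]
  refine isProbabilityMeasure_NIGa _ ?_ h.d_pos h.a_pos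
  rw [det_smul]
  exact mul_ne_zero (pow_ne_zero _ (Real.sqrt_pos.2 h.g_pos).ne') M.det_rootK

/-- The domain of the parameters of the submodel. -/
abbrev paramMeasure (k : ℕ) : Measure ((Fin k → ℝ) × ℝ) := volume.restrict {η | 0 < η.2}

theorem ae_paramMeasure_pos (k : ℕ) : ∀ᵐ η ∂paramMeasure k, 0 < η.2 :=
  ae_restrict_mem (measurableSet_lt measurable_const measurable_snd)

theorem klPrior_absolutelyContinuous : M.klPrior ≪ paramMeasure k := by
  obtain ⟨C, -, h⟩ := M.klPrior_le
  exact (Measure.absolutelyContinuous_of_le h).trans (withDensity_absolutelyContinuous _ _)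

/-- The density of a conjugate law. -/
def conjDensity (h : Hyper k) (η : (Fin k → ℝ) × ℝ) : ℝ :=
  normalPDF h.b (η.2 • (h.g • M.gram⁻¹)) η.1 * invGammaPDF (h.d / 2) (h.a / 2) η.2

theorem conjugate_eq (h : Hyper k) : M.conjugate h =
    (paramMeasure k).withDensity fun η => ENNReal.ofReal (M.conjDensity h η) :=
  NIGa_eq_withDensity_restrict _ _ _ _

theorem log_conjDensity : ∃ c : ℝ, ∀ (h : Hyper k) (η : (Fin k → ℝ) × ℝ), 0 < η.2 →
    0 < M.conjDensity h η ∧ Real.log (M.conjDensity h η) =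
      (c - k / 2 * Real.log h.g + h.d / 2 * Real.log (h.a / 2) - Real.log (Real.Gamma (h.d / 2))) -
        (k / 2 + h.d / 2 + 1) * Real.log η.2 -
        (1 / (2 * h.g) * (((η.1 - h.b) ⬝ᵥ (M.gram *ᵥ (η.1 - h.b))) / η.2) + h.a / 2 * η.2⁻¹) := by
  refine ⟨-(1 / 2) * (k * Real.log (2 * Real.pi) + Real.log M.gram⁻¹.det), fun h η hη => ?_⟩
  have hdet : 0 < M.gram⁻¹.det := M.posDef_gram.inv.det_pos
  have hV : (h.g • M.gram⁻¹).det = h.g ^ k * M.gram⁻¹.det := by simp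
  have hg := h.g_pos
  have hinv : (h.g • M.gram⁻¹)⁻¹ = h.g⁻¹ • M.gram := by
    apply inv_eq_right_inv
    rw [smul_mul_smul, mul_inv_cancel₀ hg.ne', one_smul, nonsing_inv_mul _ M.isUnit_det_gram]
  obtain ⟨h1, h2⟩ := log_density_NIGa h.b (V := h.g • M.gram⁻¹) (by rw [hV]; positivity)
    (half_pos h.d_pos) (half_pos h.a_pos) hη η.1
  refine ⟨h1, h2.trans ?_⟩
  rw [hV, Real.log_mul (by positivity) hdet.ne', Real.log_pow, hinv, smul_mulVec, dotProduct_smul,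
    smul_eq_mul, Fintype.card_fin]
  field_simp
  ring

theorem integral_log_conjDensity : ∃ c : ℝ, ∀ h : Hyper k,
    Integrable (fun η => Real.log (M.conjDensity h η)) M.klPrior ∧
    ∫ η, Real.log (M.conjDensity h η) ∂M.klPrior = c - M.score h := by
  obtain ⟨c, hc⟩ := M.log_conjDensity
  refine ⟨c - (k / 2 + 1) * M.meanLogVar, fun h => ?_⟩
  obtain ⟨i1, e1⟩ := M.klPrior_log_var
  obtain ⟨i2, e2⟩ := M.klPrior_inv_var
  obtain ⟨i3, e3⟩ := M.klPrior_quadForm h.b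
  have hae : (fun η => Real.log (M.conjDensity h η)) =ᵐ[M.klPrior] fun η =>
      (c - k / 2 * Real.log h.g + h.d / 2 * Real.log (h.a / 2) - Real.log (Real.Gamma (h.d / 2))) -
        (k / 2 + h.d / 2 + 1) * Real.log η.2 -
        (1 / (2 * h.g) * (((η.1 - h.b) ⬝ᵥ (M.gram *ᵥ (η.1 - h.b))) / η.2) + h.a / 2 * η.2⁻¹) := by
    filter_upwards [M.klPrior_absolutelyContinuous.ae_le (ae_paramMeasure_pos k)] with η hη
    exact (hc h η hη).2
  have j1 : Integrable (fun η : (Fin k → ℝ) × ℝ =>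
      (c - k / 2 * Real.log h.g + h.d / 2 * Real.log (h.a / 2) - Real.log (Real.Gamma (h.d / 2))) -
        (k / 2 + h.d / 2 + 1) * Real.log η.2) M.klPrior :=
    (integrable_const _).sub (i1.const_mul _)
  have j2 : Integrable (fun η : (Fin k → ℝ) × ℝ =>
      1 / (2 * h.g) * (((η.1 - h.b) ⬝ᵥ (M.gram *ᵥ (η.1 - h.b))) / η.2) + h.a / 2 * η.2⁻¹) M.klPrior := (i3.const_mul (1 / (2 * h.g))).add (i2.const_mul (h.a / 2))
  refine ⟨(integrable_congr hae).2 (j1.sub j2), ?_⟩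
  have hg := h.g_pos
  rw [integral_congr_ae hae, integral_sub j1 j2, integral_sub (integrable_const _) (i1.const_mul _),
    integral_add (i3.const_mul _) (i2.const_mul _), integral_const, integral_const_mul,
    integral_const_mul, integral_const_mul, e1, e2, e3, score]
  simp only [probReal_univ, one_smul]
  field_simp
  ring

/-- The entropy part c does not depend on the hyperparameters. Its finiteness is essential: with
infinite divergences every member of the family would be a minimizer. -/
theorem klDiv_klPrior : ∃ c : ℝ, ∀ h : Hyper k,
    klDiv M.klPrior (M.conjugate h) = ENNReal.ofReal (c + M.score h) ∧ 0 ≤ c + M.score h := by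
  obtain ⟨c₀, hc₀⟩ := M.log_conjDensity
  obtain ⟨c, hc⟩ := M.integral_log_conjDensity
  obtain ⟨C, hC, hle⟩ := M.klPrior_le
  have hac := M.klPrior_absolutelyContinuous
  have hmeas : ∀ h, Measurable (M.conjDensity h) := fun h => measurable_density_NIGa _ _ _ _
  have hpos : ∀ h, ∀ᵐ η ∂paramMeasure k, 0 < M.conjDensity h η := fun h => by
    filter_upwards [ae_paramMeasure_pos k] with η hη using (hc₀ h η hη).1
  have hprob : ∀ h, IsProbabilityMeasure
      ((paramMeasure k).withDensity fun η => ENNReal.ofReal (M.conjDensity h η)) := fun h => by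
    rw [← conjugate_eq]
    exact M.isProbabilityMeasure_conjugate h
  have hG : Integrable (fun η : (Fin k → ℝ) × ℝ => Real.log (C * Real.sqrt η.2 ^ q)) M.klPrior := by
    refine (integrable_congr ?_).2 ((integrable_const (Real.log C)).add
      (M.klPrior_log_var.1.const_mul ((q : ℝ) / 2)))
    filter_upwards [hac.ae_le (ae_paramMeasure_pos k)] with η hη
    have := Real.sqrt_pos.2 hη
    simp only [Pi.add_apply]
    rw [Real.log_mul hC.ne' (by positivity), Real.log_pow, Real.log_sqrt hη.le]
    ring
  have hlog : Integrable (fun η => Real.log (M.klPrior.rnDeriv (paramMeasure k) η).toReal) M.klPrior := by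
    -- Any member of the family can serve as the reference probability density.
    let h₀ : Hyper k := ⟨0, 1, 1, 1, one_pos, one_pos, one_pos⟩
    have := hprob h₀
    exact integrable_log_rnDeriv (hmeas h₀) (hpos h₀) (hc h₀).1 hle hG
  refine ⟨∫ η, Real.log (M.klPrior.rnDeriv (paramMeasure k) η).toReal ∂M.klPrior - c, fun h => ?_⟩
  have := hprob h
  obtain ⟨h1, h2⟩ := llr_withDensity_right hac (hmeas h) (hpos h)
  have h3 := klDiv_eq_ofReal_integral h1 h2 (hlog.sub (hc h).1)
  rw [integral_sub hlog (hc h).1, (hc h).2, ← sub_add] at h3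
  rwa [conjugate_eq]

theorem isKLConjugateApprox_iff (h : Hyper k) :
    M.IsKLConjugateApprox h ↔ ∀ h', M.score h ≤ M.score h' := by
  obtain ⟨c, hc⟩ := M.klDiv_klPrior
  refine forall_congr' fun h' => ?_
  rw [(hc h).1, (hc h').1, ENNReal.ofReal_le_ofReal_iff (hc h').2, add_le_add_iff_left]

end Setting


/-! ### Minimization of the score, and the exact systems. -/

theorem log_gamma_minimizer {T x₀ x : ℝ} (h₀ : 0 < x₀) (hT : digammaGap x₀ = T) (hx : 0 < x) :
    let f := fun t : ℝ => Real.log (Real.Gamma t) + t - t * Real.log t + t * T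
    f x₀ ≤ f x ∧ (f x ≤ f x₀ → x = x₀) := by
  intro f
  -- Because the gap decreases strictly, this derivative is negative before x₀ and positive after
  -- it.
  have hderiv : ∀ t : ℝ, 0 < t → HasDerivAt f (T - digammaGap t) t := fun t ht => by
    have h1 : HasDerivAt f (digamma t + 1 - (1 * Real.log t + t * t⁻¹) + 1 * T) t := (((hasDerivAt_log_gamma ht).add (hasDerivAt_id t)).sub
      ((hasDerivAt_id t).mul (Real.hasDerivAt_log ht.ne'))).add ((hasDerivAt_id t).mul_const T)
    refine h1.congr_deriv ?_
    rw [digammaGap, mul_inv_cancel₀ ht.ne']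
    ring
  have hanti : StrictAntiOn f (Set.Ioc 0 x₀) := by
    refine strictAntiOn_of_deriv_neg (convex_Ioc 0 x₀)
      (fun t ht => (hderiv t ht.1).continuousAt.continuousWithinAt) fun t ht => ?_
    rw [interior_Ioc] at ht
    rw [(hderiv t ht.1).deriv, ← hT, sub_neg]
    exact digammaGap_lt ht.1 ht.2
  have hmono : StrictMonoOn f (Set.Ici x₀) := by
    refine strictMonoOn_of_deriv_pos (convex_Ici x₀)
      (fun t ht => (hderiv t (h₀.trans_le ht)).continuousAt.continuousWithinAt) fun t ht => ?_
    rw [interior_Ici] at ht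
    rw [(hderiv t (h₀.trans ht)).deriv, ← hT, sub_pos]
    exact digammaGap_lt h₀ ht
  rcases lt_trichotomy x x₀ with h | h | h
  · have := hanti ⟨hx, h.le⟩ ⟨h₀, le_rfl⟩ h
    exact ⟨this.le, fun h' => absurd h' this.not_ge⟩
  · rw [h]
    exact ⟨le_rfl, fun _ => rfl⟩
  · have := hmono Set.self_mem_Ici h.le h
    exact ⟨this.le, fun h' => absurd h' this.not_ge⟩

namespace Setting

variable {n k q : ℕ} (M : Setting n k q)

theorem ae_klPrior_ne (c : ℝ) : ∀ᵐ η ∂M.klPrior, η.2 ≠ c := by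
  refine M.klPrior_absolutelyContinuous.ae_le (ae_restrict_of_ae ?_)
  rw [ae_iff]
  have : {η : (Fin k → ℝ) × ℝ | ¬ η.2 ≠ c} = Set.univ ×ˢ {c} := by
    ext η
    simp
  rw [this, Measure.volume_eq_prod, Measure.prod_prod, Real.volume_singleton, mul_zero]

/-- Strict Jensen for log at 1/σ_k², which is not constant because the KL-prior has a density.
Positivity puts this number in the range of the gap, so the equation for d is solvable. -/
theorem log_meanRPrec_add_meanLogVar_pos : 0 < Real.log M.meanRPrec + M.meanLogVar := by
  have hm := M.meanRPrec_pos
  obtain ⟨i1, e1⟩ := M.klPrior_log_var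
  obtain ⟨i2, e2⟩ := M.klPrior_inv_var
  have hpos := M.klPrior_absolutelyContinuous.ae_le (ae_paramMeasure_pos k)
  have hc := inv_pos.2 hm
  have hi : Integrable (fun η : (Fin k → ℝ) × ℝ =>
      (Real.log η.2 + M.meanRPrec⁻¹ * η.2⁻¹) + (Real.log M.meanRPrec - 1)) M.klPrior :=
    (i1.add (i2.const_mul _)).add (integrable_const _)
  have hint : ∫ η : (Fin k → ℝ) × ℝ, ((Real.log η.2 + M.meanRPrec⁻¹ * η.2⁻¹) +
      (Real.log M.meanRPrec - 1)) ∂M.klPrior = Real.log M.meanRPrec + M.meanLogVar := by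
    have i3 : Integrable (fun η : (Fin k → ℝ) × ℝ => Real.log η.2 + M.meanRPrec⁻¹ * η.2⁻¹) M.klPrior :=
      i1.add (i2.const_mul _)
    rw [integral_add i3 (integrable_const _), integral_add i1 (i2.const_mul _),
      integral_const_mul, e1, e2, integral_const]
    simp only [probReal_univ, one_smul]
    field_simp
    ring
  have hnn : 0 ≤ᵐ[M.klPrior] fun η : (Fin k → ℝ) × ℝ =>
      (Real.log η.2 + M.meanRPrec⁻¹ * η.2⁻¹) + (Real.log M.meanRPrec - 1) := by
    filter_upwards [hpos] with η hη
    have := (log_add_div_ge hc hη).1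
    rw [Real.log_inv, div_eq_mul_inv] at this
    simp only [Pi.zero_apply]
    linarith
  rw [← hint]
  refine lt_of_le_of_ne (integral_nonneg_of_ae hnn) fun h0 => ?_
  have hz := (integral_eq_zero_iff_of_nonneg_ae hnn hi).1 h0.symm
  have hfalse : ∀ᵐ η ∂M.klPrior, False := by
    filter_upwards [hz, hpos, M.ae_klPrior_ne M.meanRPrec⁻¹] with η h1 h2 h3
    refine h3 ((log_add_div_ge hc h2).2 ?_)
    rw [Real.log_inv, div_eq_mul_inv]
    simp only [Pi.zero_apply] at h1
    linarith
  exact (hfalse.exists).elim fun _ h => h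

theorem exactSystem_iff (h : Hyper k) : M.ExactSystem h ↔ h.b = M.projMean ∧ h.g = M.g * M.meanR ∧
    h.a = h.d / M.meanRPrec ∧ digammaGap (h.d / 2) = Real.log M.meanRPrec + M.meanLogVar := by
  unfold ExactSystem
  refine and_congr_right fun _ => and_congr_right fun _ => and_congr_right fun ha => ?_
  have hlog : Real.log (h.a / 2) = Real.log (h.d / 2) - Real.log M.meanRPrec := by
    rw [ha, div_right_comm, Real.log_div (half_pos h.d_pos).ne' M.meanRPrec_pos.ne']
  rw [hlog, digammaGap, meanLogVar]
  constructor <;> intro <;> linarith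

theorem exists_exactSystem : ∃ h : Hyper k, M.ExactSystem h := by
  obtain ⟨x, hx, hgap⟩ := exists_digammaGap_eq M.log_meanRPrec_add_meanLogVar_pos
  refine ⟨⟨M.projMean, M.g * M.meanR, 2 * x, 2 * x / M.meanRPrec, mul_pos M.g_pos M.meanR_pos,
    by positivity, div_pos (by positivity) M.meanRPrec_pos⟩, ?_⟩
  rw [exactSystem_iff]
  refine ⟨rfl, rfl, rfl, ?_⟩
  simpa using hgap

/-- The score splits into a g term, a nonnegative mean error term, an a term that is minimal at a =
d/E[R_k/σ²] for the given d, and the function of d in `log_gamma_minimizer`. Equality forces each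
part to be minimal. -/
theorem score_ge {h₀ : Hyper k} (he : M.ExactSystem h₀) (h : Hyper k) :
    M.score h₀ ≤ M.score h ∧ (M.score h ≤ M.score h₀ → h = h₀) := by
  rw [exactSystem_iff] at he
  obtain ⟨hb0, hg0, ha0, hd0⟩ := he
  have hm := M.meanRPrec_pos
  have hR := M.meanR_pos
  have hk : (0 : ℝ) < k := Nat.cast_pos.2 M.k_pos
  have hgR := mul_pos M.g_pos hR
  have hg := h.g_pos
  have hδ := half_pos h.d_pos
  have hα := half_pos h.a_pos
  have hδ0 := half_pos h₀.d_pos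
  obtain ⟨p1, p2⟩ := log_add_div_ge hgR hg
  obtain ⟨q1, q2⟩ := log_add_div_ge hα (div_pos hδ hm)
  obtain ⟨r1, r2⟩ := log_gamma_minimizer hδ0 hd0 hδ
  simp only at r1 r2
  have hD : 0 ≤ M.meanError h.b * M.meanRPrec / (2 * h.g) :=
    div_nonneg (mul_nonneg (M.meanError_nonneg _) hm.le) (by positivity)
  have hD0 : M.meanError h₀.b = 0 := by simp [meanError, hb0]
  have e0 : M.score h₀ = k / 2 * (Real.log (M.g * M.meanR) + 1) +
      (Real.log (Real.Gamma (h₀.d / 2)) + h₀.d / 2 - h₀.d / 2 * Real.log (h₀.d / 2) +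
        h₀.d / 2 * (Real.log M.meanRPrec + M.meanLogVar)) := by
    have hlog : Real.log (h₀.a / 2) = Real.log (h₀.d / 2) - Real.log M.meanRPrec := by
      rw [ha0, div_right_comm, Real.log_div hδ0.ne' hm.ne']
    have hg0 := M.g_pos
    rw [score, hD0, hlog, ‹h₀.g = _›, ha0]
    field_simp
    ring
  have e1 : M.score h = k / 2 * (Real.log h.g + M.g * M.meanR / h.g) +
      M.meanError h.b * M.meanRPrec / (2 * h.g) +
      (Real.log (Real.Gamma (h.d / 2)) + h.d / 2 * M.meanLogVar +
        h.d / 2 * (h.a / 2 / (h.d / 2 / M.meanRPrec) - Real.log (h.a / 2))) := by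
    have hd := h.d_pos
    rw [score]
    field_simp
    ring
  rw [Real.log_div hδ.ne' hm.ne'] at q1 q2
  have p3 := mul_le_mul_of_nonneg_left p1 (half_pos hk).le
  have q3 : h.d / 2 * (1 - Real.log (h.d / 2) + Real.log M.meanRPrec) ≤
      h.d / 2 * (h.a / 2 / (h.d / 2 / M.meanRPrec) - Real.log (h.a / 2)) :=
    mul_le_mul_of_nonneg_left (by linarith) hδ.le
  rw [e0, e1]
  refine ⟨by linarith, fun hle => ?_⟩
  have hd : h.d = h₀.d := by
    have := r2 (by linarith)
    linarith
  have hg' : h.g = M.g * M.meanR := p2 (mul_left_cancel₀ (half_pos hk).ne' (by linarith))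
  have ha' : h.d / 2 / M.meanRPrec = h.a / 2 := by
    refine q2 ?_
    have := mul_left_cancel₀ hδ.ne' (le_antisymm q3 (by linarith))
    linarith
  have hb' : h.b = M.projMean := by
    refine M.meanError_eq_zero ?_
    have h1 : M.meanError h.b * M.meanRPrec / (2 * h.g) = 0 := by linarith
    rcases div_eq_zero_iff.1 h1 with h2 | h2
    · exact (mul_eq_zero.1 h2).resolve_right hm.ne'
    · linarith
  have ha : h.a = h₀.a := by
    rw [ha0, ← hd]
    linarith [div_right_comm h.d 2 M.meanRPrec]
  cases h
  cases h₀
  simp only at hd hg' hb' ha hg0 hb0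
  subst hd ha
  simp [hb', hb0, hg', hg0]

theorem isKLConjugateApprox_iff_exactSystem (h : Hyper k) :
    M.IsKLConjugateApprox h ↔ M.ExactSystem h := by
  rw [isKLConjugateApprox_iff]
  constructor
  · intro hmin
    obtain ⟨h₀, h0⟩ := M.exists_exactSystem
    rwa [(M.score_ge h0 h).2 (hmin h₀)]
  · exact fun he h' => (M.score_ge he h').1

theorem existsUnique_isKLConjugateApprox : ∃! h : Hyper k, M.IsKLConjugateApprox h := by
  obtain ⟨h₀, h0⟩ := M.exists_exactSystem
  refine ⟨h₀, (M.isKLConjugateApprox_iff_exactSystem h₀).2 h0, fun h hh => ?_⟩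
  exact (M.score_ge h0 h).2 ((M.isKLConjugateApprox_iff h).1 hh h₀)

/-- Independence factors E[R_k/σ²] as E[R_k]·d/a, which turns the logarithms of a into logarithms of
d and E[R_k]. -/
theorem exactSystem_iff_centralSystem (hbc : M.bc = 0) (h : Hyper k) :
    M.ExactSystem h ↔ M.CentralSystem h := by
  have hR := M.meanR_pos
  have hd := M.d_pos
  have ha := M.a_pos
  have hb : M.projMean = M.bk := by simp [projMean, hbc]
  have hprec := M.meanRPrec_central hbc
  have ha' : h.d / M.meanRPrec = h.d * (M.a / M.d) * (1 / M.meanR) := by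
    rw [hprec]
    field_simp
  unfold ExactSystem CentralSystem
  rw [hb, ha']
  refine and_congr_right fun _ => and_congr_right fun _ => and_congr_right fun hha => ?_
  have hlog : Real.log (h.a / 2) =
      Real.log (h.d / 2) + Real.log (M.a / 2) - Real.log (M.d / 2) - Real.log M.meanR := by
    have : h.a / 2 = h.d / 2 * (M.a / 2) / (M.d / 2) / M.meanR := by
      rw [hha]
      field_simp
    have := h.d_pos
    rw [‹h.a / 2 = _›, Real.log_div (by positivity) hR.ne', Real.log_div (by positivity) (by positivity),
      Real.log_mul (by positivity) (by positivity)]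
  rw [hlog]
  constructor <;> intro <;> linarith

end Setting


/-! ### Delta-method expansions in the coefficient of variation. -/

theorem abs_log_one_add_sub_le {v : ℝ} (hv : -(1 / 2) ≤ v) :
    |Real.log (1 + v) - v + v ^ 2 / 2| ≤ |v| ^ 3 := by
  set f : ℝ → ℝ := fun v => Real.log (1 + v) - v + v ^ 2 / 2 with hf
  have hd : ∀ t : ℝ, -(1 / 2) ≤ t → HasDerivAt f (t ^ 2 / (1 + t)) t := fun t ht => by
    have hne : 1 + t ≠ 0 := by linarith
    have h : HasDerivAt f (1 / (1 + t) - 1 + (2 : ℕ) * t ^ (2 - 1) / 2) t :=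
      ((((hasDerivAt_id t).const_add 1).log hne).sub (hasDerivAt_id t)).add ((hasDerivAt_pow 2 t).div_const 2)
    refine h.congr_deriv ?_
    push_cast
    field_simp
    ring
  have hd2 : ∀ t : ℝ, -(1 / 2) ≤ t →
      HasDerivAt (fun t => f t - t ^ 3) (t ^ 2 / (1 + t) - (3 : ℕ) * t ^ (3 - 1)) t := fun t ht =>
    (hd t ht).sub (hasDerivAt_pow 3 t)
  -- For v ≥ -1/2 the derivative v²/(1 + v) lies between 0 and 3v², so f is squeezed between 0 and
  -- v³ on either side of 0.
  have hmono : MonotoneOn f (Set.Ici (-(1 / 2))) := by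
    refine monotoneOn_of_deriv_nonneg (convex_Ici _)
      (fun t ht => (hd t ht).continuousAt.continuousWithinAt)
      (fun t ht => (hd t (interior_subset ht)).differentiableAt.differentiableWithinAt) fun t ht => ?_
    have ht' : -(1 / 2) ≤ t := interior_subset ht
    rw [(hd t ht').deriv]
    have : 0 < 1 + t := by linarith
    positivity
  have hanti : AntitoneOn (fun t => f t - t ^ 3) (Set.Ici (-(1 / 2))) := by
    refine antitoneOn_of_deriv_nonpos (convex_Ici _)
      (fun t ht => (hd2 t ht).continuousAt.continuousWithinAt)
      (fun t ht => (hd2 t (interior_subset ht)).differentiableAt.differentiableWithinAt) fun t ht => ?_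
    have ht' : -(1 / 2) ≤ t := interior_subset ht
    rw [(hd2 t ht').deriv, sub_nonpos, div_le_iff₀ (by linarith)]
    push_cast
    nlinarith [sq_nonneg t, mul_nonneg (sq_nonneg t) (by linarith : 0 ≤ t + 1 / 2)]
  have h0 : f 0 = 0 := by simp [hf]
  have hz : (0 : ℝ) ∈ Set.Ici (-(1 / 2) : ℝ) := by
    rw [Set.mem_Ici]
    norm_num
  rcases le_total 0 v with h | h
  · have h1 := hmono hz hv h
    have h2 := hanti hz hv h
    simp only [h0] at h1 h2
    rw [abs_of_nonneg h, abs_of_nonneg h1]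
    linarith
  · have h1 := hmono hv hz h
    have h2 := hanti hv hz h
    simp only [h0] at h1 h2
    rw [abs_of_nonpos h, abs_of_nonpos h1, Odd.neg_pow (by decide)]
    linarith

theorem abs_log_one_add_sub_self_le {e : ℝ} (he : 0 ≤ e) : |Real.log (1 + e) - e| ≤ e ^ 2 := by
  have h1 := Real.log_le_sub_one_of_pos (show 0 < 1 + e by linarith)
  have h2 := Real.one_sub_inv_le_log_of_pos (show 0 < 1 + e by linarith)
  have h3 : e - e ^ 2 ≤ 1 - (1 + e)⁻¹ := by
    rw [← one_div, le_sub_iff_add_le, ← le_sub_iff_add_le', div_le_iff₀ (by linarith)]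
    nlinarith [pow_nonneg he 3]
  rw [abs_le]
  constructor <;> nlinarith [sq_nonneg e]

theorem abs_sub_cube_le {x y : ℝ} (hx : 0 ≤ x) (hy : 0 ≤ y) : |x - y| ^ 3 ≤ x ^ 3 + y ^ 3 := by
  rcases le_total y x with h | h
  · rw [abs_of_nonneg (sub_nonneg.2 h)]
    have := pow_le_pow_left₀ (sub_nonneg.2 h) (show x - y ≤ x by linarith) 3
    linarith [pow_nonneg hy 3]
  · rw [abs_of_nonpos (sub_nonpos.2 h)]
    have := pow_le_pow_left₀ (show 0 ≤ -(x - y) by linarith) (show -(x - y) ≤ y by linarith) 3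
    linarith [pow_nonneg hx 3]

namespace Setting

variable {n k q : ℕ} (M : Setting n k q)

theorem one_le_meanInvR : 1 ≤ M.meanInvR := by
  rw [meanInvR_eq_add]
  linarith [integral_nonneg (μ := M.noise) (f := M.excess) fun ω => M.excess_nonneg ω]

theorem cv_nonneg : 0 ≤ M.cv :=
  div_nonneg (Real.sqrt_nonneg _) (by linarith [M.one_le_meanInvR])

theorem varInvR_nonneg : 0 ≤ M.varInvR := variance_nonneg _ _

theorem cv_sq : M.cv ^ 2 = M.varInvR / M.meanInvR ^ 2 := by
  rw [cv, div_pow, Real.sq_sqrt M.varInvR_nonneg]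

/-- The proportionality constant between the coefficient of variation of `R_k⁻¹` and the distance of
its mean from one. -/
def cvBound (q : ℕ) (d : ℝ) : ℝ := Real.sqrt (2 * (q + d))

theorem cvBound_pos (q : ℕ) {d : ℝ} (hd : 0 < d) : 0 < cvBound q d := Real.sqrt_pos.2 (by positivity)

/-- A small coefficient of variation forces R_k⁻¹ to be close to 1 in mean: its variance dominates a
multiple of (m - 1)², and m itself is bounded by absorption. -/
theorem meanInvR_le (h : cvBound q M.d * M.cv ≤ 1 / 2) :
    M.meanInvR - 1 ≤ cvBound q M.d * M.cv ∧ M.meanInvR ≤ 2 := by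
  have hm := M.one_le_meanInvR
  have hd := M.d_pos
  have ha := M.a_pos
  have hn := M.n_cast_pos
  have hg := M.g_pos
  have hK := cvBound_pos q M.d_pos
  have hK2 : cvBound q M.d ^ 2 = 2 * (q + M.d) := Real.sq_sqrt (by positivity)
  have hc := M.cv_nonneg
  have hV : M.varInvR = M.cv ^ 2 * M.meanInvR ^ 2 := by
    rw [cv_sq]
    field_simp
  set x := M.Q (Sum.elim M.bk M.bc) / M.a with hx
  set γ := M.g / n with hγ
  have hx0 : 0 ≤ x := div_nonneg (M.Q_nonneg _) ha.le
  have hγ0 : 0 < γ := by positivity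
  have e1 : M.meanInvR - 1 = γ * q + M.d * x := by
    rw [meanInvR_eq, hx, hγ]
    ring
  have e2 : M.varInvR = 2 * M.d * x * (x + 2 * γ) + 2 * γ ^ 2 * q := by
    rw [varInvR_eq, hx, hγ]
    field_simp
  -- With m - 1 = γq + dx, the difference of the two sides is 2qd(γ - x)² + 4(q + d)dxγ.
  have e3 : 2 * (M.meanInvR - 1) ^ 2 ≤ (q + M.d) * M.varInvR := by
    rw [e1, e2]
    have h1 : 0 ≤ q * M.d * (γ - x) ^ 2 := by positivity
    have h2 : 0 ≤ ((q : ℝ) + M.d) * (M.d * x * γ) := by positivity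
    nlinarith
  have e4 : (2 * (M.meanInvR - 1)) ^ 2 ≤ (cvBound q M.d * M.cv * M.meanInvR) ^ 2 := by
    rw [mul_pow (cvBound q M.d * M.cv), mul_pow (cvBound q M.d), hK2, mul_assoc (2 * _), ← hV]
    linarith
  have e5 := (abs_le_of_sq_le_sq' e4 (by positivity)).2
  have e6 := mul_le_mul_of_nonneg_right h (by linarith : 0 ≤ M.meanInvR)
  have e7 : M.meanInvR ≤ 2 := by linarith
  have e8 := mul_le_mul_of_nonneg_left e7 (mul_nonneg hK.le hc)
  exact ⟨by linarith, e7⟩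

/-- The third absolute central moment of `R_k⁻¹`. -/
def absMoment : ℝ := ∫ ω, |1 + M.excess ω - M.meanInvR| ^ 3 ∂M.noise

theorem abs_deviation_cube_le (ω : (Fin q → ℝ) × ℝ) :
    |1 + M.excess ω - M.meanInvR| ^ 3 ≤ M.excess ω ^ 3 + (M.meanInvR - 1) ^ 3 := by
  have := abs_sub_cube_le (M.excess_nonneg ω) (sub_nonneg.2 M.one_le_meanInvR)
  rwa [← sub_add, sub_add_eq_add_sub, add_comm (M.excess ω)] at this

theorem integrable_abs_deviation_cube :
    Integrable (fun ω => |1 + M.excess ω - M.meanInvR| ^ 3) M.noise := by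
  have hm : Measurable fun ω => |1 + M.excess ω - M.meanInvR| ^ 3 :=
    (((M.measurable_excess.const_add 1).sub_const _).abs).pow_const 3
  refine ((M.integrable_excess_pow 2).add (integrable_const ((M.meanInvR - 1) ^ 3))).mono'
    hm.aestronglyMeasurable (Filter.Eventually.of_forall fun ω => ?_)
  rw [Real.norm_of_nonneg (by positivity)]
  exact M.abs_deviation_cube_le ω

theorem absMoment_le : M.absMoment ≤ ∫ ω, M.excess ω ^ 3 ∂M.noise + (M.meanInvR - 1) ^ 3 := by
  have h := integral_mono M.integrable_abs_deviation_cube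
    ((M.integrable_excess_pow 2).add (integrable_const ((M.meanInvR - 1) ^ 3))) M.abs_deviation_cube_le
  simp only [Pi.add_apply] at h
  rw [integral_add (M.integrable_excess_pow 2) (integrable_const _), integral_const] at h
  simpa [absMoment] using h

/-- The constant in the bound of the third absolute central moment. -/
def momentBound (q : ℕ) (d : ℝ) : ℝ :=
  2 ^ 3 * 2 ^ 2 * (8 * (Real.Gamma (d / 2 + 3) / Real.Gamma (d / 2)) * (cvBound q d / d) ^ 3 +
    cvBound q d ^ 3 * ∫ w : Fin q → ℝ, (∑ i, w i ^ 2) ^ 3 ∂stdNormal (Fin q)) + cvBound q d ^ 3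

theorem momentBound_pos (q : ℕ) {d : ℝ} (hd : 0 < d) : 0 < momentBound q d := by
  have h1 := Real.Gamma_pos_of_pos (half_pos hd)
  have h2 := Real.Gamma_pos_of_pos (show 0 < d / 2 + 3 by positivity)
  have h3 := cvBound_pos q hd
  have h4 : 0 ≤ ∫ w : Fin q → ℝ, (∑ i, w i ^ 2) ^ 3 ∂stdNormal (Fin q) :=
    integral_nonneg fun w => pow_nonneg (Finset.sum_nonneg fun i _ => sq_nonneg _) 3
  unfold momentBound
  positivity

theorem scale_le (h : cvBound q M.d * M.cv ≤ 1 / 2) :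
    M.Q (Sum.elim M.bk M.bc) / M.a ≤ cvBound q M.d * M.cv / M.d ∧
      M.g / n * q ≤ cvBound q M.d * M.cv ∧ M.g / n ≤ cvBound q M.d * M.cv := by
  have h1 := (M.meanInvR_le h).1
  have hd := M.d_pos
  have hγ : 0 < M.g / n := div_pos M.g_pos M.n_cast_pos
  have hq : (1 : ℝ) ≤ q := Nat.one_le_cast.2 M.q_pos
  have hx : 0 ≤ M.Q (Sum.elim M.bk M.bc) / M.a := div_nonneg (M.Q_nonneg _) M.a_pos.le
  have e : M.meanInvR - 1 = M.g / n * q + M.d * (M.Q (Sum.elim M.bk M.bc) / M.a) := by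
    rw [meanInvR_eq]
    ring
  have h2 := mul_nonneg hd.le hx
  have h3 : M.g / n ≤ M.g / n * q := le_mul_of_one_le_right hγ.le hq
  refine ⟨?_, by linarith, by linarith⟩
  rw [le_div_iff₀ hd]
  linarith

/-- Q_k(b)/a, g/n and m - 1 are all O(c) by `scale_le`, and the third moment is homogeneous of
degree three in them, up to constants of q and d. -/
theorem absMoment_le_cv (h : cvBound q M.d * M.cv ≤ 1 / 2) :
    M.absMoment ≤ momentBound q M.d * M.cv ^ 3 := by
  obtain ⟨hx, -, hγ⟩ := M.scale_le h
  have h1 := (M.meanInvR_le h).1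
  have hm := M.one_le_meanInvR
  have hd := M.d_pos
  have ha := M.a_pos
  have hG1 := Real.Gamma_pos_of_pos (half_pos hd)
  have hG2 := Real.Gamma_pos_of_pos (show 0 < M.d / 2 + 3 by positivity)
  have hx0 : 0 ≤ M.Q (Sum.elim M.bk M.bc) / M.a := div_nonneg (M.Q_nonneg _) ha.le
  have hγ0 : 0 < M.g / n := div_pos M.g_pos M.n_cast_pos
  have hW : 0 ≤ ∫ w : Fin q → ℝ, (∑ i, w i ^ 2) ^ 3 ∂stdNormal (Fin q) :=
    integral_nonneg fun w => pow_nonneg (Finset.sum_nonneg fun i _ => sq_nonneg _) 3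
  have h3 := M.integral_excess_pow_le 2
  have hτ := (gamma_pow_moment (half_pos hd) (half_pos ha) 3).2
  norm_num only at h3
  push_cast at hτ
  rw [hτ] at h3
  have e1 : M.Q (Sum.elim M.bk M.bc) ^ 3 * (Real.Gamma (M.d / 2 + 3) /
      (Real.Gamma (M.d / 2) * (M.a / 2) ^ 3)) = 8 * (Real.Gamma (M.d / 2 + 3) / Real.Gamma (M.d / 2)) *
        (M.Q (Sum.elim M.bk M.bc) / M.a) ^ 3 := by
    field_simp
    norm_num
  rw [e1] at h3
  have k1 := pow_le_pow_left₀ hx0 hx 3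
  have k2 := pow_le_pow_left₀ hγ0.le hγ 3
  have k3 := pow_le_pow_left₀ (sub_nonneg.2 hm) h1 3
  have k4 := mul_le_mul_of_nonneg_left k1
    (show 0 ≤ 8 * (Real.Gamma (M.d / 2 + 3) / Real.Gamma (M.d / 2)) by positivity)
  have k5 := mul_le_mul_of_nonneg_right k2 hW
  refine M.absMoment_le.trans ?_
  have e2 : momentBound q M.d * M.cv ^ 3 =
      32 * (8 * (Real.Gamma (M.d / 2 + 3) / Real.Gamma (M.d / 2)) * (cvBound q M.d * M.cv / M.d) ^ 3 +
        (cvBound q M.d * M.cv) ^ 3 * ∫ w : Fin q → ℝ, (∑ i, w i ^ 2) ^ 3 ∂stdNormal (Fin q)) +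
        (cvBound q M.d * M.cv) ^ 3 := by
    rw [momentBound]
    ring
  rw [e2]
  linarith

theorem integral_deviation :
    Integrable (fun ω => 1 + M.excess ω - M.meanInvR) M.noise ∧
    ∫ ω, (1 + M.excess ω - M.meanInvR) ∂M.noise = 0 := by
  have h1 : Integrable (fun ω => 1 + M.excess ω) M.noise := (integrable_const _).add M.integrable_excess
  refine ⟨h1.sub (integrable_const _), ?_⟩
  rw [integral_sub h1 (integrable_const _), ← M.invR_transfer.2]
  simp

theorem integral_deviation_sq :
    Integrable (fun ω => (1 + M.excess ω - M.meanInvR) ^ 2) M.noise ∧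
    ∫ ω, (1 + M.excess ω - M.meanInvR) ^ 2 ∂M.noise = M.varInvR := by
  have e : ∀ ω, (1 + M.excess ω - M.meanInvR) ^ 2 =
      M.excess ω ^ 2 + (-(2 * (M.meanInvR - 1)) * M.excess ω + (M.meanInvR - 1) ^ 2) := fun ω => by ring
  have h2 := M.integrable_excess_pow 1
  have h1 := M.integrable_excess.const_mul (-(2 * (M.meanInvR - 1)))
  have h3 : Integrable (fun ω => -(2 * (M.meanInvR - 1)) * M.excess ω + (M.meanInvR - 1) ^ 2) M.noise :=
    h1.add (integrable_const _)
  simp only [e]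
  refine ⟨h2.add h3, ?_⟩
  rw [integral_add h2 h3, integral_add h1 (integrable_const _), integral_const_mul, varInvR_eq_sub,
    meanInvR_eq_add]
  simp
  ring

/-- Take expectations in (Y - m)²/(mY) = (m/Y - 1) + (Y - m)/m; the last term is centered. -/
theorem meanR_mul_meanInvR_sub_one :
    M.meanR * M.meanInvR - 1 =
      ∫ ω, (1 + M.excess ω - M.meanInvR) ^ 2 / (M.meanInvR * (1 + M.excess ω)) ∂M.noise := by
  have hm : M.meanInvR ≠ 0 := by linarith [M.one_le_meanInvR]
  have e : ∀ ω, (1 + M.excess ω - M.meanInvR) ^ 2 / (M.meanInvR * (1 + M.excess ω)) =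
      (M.meanInvR * (1 + M.excess ω)⁻¹ - 1) + M.meanInvR⁻¹ * (1 + M.excess ω - M.meanInvR) := fun ω => by
    have := (M.one_add_excess_pos ω).ne'
    field_simp
    ring
  have h1 := M.integrable_inv_one_add_excess.const_mul M.meanInvR
  have h2 : Integrable (fun ω => M.meanInvR * (1 + M.excess ω)⁻¹ - 1) M.noise := h1.sub (integrable_const _)
  simp only [e]
  rw [integral_add h2 (M.integral_deviation.1.const_mul _), integral_sub h1 (integrable_const _),
    integral_const_mul, integral_const_mul, M.integral_deviation.2, ← M.R_transfer.2]
  simp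
  ring

theorem meanR_mul_meanInvR_bounds (hm2 : M.meanInvR ≤ 2) :
    0 ≤ M.meanR * M.meanInvR - 1 ∧ M.meanR * M.meanInvR - 1 ≤ 2 * M.cv ^ 2 ∧
      |M.meanR * M.meanInvR - 1 - M.cv ^ 2| ≤ M.absMoment := by
  have hm := M.one_le_meanInvR
  have hm0 : 0 < M.meanInvR := by linarith
  have hY : ∀ ω, 1 ≤ 1 + M.excess ω := fun ω => by linarith [M.excess_nonneg ω]
  obtain ⟨i2, e2⟩ := M.integral_deviation_sq
  have hmeas : Measurable fun ω =>
      (1 + M.excess ω - M.meanInvR) ^ 2 / (M.meanInvR * (1 + M.excess ω)) :=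
    (((M.measurable_excess.const_add 1).sub_const _).pow_const 2).div
      ((M.measurable_excess.const_add 1).const_mul _)
  have hle : ∀ ω, (1 + M.excess ω - M.meanInvR) ^ 2 / (M.meanInvR * (1 + M.excess ω)) ≤
      M.meanInvR⁻¹ * (1 + M.excess ω - M.meanInvR) ^ 2 := fun ω => by
    rw [inv_mul_eq_div]
    exact div_le_div_of_nonneg_left (sq_nonneg _) hm0 (le_mul_of_one_le_right hm0.le (hY ω))
  have h0 : ∀ ω, 0 ≤ (1 + M.excess ω - M.meanInvR) ^ 2 / (M.meanInvR * (1 + M.excess ω)) := fun ω =>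
    div_nonneg (sq_nonneg _) (mul_nonneg hm0.le (by linarith [hY ω]))
  have hint : Integrable (fun ω =>
      (1 + M.excess ω - M.meanInvR) ^ 2 / (M.meanInvR * (1 + M.excess ω))) M.noise := by
    refine (i2.const_mul M.meanInvR⁻¹).mono' hmeas.aestronglyMeasurable
      (Filter.Eventually.of_forall fun ω => ?_)
    rw [Real.norm_of_nonneg (h0 ω)]
    exact hle ω
  have hc : M.cv ^ 2 = ∫ ω, M.meanInvR⁻¹ ^ 2 * (1 + M.excess ω - M.meanInvR) ^ 2 ∂M.noise := by
    rw [integral_const_mul, e2, cv_sq]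
    field_simp
  rw [meanR_mul_meanInvR_sub_one]
  refine ⟨integral_nonneg h0, ?_, ?_⟩
  · calc _ ≤ ∫ ω, M.meanInvR⁻¹ * (1 + M.excess ω - M.meanInvR) ^ 2 ∂M.noise :=
        integral_mono hint (i2.const_mul _) hle
      _ = M.meanInvR * M.cv ^ 2 := by
        rw [integral_const_mul, e2, cv_sq]
        field_simp
      _ ≤ 2 * M.cv ^ 2 := mul_le_mul_of_nonneg_right hm2 (sq_nonneg _)
  · rw [hc, ← integral_sub hint (i2.const_mul _), ← Real.norm_eq_abs]
    refine norm_integral_le_of_norm_le M.integrable_abs_deviation_cube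
      (Filter.Eventually.of_forall fun ω => ?_)
    have hYp := M.one_add_excess_pos ω
    -- Replacing Y by m in the denominator leaves a cubic remainder, and Y and m are both at least
    -- 1.
    have e : (1 + M.excess ω - M.meanInvR) ^ 2 / (M.meanInvR * (1 + M.excess ω)) -
        M.meanInvR⁻¹ ^ 2 * (1 + M.excess ω - M.meanInvR) ^ 2 =
        -((1 + M.excess ω - M.meanInvR) ^ 3 / (M.meanInvR ^ 2 * (1 + M.excess ω))) := by
      field_simp
      ring
    rw [e, Real.norm_eq_abs, abs_neg, abs_div, abs_pow]
    refine div_le_self (by positivity) ?_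
    rw [abs_of_nonneg (by positivity)]
    exact one_le_mul_of_one_le_of_one_le (one_le_pow₀ hm) (hY ω)

theorem meanLogR_bound (hm2 : M.meanInvR ≤ 2) :
    |-M.meanLogR - Real.log M.meanInvR + M.cv ^ 2 / 2| ≤ M.absMoment := by
  have hm := M.one_le_meanInvR
  have hm0 : 0 < M.meanInvR := by linarith
  obtain ⟨i1, e1⟩ := M.integral_deviation
  obtain ⟨i2, e2⟩ := M.integral_deviation_sq
  have hlog := M.integrable_log_one_add_excess
  have j1 : Integrable (fun ω => Real.log (1 + M.excess ω) - Real.log M.meanInvR) M.noise :=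
    hlog.sub (integrable_const _)
  have j2 : Integrable (fun ω => (Real.log (1 + M.excess ω) - Real.log M.meanInvR) -
      M.meanInvR⁻¹ * (1 + M.excess ω - M.meanInvR)) M.noise := j1.sub (i1.const_mul _)
  have hint : ∫ ω, (((Real.log (1 + M.excess ω) - Real.log M.meanInvR) -
      M.meanInvR⁻¹ * (1 + M.excess ω - M.meanInvR)) +
      (M.meanInvR⁻¹ ^ 2 / 2) * (1 + M.excess ω - M.meanInvR) ^ 2) ∂M.noise =
      -M.meanLogR - Real.log M.meanInvR + M.cv ^ 2 / 2 := by
    rw [integral_add j2 (i2.const_mul _), integral_sub j1 (i1.const_mul _),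
      integral_sub hlog (integrable_const _), integral_const_mul, integral_const_mul, e1, e2, cv_sq,
      M.logR_transfer.2, integral_neg]
    simp
    field_simp
  rw [← hint, ← Real.norm_eq_abs]
  refine norm_integral_le_of_norm_le M.integrable_abs_deviation_cube
    (Filter.Eventually.of_forall fun ω => ?_)
  have hYp := M.one_add_excess_pos ω
  set v := M.meanInvR⁻¹ * (1 + M.excess ω - M.meanInvR) with hv
  have hv1 : 1 + v = (1 + M.excess ω) / M.meanInvR := by
    rw [hv]
    field_simp
    ring
  -- Here Y ≥ 1 and m ≤ 2 keep the relative deviation within the range of the cubic Taylor bound.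
  have hv2 : -(1 / 2) ≤ v := by
    have : 1 / 2 ≤ (1 + M.excess ω) / M.meanInvR := by
      rw [div_le_div_iff₀ two_pos hm0]
      linarith [M.excess_nonneg ω]
    linarith
  have h := abs_log_one_add_sub_le hv2
  rw [hv1, Real.log_div hYp.ne' hm0.ne'] at h
  have h2 : M.meanInvR⁻¹ ^ 2 / 2 * (1 + M.excess ω - M.meanInvR) ^ 2 = v ^ 2 / 2 := by
    rw [hv]
    ring
  rw [h2, Real.norm_eq_abs]
  refine h.trans (pow_le_pow_left₀ (abs_nonneg _) ?_ 3)
  rw [hv, abs_mul, abs_of_pos (inv_pos.2 hm0)]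
  exact mul_le_of_le_one_left (abs_nonneg _) (inv_le_one_of_one_le₀ hm)

end Setting


/-! ### From errors in the equations to errors in the hyperparameters. -/

theorem abs_log_one_add_le {ε : ℝ} (h : |ε| ≤ 1 / 2) : |Real.log (1 + ε)| ≤ 2 * |ε| := by
  obtain ⟨ha, hb⟩ := abs_le.1 h
  have hpos : 0 < 1 + ε := by linarith
  have h1 := Real.log_le_sub_one_of_pos hpos
  have h2 := Real.one_sub_inv_le_log_of_pos hpos
  have h3 : 1 - (1 + ε)⁻¹ = ε / (1 + ε) := by
    field_simp
    ring
  have h4 : |ε / (1 + ε)| ≤ 2 * |ε| := by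
    rw [abs_div, abs_of_pos hpos, div_le_iff₀ hpos]
    nlinarith [abs_nonneg ε]
  rw [abs_le]
  constructor
  · linarith [neg_abs_le (ε / (1 + ε))]
  · linarith [le_abs_self ε, abs_nonneg ε]

theorem abs_div_one_add_sub_one_le {r η A B : ℝ} (hr : |r - 1| ≤ A) (hη : |η| ≤ B) (hB : B ≤ 1 / 2) :
    |r / (1 + η) - 1| ≤ 2 * (A + B) := by
  have hpos : 1 / 2 ≤ 1 + η := by linarith [neg_abs_le η]
  have h : r / (1 + η) - 1 = (r - 1 - η) / (1 + η) := by
    rw [div_sub_one (by linarith)]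
    ring
  have h2 : |r - 1 - η| ≤ A + B := (abs_sub _ _).trans (add_le_add hr hη)
  rw [h, abs_div, abs_of_pos (show 0 < 1 + η by linarith), div_le_iff₀ (by linarith)]
  nlinarith [abs_nonneg (r - 1 - η)]

/-- Stability of the solutions of the equations that determine the shape parameters. -/
theorem abs_div_sub_one_le_of_digammaGap {d x y s η : ℝ} (hd : 0 < d) (hx : 0 < x) (hy : 0 < y)
    (hs : 0 ≤ s) (hys : digammaGap y = digammaGap (d / 2) + s)
    (hs' : s ≤ digammaGap (d / 4) - digammaGap (d / 2))
    (hxy : |digammaGap x - digammaGap y| ≤ η) (hη : η ≤ digammaGap (d / 2) - digammaGap d) :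
    |x / y - 1| ≤ 4 * d * (d + 1) * η := by
  have hη0 : 0 ≤ η := (abs_nonneg _).trans hxy
  obtain ⟨h1, h2⟩ := abs_le.1 hxy
  -- The two smallness conditions confine y to [d/4, d/2] and x to (0, d], where the decrease of the
  -- gap has rate at least 1/(d²(d + 1)); dividing by y ≥ d/4 gives 4d(d + 1).
  have hy1 : y ≤ d / 2 := (digammaGap_le_iff (half_pos hd) hy).1 (by linarith)
  have hy2 : d / 4 ≤ y := (digammaGap_le_iff hy (by positivity)).1 (by linarith)
  have hx1 : x ≤ d := (digammaGap_le_iff hd hx).1 (by linarith)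
  have key : ∀ {u v : ℝ}, 0 < u → u ≤ v → v ≤ d → digammaGap u - digammaGap v ≤ η →
      v - u ≤ η * (d ^ 2 * (d + 1)) := fun {u v} hu huv hv h => by
    have hv0 := hu.trans_le huv
    have h3 := (digammaGap_sub hu huv).trans h
    rw [div_le_iff₀ (by positivity)] at h3
    refine h3.trans (mul_le_mul_of_nonneg_left ?_ hη0)
    gcongr
  have h3 : |x - y| ≤ η * (d ^ 2 * (d + 1)) := by
    rcases le_total x y with h | h
    · rw [abs_sub_comm, abs_of_nonneg (sub_nonneg.2 h)]
      exact key hx h (by linarith) h2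
    · rw [abs_of_nonneg (sub_nonneg.2 h)]
      exact key hy h hx1 (by linarith)
  rw [div_sub_one hy.ne', abs_div, abs_of_pos hy, div_le_iff₀ hy]
  refine h3.trans ?_
  have h4 : 4 * d * (d + 1) * η * (d / 4) ≤ 4 * d * (d + 1) * η * y :=
    mul_le_mul_of_nonneg_left hy2 (by positivity)
  linarith

namespace Setting

variable {n k q : ℕ} (M : Setting n k q)

theorem integral_excess_mul_precision_le :
    Integrable (fun ω : (Fin q → ℝ) × ℝ => M.excess ω * ω.2) M.noise ∧
    ∫ ω, M.excess ω * ω.2 ∂M.noise ≤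
      2 * (M.d / M.a) * (M.Q (Sum.elim M.bk M.bc) / M.a * (M.d + 2) + M.g / n * q) := by
  have hd := M.d_pos
  have ha := M.a_pos
  have i1 : Integrable (fun ω : (Fin q → ℝ) × ℝ => M.Q (Sum.elim M.bk M.bc) * ω.2 ^ 2) M.noise :=
    (M.integrable_precision_pow 2).const_mul _
  have hsq : Integrable (fun w : Fin q → ℝ => ∑ i, w i ^ 2) (stdNormal (Fin q)) := by
    simpa using integrable_normSq_pow (Fin q) 0
  have hτ : Integrable (fun t : ℝ => t) (gammaMeasure (M.d / 2) (M.a / 2)) := by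
    simpa using (gamma_pow_moment (half_pos hd) (half_pos ha) 1).1
  have i2 : Integrable (fun ω : (Fin q → ℝ) × ℝ => M.g / n * ((∑ i, ω.1 i ^ 2) * ω.2)) M.noise :=
    (hsq.mul_prod hτ).const_mul _
  have e2 : ∫ ω : (Fin q → ℝ) × ℝ, (∑ i, ω.1 i ^ 2) * ω.2 ∂M.noise = q * (M.d / M.a) := by
    rw [integral_prod_mul (fun w : Fin q → ℝ => ∑ i, w i ^ 2) (fun t : ℝ => t),
      gamma_mean (half_pos hd) (half_pos ha)]
    have := (noncentral_moments (0 : Fin q → ℝ) 1).1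
    simp only [Pi.zero_apply, zero_add, one_mul, Fintype.card_fin] at this
    rw [this, div_div_div_cancel_right₀ two_ne_zero]
    simp
  have hle : ∀ᵐ ω ∂M.noise, M.excess ω * ω.2 ≤
      2 * (M.Q (Sum.elim M.bk M.bc) * ω.2 ^ 2 + M.g / n * ((∑ i, ω.1 i ^ 2) * ω.2)) := by
    filter_upwards [M.ae_noise_pos] with ω hω
    refine (mul_le_mul_of_nonneg_right (M.excess_le hω) hω.le).trans_eq ?_
    ring
  have hint : Integrable (fun ω : (Fin q → ℝ) × ℝ => M.excess ω * ω.2) M.noise := by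
    refine ((i1.add i2).const_mul 2).mono' (M.measurable_excess.mul measurable_snd).aestronglyMeasurable ?_
    filter_upwards [hle, M.ae_noise_pos] with ω h hω
    rw [Real.norm_of_nonneg (mul_nonneg (M.excess_nonneg ω) hω.le)]
    exact h
  refine ⟨hint, (integral_mono_ae hint ((i1.add i2).const_mul 2) hle).trans_eq ?_⟩
  simp only [Pi.add_apply]
  rw [integral_const_mul, integral_add i1 i2, integral_const_mul, integral_const_mul, e2,
    M.integral_precision_comp (fun t => t ^ 2), M.mean_precision_sq]
  field_simp

/-- The constant in the relative error of `E[R_k / σ²]`. -/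
def precBound (q : ℕ) (d : ℝ) : ℝ := 2 * (cvBound q d * (d + 2) / d + cvBound q d)

theorem cvBound_le_precBound (q : ℕ) {d : ℝ} (hd : 0 < d) : cvBound q d ≤ precBound q d := by
  have := cvBound_pos q hd
  have h : 0 ≤ cvBound q d * (d + 2) / d := by positivity
  unfold precBound
  linarith

/-- From 1 - e ≤ 1/(1 + e) ≤ 1 for e = `excess`, weighted by the precision. The correction E[eT] is
O(c) relative to E[T]. -/
theorem meanRPrec_bounds (h : cvBound q M.d * M.cv ≤ 1 / 2) :
    M.meanRPrec ≤ M.d / M.a ∧ M.d / M.a * (1 - precBound q M.d * M.cv) ≤ M.meanRPrec := by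
  have hd := M.d_pos
  have ha := M.a_pos
  obtain ⟨hx, hγ, -⟩ := M.scale_le h
  obtain ⟨hint, hle⟩ := M.integral_excess_mul_precision_le
  rw [M.RPrec_transfer.2]
  constructor
  · rw [← M.mean_precision, ← M.integral_precision_comp fun t => t]
    refine integral_mono_ae M.integrable_inv_mul_precision M.integrable_precision ?_
    filter_upwards [M.ae_noise_pos] with ω hω
    exact mul_le_of_le_one_left hω.le (M.inv_one_add_excess_le_one ω)
  · have h1 : ∫ ω : (Fin q → ℝ) × ℝ, (ω.2 - M.excess ω * ω.2) ∂M.noise ≤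
        ∫ ω : (Fin q → ℝ) × ℝ, (1 + M.excess ω)⁻¹ * ω.2 ∂M.noise := by
      refine integral_mono_ae (M.integrable_precision.sub hint) M.integrable_inv_mul_precision ?_
      filter_upwards [M.ae_noise_pos] with ω hω
      have h0 := M.excess_nonneg ω
      have h2 : 1 - M.excess ω ≤ (1 + M.excess ω)⁻¹ := by
        rw [← one_div, le_div_iff₀ (M.one_add_excess_pos ω)]
        nlinarith
      have := mul_le_mul_of_nonneg_right h2 hω.le
      linarith
    rw [integral_sub M.integrable_precision hint, M.integral_precision_comp fun t => t,
      M.mean_precision] at h1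
    refine le_trans ?_ h1
    have h3 : M.Q (Sum.elim M.bk M.bc) / M.a * (M.d + 2) + M.g / n * q ≤
        cvBound q M.d * M.cv / M.d * (M.d + 2) + cvBound q M.d * M.cv := by gcongr
    have h4 := mul_le_mul_of_nonneg_left h3 (show 0 ≤ 2 * (M.d / M.a) by positivity)
    have h5 : M.d / M.a * (precBound q M.d * M.cv) = 2 * (M.d / M.a) *
        (cvBound q M.d * M.cv / M.d * (M.d + 2) + cvBound q M.d * M.cv) := by
      rw [precBound]
      ring
    rw [mul_sub, mul_one, h5]
    linarith

theorem meanR_bounds (h : cvBound q M.d * M.cv ≤ 1 / 2) :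
    M.meanR ≤ 1 ∧ 1 - cvBound q M.d * M.cv ≤ M.meanR := by
  have h1 := (M.meanInvR_le h).1
  rw [M.R_transfer.2]
  constructor
  · have := integral_mono M.integrable_inv_one_add_excess (integrable_const 1) M.inv_one_add_excess_le_one
    simpa using this
  · have h2 : ∫ ω, (1 - M.excess ω) ∂M.noise ≤ ∫ ω, (1 + M.excess ω)⁻¹ ∂M.noise := by
      refine integral_mono ((integrable_const _).sub M.integrable_excess) M.integrable_inv_one_add_excess
        fun ω => ?_
      have h0 := M.excess_nonneg ω
      simp only
      rw [← one_div, le_div_iff₀ (M.one_add_excess_pos ω)]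
      nlinarith
    rw [integral_sub (integrable_const _) M.integrable_excess] at h2
    rw [meanInvR_eq_add] at h1
    simp only [integral_const, probReal_univ, one_smul] at h2
    linarith

theorem abs_meanRPrec_div_sub_one_le (h : cvBound q M.d * M.cv ≤ 1 / 2) :
    |M.meanRPrec / (M.meanR * (M.d / M.a)) - 1| ≤ 2 * precBound q M.d * M.cv := by
  have hA : 0 < M.d / M.a := div_pos M.d_pos M.a_pos
  obtain ⟨p1, p2⟩ := M.meanRPrec_bounds h
  obtain ⟨r1, r2⟩ := M.meanR_bounds h
  have hR := M.meanR_pos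
  have hc := M.cv_nonneg
  have hK := mul_le_mul_of_nonneg_right (cvBound_le_precBound q M.d_pos) hc
  set A := M.d / M.a with hAdef
  have hP : 0 ≤ precBound q M.d * M.cv := le_trans (mul_nonneg (cvBound_pos q M.d_pos).le hc) hK
  rw [div_sub_one (by positivity), abs_div, abs_of_pos (by positivity : 0 < M.meanR * A),
    div_le_iff₀ (by positivity), abs_le]
  have h1 : A * (precBound q M.d * M.cv) * 1 ≤ A * (precBound q M.d * M.cv) * (2 * M.meanR) :=
    mul_le_mul_of_nonneg_left (by linarith) (by positivity)
  have h2 : A * M.meanR ≤ A * 1 := mul_le_mul_of_nonneg_left r1 hA.le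
  have h3 : A * (1 - cvBound q M.d * M.cv) ≤ A * M.meanR := mul_le_mul_of_nonneg_left r2 hA.le
  have h4 := mul_le_mul_of_nonneg_left hK hA.le
  constructor <;> linarith

/-- Up to O(c³), E[log R_k] = -log m + c²/2 and log E[R_k] = -log m + c²; the difference is -c²/2.
The square of e = mE[R_k] - 1 is O(c⁴), absorbed into c³ by c ≤ 1. -/
theorem abs_meanLogR_sub_le (h : cvBound q M.d * M.cv ≤ 1 / 2) (hc1 : M.cv ≤ 1) :
    |M.meanLogR - Real.log M.meanR + 1 / 2 * (M.varInvR / M.meanInvR ^ 2)| ≤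
      (2 * momentBound q M.d + 4) * M.cv ^ 3 := by
  have hm2 := (M.meanInvR_le h).2
  have hm := M.one_le_meanInvR
  have hR := M.meanR_pos
  have hc := M.cv_nonneg
  obtain ⟨b1, b2, b3⟩ := M.meanR_mul_meanInvR_bounds hm2
  have b4 := M.meanLogR_bound hm2
  have b5 := M.absMoment_le_cv h
  set e := M.meanR * M.meanInvR - 1 with he
  have b6 := abs_log_one_add_sub_self_le b1
  have hlog : Real.log (1 + e) = Real.log M.meanR + Real.log M.meanInvR := by
    rw [he, add_sub_cancel, Real.log_mul hR.ne' (by linarith)]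
  have b7 : e ^ 2 ≤ 4 * M.cv ^ 3 := by
    calc e ^ 2 ≤ (2 * M.cv ^ 2) ^ 2 := pow_le_pow_left₀ b1 b2 2
      _ = 4 * M.cv ^ 3 * M.cv := by ring
      _ ≤ 4 * M.cv ^ 3 := mul_le_of_le_one_right (by positivity) hc1
  rw [← cv_sq]
  rw [hlog] at b6
  rw [abs_le] at b3 b4 b6 ⊢
  constructor <;> linarith

theorem deltaSystem_iff (h : Hyper k) : M.DeltaSystem h ↔ h.b = M.projMean ∧
    h.g = M.g / M.meanInvR ∧ h.a = h.d * (M.a / M.d) * M.meanInvR ∧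
      digammaGap (h.d / 2) = digammaGap (M.d / 2) + 1 / 2 * M.cv ^ 2 := by
  unfold DeltaSystem
  rw [cv_sq, digammaGap, digammaGap]
  refine and_congr_right fun _ => and_congr_right fun _ => and_congr_right fun _ => ?_
  constructor <;> intro <;> linarith

theorem existsUnique_deltaSystem : ∃! h : Hyper k, M.DeltaSystem h := by
  have hm : 0 < M.meanInvR := by linarith [M.one_le_meanInvR]
  have ha := M.a_pos
  have hd := M.d_pos
  have hpos : 0 < digammaGap (M.d / 2) + 1 / 2 * M.cv ^ 2 := by
    have := digammaGap_pos (half_pos hd)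
    positivity
  obtain ⟨x, hx, hgap⟩ := exists_digammaGap_eq hpos
  refine ⟨⟨M.projMean, M.g / M.meanInvR, 2 * x, 2 * x * (M.a / M.d) * M.meanInvR,
    div_pos M.g_pos hm, by positivity, by positivity⟩, ?_, fun h hh => ?_⟩
  · simp only
    rw [deltaSystem_iff]
    refine ⟨rfl, rfl, rfl, ?_⟩
    simpa using hgap
  · obtain ⟨h1, h2, h3, h4⟩ := (M.deltaSystem_iff h).1 hh
    have h5 := digammaGap_inj (half_pos h.d_pos) hx (h4.trans hgap.symm)
    have h6 : h.d = 2 * x := by linarith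
    cases h
    simp only at h1 h2 h3 h6
    subst h6
    simp [h1, h2, h3]

/-- Rewrites the exact digamma equation so that it differs from the delta equation only by the two
replacement errors. -/
theorem exactSystem_digammaGap {h : Hyper k} (he : M.ExactSystem h) :
    digammaGap (h.d / 2) = digammaGap (M.d / 2) +
      Real.log (M.meanRPrec / (M.meanR * (M.d / M.a))) - (M.meanLogR - Real.log M.meanR) := by
  have ha := M.a_pos
  have hd := M.d_pos
  rw [((M.exactSystem_iff h).1 he).2.2.2, meanLogVar, digammaGap,
    Real.log_div M.meanRPrec_pos.ne' (mul_pos M.meanR_pos (div_pos hd ha)).ne',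
    Real.log_mul M.meanR_pos.ne' (div_pos hd ha).ne', Real.log_div hd.ne' ha.ne',
    Real.log_div ha.ne' two_ne_zero, Real.log_div hd.ne' two_ne_zero]
  ring

/-- The delta-method replacements and the resulting hyperparameters are accurate for a small
coefficient of variation of `R_k⁻¹`. -/
theorem delta_method_error (q : ℕ) (d : ℝ) (hd : 0 < d) : ∃ C δ : ℝ, 0 < C ∧ 0 < δ ∧
    ∀ {n k : ℕ} (M : Setting n k q), M.d = d → M.cv ≤ δ →
      |M.meanR * M.meanInvR - 1| ≤ C * M.cv ^ 2 ∧
      |M.meanRPrec / (M.meanR * (M.d / M.a)) - 1| ≤ C * M.cv ∧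
      |M.meanLogR - Real.log M.meanR + 1 / 2 * (M.varInvR / M.meanInvR ^ 2)| ≤ C * M.cv ^ 3 ∧
      ∀ h h' : Hyper k, M.ExactSystem h → M.DeltaSystem h' →
        h.b = h'.b ∧
        |h.g / h'.g - 1| ≤ C * M.cv ^ 2 ∧
        |h.a / h'.a - 1| ≤ C * M.cv ∧
        |h.d / h'.d - 1| ≤ C * M.cv := by
  have hK := cvBound_pos q hd
  set K := cvBound q d with hKdef
  have hP : 0 < precBound q d := hK.trans_le (cvBound_le_precBound q hd)
  set P := 2 * precBound q d with hPdef
  have hP0 : 0 < P := by positivity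
  have hB := momentBound_pos q hd
  set B := 2 * momentBound q d + 4 with hBdef
  have hB0 : 0 < B := by positivity
  have hG₁ : 0 < digammaGap (d / 4) - digammaGap (d / 2) :=
    sub_pos.2 (digammaGap_lt (by positivity) (by linarith))
  have hG₂ : 0 < digammaGap (d / 2) - digammaGap d :=
    sub_pos.2 (digammaGap_lt (by positivity) (by linarith))
  set G₁ := digammaGap (d / 4) - digammaGap (d / 2) with hG₁def
  set G₂ := digammaGap (d / 2) - digammaGap d with hG₂def
  -- Each summand encodes one smallness condition on c, and all are positive, so c ≤ 1/S yields
  -- every condition at once.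
  set S := 1 + 2 * K + 1 / G₁ + (2 * P + B) / G₂ + 2 * (P + 3) with hS
  set D := 4 * d * (d + 1) * (2 * P + B) with hD
  have hS0 : 0 < S := by positivity
  have hD0 : 0 < D := by positivity
  refine ⟨2 + P + B + D + 2 * (D + (P + 3)), 1 / S, by positivity, by positivity,
    fun {n k} M hMd hc => ?_⟩
  subst hMd
  have c0 := M.cv_nonneg
  set c := M.cv with hcdef
  rw [le_div_iff₀ hS0, hS] at hc
  have t1 : 0 ≤ c * K := by positivity
  have t2 : 0 ≤ c * (1 / G₁) := by positivity
  have t3 : 0 ≤ c * ((2 * P + B) / G₂) := by positivity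
  have t4 : 0 ≤ c * P := by positivity
  have hK2 : K * c ≤ 1 / 2 := by linarith
  have hc1 : c ≤ 1 := by linarith
  have hG1c : c ≤ G₁ := by
    have : c * (1 / G₁) ≤ 1 := by linarith
    rwa [mul_one_div, div_le_one hG₁] at this
  have hG2c : (2 * P + B) * c ≤ G₂ := by
    have : c * ((2 * P + B) / G₂) ≤ 1 := by linarith
    rwa [← mul_div_assoc, div_le_one hG₂, mul_comm] at this
  have hPc : (P + 3) * c ≤ 1 / 2 := by linarith
  have hc2 : c ^ 2 ≤ c := by nlinarith
  have hc3 : c ^ 3 ≤ c := by nlinarith [pow_le_one₀ c0 hc1 (n := 2)]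
  obtain ⟨a1, a2, -⟩ := M.meanR_mul_meanInvR_bounds (M.meanInvR_le hK2).2
  have aP := M.abs_meanRPrec_div_sub_one_le hK2
  have aL := M.abs_meanLogR_sub_le hK2 hc1
  have a3 : |M.meanR * M.meanInvR - 1| ≤ 2 * c ^ 2 := by rwa [abs_of_nonneg a1]
  have m1 : 0 ≤ (P + B + D + 2 * (D + (P + 3))) * c ^ 2 := by positivity
  have m2 : 0 ≤ (2 + B + D + 2 * (D + (P + 3))) * c := by positivity
  have m3 : 0 ≤ (2 + P + D + 2 * (D + (P + 3))) * c ^ 3 := by positivity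
  have m4 : 0 ≤ (2 + P + B + D) * c := by positivity
  have m5 : 0 ≤ (2 + P + B + 2 * (D + (P + 3))) * c := by positivity
  refine ⟨by linarith, by linarith, by linarith, fun h h' hh hh' => ?_⟩
  have hgap := M.exactSystem_digammaGap hh
  rw [exactSystem_iff] at hh
  rw [deltaSystem_iff] at hh'
  obtain ⟨x1, x2, x3, -⟩ := hh
  obtain ⟨y1, y2, y3, y4⟩ := hh'
  set ε := M.meanRPrec / (M.meanR * (M.d / M.a)) - 1 with hε
  have hε1 : M.meanRPrec / (M.meanR * (M.d / M.a)) = 1 + ε := by rw [hε, add_sub_cancel]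
  have hε2 : |ε| ≤ P * c := aP
  have hε3 : |ε| ≤ 1 / 2 := by linarith
  have hlog := abs_log_one_add_le hε3
  -- The logarithm of the O(c) factorization error dominates the O(c³) error of the logarithmic
  -- mean.
  have hη : |digammaGap (h.d / 2) - digammaGap (h'.d / 2)| ≤ (2 * P + B) * c := by
    have e : digammaGap (h.d / 2) - digammaGap (h'.d / 2) = Real.log (1 + ε) -
        (M.meanLogR - Real.log M.meanR + 1 / 2 * (M.varInvR / M.meanInvR ^ 2)) := by
      rw [hgap, y4, hε1, ← cv_sq]
      ring
    rw [e]
    refine (abs_sub _ _).trans ?_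
    have := mul_le_mul_of_nonneg_left hc3 hB0.le
    linarith
  have hdr : |h.d / h'.d - 1| ≤ D * c := by
    have := abs_div_sub_one_le_of_digammaGap M.d_pos (half_pos h.d_pos) (half_pos h'.d_pos)
      (by positivity) y4 (by linarith) hη hG2c
    rw [div_div_div_cancel_right₀ two_ne_zero] at this
    refine this.trans_eq ?_
    rw [hD]
    ring
  have hg := M.g_pos
  have ha := M.a_pos
  have hd' := M.d_pos
  have hm : 0 < M.meanInvR := by linarith [M.one_le_meanInvR]
  have hR := M.meanR_pos
  have hp := M.meanRPrec_pos
  have hgr : h.g / h'.g = M.meanR * M.meanInvR := by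
    rw [x2, y2]
    field_simp
  set e := M.meanR * M.meanInvR - 1 with he
  have har : h.a / h'.a = h.d / h'.d / (1 + (ε + e + ε * e)) := by
    have e1 : 1 + (ε + e + ε * e) = M.meanRPrec / (M.meanR * (M.d / M.a)) * (M.meanR * M.meanInvR) := by
      rw [hε1, he]
      ring
    have := h'.d_pos
    rw [x3, y3, e1]
    field_simp
  -- With |ε| ≤ 1/2 and |e| ≤ 2c² ≤ 2c, the terms containing e contribute at most 3c.
  have hηa : |ε + e + ε * e| ≤ (P + 3) * c := by
    have e2 : |ε * e| ≤ 1 / 2 * |e| := by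
      rw [abs_mul]
      exact mul_le_mul_of_nonneg_right hε3 (abs_nonneg _)
    have e3 := abs_add_le (ε + e) (ε * e)
    have e4 := abs_add_le ε e
    linarith
  refine ⟨x1.trans y1.symm, ?_, ?_, by linarith⟩
  · rw [hgr]
    linarith
  · rw [har]
    have := abs_div_one_add_sub_one_le hdr hηa hPc
    linarith

end Setting

end GPrior

end

/-! ### Assembly of the statement. -/

theorem proposition4 :
    -- integrability, and the analytical expressions for `E[R_k⁻¹]` and `Var[R_k⁻¹]`
    (∀ {n k q : ℕ} (M : GPrior.Setting n k q),
      Integrable M.R M.prior ∧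
      Integrable (fun θ => M.R θ / θ.2) M.prior ∧
      Integrable (fun θ => Real.log (M.R θ)) M.prior ∧
      MemLp (fun θ => (M.R θ)⁻¹) 2 M.prior ∧
      M.meanInvR = 1 + M.g / n * q + M.Q (Sum.elim M.bk M.bc) * (M.d / M.a) ∧
      M.varInvR =
        2 * M.d / M.a * M.Q (Sum.elim M.bk M.bc) *
            (M.Q (Sum.elim M.bk M.bc) / M.a + 2 * M.g / n) +
          2 * M.g ^ 2 / (n : ℝ) ^ 2 * q) ∧
    -- the case `b_{\k} = 0`
    (∀ {n k q : ℕ} (M : GPrior.Setting n k q), M.bc = 0 →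
      (∃! h : GPrior.Hyper k, M.IsKLConjugateApprox h) ∧
      (∀ h : GPrior.Hyper k, M.IsKLConjugateApprox h ↔ M.CentralSystem h) ∧
      M.meanR =
        (2 * M.g / n) ^ (-(q : ℝ) / 2) * Real.exp (n / (2 * M.g)) *
          GPrior.upperGamma (1 - (q : ℝ) / 2) (n / (2 * M.g))) ∧
    -- the case `b_{\k} ≠ 0`
    (∀ {n k q : ℕ} (M : GPrior.Setting n k q), M.bc ≠ 0 →
      (∃! h : GPrior.Hyper k, M.IsKLConjugateApprox h) ∧
      (∀ h : GPrior.Hyper k, M.IsKLConjugateApprox h ↔ M.ExactSystem h) ∧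
      (∃! h : GPrior.Hyper k, M.DeltaSystem h)) ∧
    (∀ (q : ℕ) (d : ℝ), 0 < q → 0 < d → ∃ C δ : ℝ, 0 < C ∧ 0 < δ ∧
      ∀ {n k : ℕ} (M : GPrior.Setting n k q), M.d = d → M.bc ≠ 0 → M.cv ≤ δ →
        -- the delta-method replacements of the expectations in the exact system
        |M.meanR * M.meanInvR - 1| ≤ C * M.cv ^ 2 ∧
        |M.meanRPrec / (M.meanR * (M.d / M.a)) - 1| ≤ C * M.cv ∧
        |M.meanLogR - Real.log M.meanR + 1 / 2 * (M.varInvR / M.meanInvR ^ 2)| ≤ C * M.cv ^ 3 ∧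
        -- the KL-conjugate approximation is approximately the solution of the delta system
        ∀ h h' : GPrior.Hyper k, M.IsKLConjugateApprox h → M.DeltaSystem h' →
          h.b = h'.b ∧
          |h.g / h'.g - 1| ≤ C * M.cv ^ 2 ∧
          |h.a / h'.a - 1| ≤ C * M.cv ∧
          |h.d / h'.d - 1| ≤ C * M.cv) := by
  refine ⟨fun M => ⟨M.integrable_R, M.integrable_RPrec, M.integrable_logR, M.memLp_invR,
    M.meanInvR_eq, M.varInvR_eq⟩, fun M hbc => ⟨M.existsUnique_isKLConjugateApprox, fun h =>
    (M.isKLConjugateApprox_iff_exactSystem h).trans (M.exactSystem_iff_centralSystem hbc h),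
    M.meanR_central hbc⟩, fun M _ => ⟨M.existsUnique_isKLConjugateApprox,
    M.isKLConjugateApprox_iff_exactSystem, M.existsUnique_deltaSystem⟩, fun q d _ hd => ?_⟩
  obtain ⟨C, δ, hC, hδ, h⟩ := GPrior.Setting.delta_method_error q d hd
  refine ⟨C, δ, hC, hδ, fun M hMd _ hc => ?_⟩
  obtain ⟨h1, h2, h3, h4⟩ := h M hMd hc
  exact ⟨h1, h2, h3, fun η η' hη => h4 η η' ((M.isKLConjugateApprox_iff_exactSystem η).1 hη)⟩
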